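/- **Setting.** Let $\mathbb{R}^{4,2}$ be $\mathbb{R}^6$ with an inner product $(\cdot,\cdot)$ of signature $(4,2)$ and lightcone $\mathcal L$; identify $\mathfrak{o}(4,2)$ with $\wedge^2\mathbb{R}^{4,2}$ by $(a\wedge b)c=(a,c)b-(b,c)a$, and put $a\odot b=\tfrac12(a\otimes b+b\otimes a)$. Let $\Sigma$ be a connected smooth surface and let $f$ be an umbilic-free Legendre map on $\Sigma$: a smooth rank 2 isotropic subbundle of $\Sigma\times\mathbb{R}^{4,2}$ such that $d_X\sigma\in f^\perp$ for all sections $\sigma$ of $f$ and all tangent vectors $X$, such that $d_X\sigma\in f$ for all sections $\sigma$ of $f$ only if $X=0$, and such that at no point there is exactly one curvature sphere. (A curvature sphere at $x$ is a line $s\le f(x)$ such that, for some $X\neq0$, $d_X\sigma\in f(x)$ for all sections $\sigma$ of $f$ with $\sigma(x)\in s$.) Locally there are then two curvature sphere congruences $s_1,s_2$, with curvature directions $T_1,T_2$; with $S_1=\langle\sigma_1,d_Y\sigma_1,d_Yd_Y\sigma_1\rangle$ and $S_2=\langle\sigma_2,d_X\sigma_2,d_Xd_X\sigma_2\rangle$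 for non-vanishing $\sigma_i\in\Gamma s_i$, $X\in\Gamma T_1$, $Y\in\Gamma T_2$, one has $\mathbb{R}^{4,2}=S_1\oplus_\perp S_2$. *Linear Weingarten surfaces.* A space form vector $\mathfrak q\ne0$ and a point sphere complex $\mathfrak p$ satisfy $(\mathfrak p,\mathfrak p)=\pm1$, $(\mathfrak q,\mathfrak p)=0$; they define the (Riemannian or Lorentzian) space form $\mathfrak Q^3=\{y\in\mathcal L:(y,\mathfrak q)=-1,\ (y,\mathfrak p)=0\}$. The map $f$ projects to $\mathfrak f:\Sigma\to\mathfrak Q^3$ with tangent plane congruence $\mathfrak t$ if $\mathfrak f,\mathfrak t$ are smooth sections of $f$ with $(\mathfrak f,\mathfrak q)=-1$, $(\mathfrak f,\mathfrak p)=0$, $(\mathfrak t,\mathfrak q)=0$, $(\mathfrak t,\mathfrak p)=-1$. Where $\mathfrak f$ immerses, its shape operator $A$ is given by $d\mathfrak t=-d\mathfrak f\circ A$, and $K=\det A$, $H=\frac12\operatorname{tr}A$. For real $a,b,c$, not all zero, $\mathfrak f$ is linear Weingarten with condition $[W]$, $W=a\,\mathfrak q\odot\mathfrak q+2b\,\mathfrak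 q\odot\mathfrak p+c\,\mathfrak p\odot\mathfrak p$, if $aK+2bH+c=0$ wherever $\mathfrak f$ immerses; it is non-tubular if $b^2-ac\neq0$. *Ω-surfaces.* $f$ is an Ω-surface if there is a closed $\eta\in\Omega^1(f\wedge f^\perp)$ with $[\eta\wedge\eta]=0$ whose quadratic differential $q(X,Y)=\operatorname{tr}(\sigma\mapsto\eta(X)d_Y\sigma:f\to f)$ is non-zero, non-degenerate on a dense open set, and of constant signature. Such an $\eta$ is a middle potential $\eta^{mid}$ if its component in $S_1\wedge S_2$, with respect to $\mathfrak{o}(4,2)=(S_1\wedge S_1\oplus S_2\wedge S_2)\oplus S_1\wedge S_2$, takes values in $\wedge^2f$; $d+t\eta^{mid}$ is then a middle pencil of $f$. A linear conserved quantity is a polynomial $p(t)=p_0+tp_1$ with $p_0,p_1:\Sigma\to\mathbb{R}^{4,2}$ smooth and $p_1\not\equiv 0$ such that $(d+t\eta^{mid})p(t)=0$ for all $t\in\mathbb{R}$. Let $P$ be a 2-dimensional vector space whose non-zero elements are linear conserved quantities of $d+t\eta^{mid}$, and put $P(0)=\{p(0):p\in P\}$. Then the metrics $g_t(\alpha,\beta)=(\alpha(t),\beta(t))$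 and $g_\infty(\alpha,\beta)=(\alpha_0,\beta_1)+(\beta_0,\alpha_1)$ on $P$ do not depend on the point of $\Sigma$, and $g_t=g_0+t\,g_\infty$. Define $\phi_0(\alpha\odot\beta)=\alpha(0)\odot\beta(0)$ and $\phi_\infty(\alpha\odot\beta)(\gamma,\delta)=\frac12\big(g_\infty(\alpha,\gamma)g_\infty(\beta,\delta)+g_\infty(\alpha,\delta)g_\infty(\beta,\gamma)\big)$ on $S^2P$. **Theorem.** The map $f$ projects, in some space form, to a non-tubular linear Weingarten surface that immerses on a dense set if and only if $f$ is an Ω-surface with a middle pencil that admits a 2-dimensional space $P$ of linear conserved quantities with $g_0\neq0$ and $g_\infty$ non-degenerate. More precisely: 1. If $f$ projects, in the space form given by $\mathfrak q,\mathfrak p$, to a non-tubular linear Weingarten surface with condition $[W]$ that immerses on a dense set, then $f$ is an Ω-surface with a middle pencil that admits a 2-dimensional space $P$ of linear conserved quantities with $g_0\ne0$, $g_\infty$ non-degenerate, $P(0)=\langle\mathfrak q,\mathfrak p\rangle$ and $[W]=[\phi_0\circ\phi_\infty^{-1}(g_\infty)]$. 2. If $f$ is an Ω-surface with a middle pencil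 that admits a 2-dimensional space $P$ of linear conserved quantities with $g_0\neq0$ and $g_\infty$ non-degenerate, then $P(0)$ contains a space form vector and point sphere complex of some space form; and for every space form with space form vector and point sphere complex $\mathfrak q,\mathfrak p\in P(0)$, $f$ projects on all of $\Sigma$ to a map $\mathfrak f$ into that space form which, where it immerses, is a non-tubular linear Weingarten surface with $[W]=[\phi_0\circ\phi_\infty^{-1}(g_\infty)]$. -/

import Mathlib

open Set Module
open scoped Manifold ContDiff Topology TensorProduct LinearAlgebra.Projectivization

noncomputable section

namespace LieSphere

/-! ### The space `ℝ^{4,2}` -/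

/-- The vector space underlying `ℝ^{4,2}`. -/
abbrev R42 : Type := Fin 6 → ℝ

/-- Its inner product, of signature `(4,2)`. -/
def ip : LinearMap.BilinForm ℝ R42 :=
  Matrix.toBilin' (Matrix.diagonal ![1, 1, 1, 1, -1, -1])

/-- Endomorphisms of `ℝ^{4,2}`; the Lie algebra `𝔬(4,2) ≅ ∧²ℝ^{4,2}` is viewed inside them. -/
abbrev End42 : Type := R42 →L[ℝ] R42

/-- `a ∧ b`, acting as `c ↦ (a,c) b - (b,c) a`. -/
def wedge (a b : R42) : End42 :=
  LinearMap.toContinuousLinearMap ((ip a).smulRight b - (ip b).smulRight a)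

/-- `A ∧ B`, the span of all `a ∧ b` with `a ∈ A`, `b ∈ B`. -/
def wedgeSub (A B : Submodule ℝ R42) : Submodule ℝ End42 :=
  Submodule.span ℝ {T | ∃ a ∈ A, ∃ b ∈ B, T = wedge a b}

/-- The orthogonal complement in `ℝ^{4,2}`. -/
def perp (A : Submodule ℝ R42) : Submodule ℝ R42 := ip.orthogonal A

/-- The model space of surfaces. -/
abbrev E2 : Type := EuclideanSpace ℝ (Fin 2)

section Surface

variable {M : Type*} [TopologicalSpace M] [ChartedSpace E2 M]

/-- The derivative `dσ` of a map into `ℝ^{4,2}`. -/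
def D (σ : M → R42) (x : M) : TangentSpace (𝓡 2) x →L[ℝ] R42 :=
  mfderiv (𝓡 2) 𝓘(ℝ, R42) σ x

/-! ### Legendre maps and curvature spheres -/

/-- `σ` is a smooth section over the open set `U` of the family of subspaces `f`. -/
structure IsSectionOn (f : M → Submodule ℝ R42) (U : Set M) (σ : M → R42) : Prop where
  isOpen : IsOpen U
  smooth : ContMDiffOn (𝓡 2) 𝓘(ℝ, R42) ∞ σ U
  mem : ∀ y ∈ U, σ y ∈ f y

/-- `β(X) v = 0`: derivatives at `x` in the direction `X` of local sections of `f` with value `v`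
at `x` lie in `f x`. -/
def BetaVanishes (f : M → Submodule ℝ R42) (x : M) (X : TangentSpace (𝓡 2) x) (v : R42) : Prop :=
  ∀ (U : Set M) (σ : M → R42), IsSectionOn f U σ → x ∈ U → σ x = v → D σ x X ∈ f x

/-- Legendre maps: smooth maps into the Grassmannian of isotropic 2-planes of `ℝ^{4,2}`
that satisfy the contact and the immersion condition. -/
structure IsLegendre (f : M → Submodule ℝ R42) : Prop where
  rank_two : ∀ x, finrank ℝ (f x) = 2
  isotropic : ∀ x, ∀ v ∈ f x, ∀ w ∈ f x, ip v w = 0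
  /-- smoothness: local smooth frames exist -/
  smooth : ∀ x, ∃ (U : Set M) (σ τ : M → R42), x ∈ U ∧ IsSectionOn f U σ ∧ IsSectionOn f U τ ∧
    ∀ y ∈ U, f y = Submodule.span ℝ {σ y, τ y}
  contact : ∀ (U : Set M) (σ : M → R42), IsSectionOn f U σ →
    ∀ x ∈ U, ∀ X : TangentSpace (𝓡 2) x, D σ x X ∈ perp (f x)
  immersion : ∀ (x : M) (X : TangentSpace (𝓡 2) x), (∀ v ∈ f x, BetaVanishes f x X v) → X = 0

/-- Curvature spheres of `f` at `x`. -/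
def IsCurvatureSphere (f : M → Submodule ℝ R42) (x : M) (s : Submodule ℝ R42) : Prop :=
  finrank ℝ s = 1 ∧ s ≤ f x ∧
    ∃ T : Submodule ℝ (TangentSpace (𝓡 2) x), T ≠ ⊥ ∧ ∀ X ∈ T, ∀ v ∈ s, BetaVanishes f x X v

/-- No point is umbilic, i.e. has exactly one curvature sphere. -/
def UmbilicFree (f : M → Submodule ℝ R42) : Prop :=
  ∀ x, ¬ ∃! s : Submodule ℝ R42, IsCurvatureSphere f x s

/-! ### One-forms with values in `𝔬(4,2)` -/

/-- `End(ℝ^{4,2})`-valued one-forms on `M`. -/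
abbrev OneForm (M : Type*) [TopologicalSpace M] [ChartedSpace E2 M] : Type _ :=
  ∀ x : M, TangentSpace (𝓡 2) x →L[ℝ] End42

/-- The expression of a one-form in a chart `e` (its pull-back under `e.symm`). -/
def OneForm.inChart (η : OneForm M) (e : OpenPartialHomeomorph M E2) : E2 → E2 →L[ℝ] End42 :=
  fun y => (η (e.symm y)).comp (mfderiv 𝓘(ℝ, E2) (𝓡 2) e.symm y)

/-- Smoothness of a one-form. -/
def OneForm.IsSmooth (η : OneForm M) : Prop :=
  ∀ e ∈ atlas E2 M, ContDiffOn ℝ ∞ (η.inChart e) e.target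

/-- `dη = 0`. -/
def OneForm.IsClosed (η : OneForm M) : Prop :=
  ∀ e ∈ atlas E2 M, ∀ y ∈ e.target, ∀ v w : E2,
    fderiv ℝ (η.inChart e) y v w - fderiv ℝ (η.inChart e) y w v = 0

/-- `[η ∧ η] = 0`, where `[η ∧ η](X,Y) = [η(X),η(Y)] - [η(Y),η(X)]`. -/
def OneForm.BracketVanishes (η : OneForm M) : Prop :=
  ∀ (x : M) (X Y : TangentSpace (𝓡 2) x), ⁅η x X, η x Y⁆ - ⁅η x Y, η x X⁆ = 0

/-- `q` is the quadratic differential `q(X,Y) = tr (σ ↦ η(X) d_Y σ : f → f)`. -/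
def IsQuadraticDifferential (f : M → Submodule ℝ R42) (η : OneForm M)
    (q : ∀ x : M, LinearMap.BilinForm ℝ (TangentSpace (𝓡 2) x)) : Prop :=
  ∀ (x : M) (X Y : TangentSpace (𝓡 2) x), ∃ L : f x →ₗ[ℝ] f x,
    (∀ (U : Set M) (σ : M → R42) (hσ : IsSectionOn f U σ) (hx : x ∈ U),
      (L ⟨σ x, hσ.mem x hx⟩ : R42) = η x X (D σ x Y)) ∧
    q x X Y = LinearMap.trace ℝ (f x) L

/-- The signature of the quadratic differential is the same at all points. -/
def HasConstantSignature (q : ∀ x : M, LinearMap.BilinForm ℝ (TangentSpace (𝓡 2) x)) : Prop :=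
  ∃ s : Fin 2 → SignType, ∀ x : M, ∃ e : Basis (Fin 2) ℝ (TangentSpace (𝓡 2) x),
    ∀ i j, q x (e i) (e j) = if i = j then ((s i : SignType) : ℝ) else 0

/-- `η` exhibits `f` as an Ω-surface: `η ∈ Ω¹(f ∧ f^⊥)` is closed, `[η ∧ η] = 0`, and its quadratic
differential is non-zero, non-degenerate on a dense open set, and of constant signature. -/
structure IsOmegaPotential (f : M → Submodule ℝ R42) (η : OneForm M) : Prop where
  smooth : η.IsSmooth
  mem : ∀ (x : M) (X : TangentSpace (𝓡 2) x), η x X ∈ wedgeSub (f x) (perp (f x))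
  closed : η.IsClosed
  bracket : η.BracketVanishes
  quadDiff : ∃ q : ∀ x : M, LinearMap.BilinForm ℝ (TangentSpace (𝓡 2) x),
    IsQuadraticDifferential f η q ∧ (∃ x, q x ≠ 0) ∧
    (∃ U : Set M, IsOpen U ∧ Dense U ∧ ∀ x ∈ U, (q x).Nondegenerate) ∧
    HasConstantSignature q

/-! ### The Lie cyclide splitting and the middle potential -/

/-- Over the open set `U`: smooth lifts `σ₁, σ₂` of the two curvature sphere congruences and
nowhere zero smooth vector fields `X₁, X₂` spanning the respective curvature subbundles. -/
structure IsCurvatureFrame [IsManifold (𝓡 2) ∞ M] (f : M → Submodule ℝ R42) (U : Set M) (σ₁ σ₂ : M → R42)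
    (X₁ X₂ : ∀ x : M, TangentSpace (𝓡 2) x) : Prop where
  section₁ : IsSectionOn f U σ₁
  section₂ : IsSectionOn f U σ₂
  sphere₁ : ∀ y ∈ U, IsCurvatureSphere f y (Submodule.span ℝ {σ₁ y})
  sphere₂ : ∀ y ∈ U, IsCurvatureSphere f y (Submodule.span ℝ {σ₂ y})
  indep : ∀ y ∈ U, LinearIndependent ℝ ![σ₁ y, σ₂ y]
  smooth₁ : ContMDiffOn (𝓡 2) (𝓡 2).tangent ∞ (fun y => (⟨y, X₁ y⟩ : TangentBundle (𝓡 2) M)) U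
  smooth₂ : ContMDiffOn (𝓡 2) (𝓡 2).tangent ∞ (fun y => (⟨y, X₂ y⟩ : TangentBundle (𝓡 2) M)) U
  ne_zero₁ : ∀ y ∈ U, X₁ y ≠ 0
  ne_zero₂ : ∀ y ∈ U, X₂ y ≠ 0
  direction₁ : ∀ y ∈ U, BetaVanishes f y (X₁ y) (σ₁ y)
  direction₂ : ∀ y ∈ U, BetaVanishes f y (X₂ y) (σ₂ y)

/-- `⟨σ, d_Y σ, d_Y d_Y σ⟩` at `x`. The Lie cyclide splitting `S₁ ⊕ S₂` is
`cyclide σ₁ X₂ x ⊕ cyclide σ₂ X₁ x` for a curvature frame `σ₁, σ₂, X₁, X₂`. -/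
def cyclide (σ : M → R42) (Y : ∀ x : M, TangentSpace (𝓡 2) x) (x : M) : Submodule ℝ R42 :=
  Submodule.span ℝ {σ x, D σ x (Y x), D (fun z => D σ z (Y z)) x (Y x)}

/-- `η` is a middle potential: its component `η_𝔪` with respect to the splitting `𝔥 ⊕ 𝔪`,
`𝔥 = S₁ ∧ S₁ ⊕ S₂ ∧ S₂`, `𝔪 = S₁ ∧ S₂`, takes values in `∧²f`. -/
def IsMiddle [IsManifold (𝓡 2) ∞ M] (f : M → Submodule ℝ R42) (η : OneForm M) : Prop :=
  ∀ (U : Set M) (σ₁ σ₂ : M → R42) (X₁ X₂ : ∀ x : M, TangentSpace (𝓡 2) x),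
    IsCurvatureFrame f U σ₁ σ₂ X₁ X₂ → ∀ x ∈ U, ∀ Z : TangentSpace (𝓡 2) x,
      ∃ h ∈ wedgeSub (cyclide σ₁ X₂ x) (cyclide σ₁ X₂ x) ⊔
          wedgeSub (cyclide σ₂ X₁ x) (cyclide σ₂ X₁ x),
        ∃ m ∈ wedgeSub (cyclide σ₁ X₂ x) (cyclide σ₂ X₁ x),
          m ∈ wedgeSub (f x) (f x) ∧ η x Z = h + m

/-! ### Linear conserved quantities -/

/-- Polynomials `p₀ + t p₁` of degree at most one with coefficients maps `M → ℝ^{4,2}`. -/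
abbrev LinPoly (M : Type*) : Type _ := (M → R42) × (M → R42)

/-- Evaluation of `p₀ + t p₁` at `t` and at the point `x`. -/
def evalAt (t : ℝ) (x : M) : LinPoly M →ₗ[ℝ] R42 :=
  (LinearMap.proj x).comp (LinearMap.fst ℝ (M → R42) (M → R42)) +
    t • (LinearMap.proj x).comp (LinearMap.snd ℝ (M → R42) (M → R42))

/-- `p₀ + t p₁` is a conserved quantity of degree one of the pencil `d + t η`. -/
structure IsLinearConserved (η : OneForm M) (p : LinPoly M) : Prop where
  smooth_zero : ContMDiff (𝓡 2) 𝓘(ℝ, R42) ∞ p.1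
  smooth_one : ContMDiff (𝓡 2) 𝓘(ℝ, R42) ∞ p.2
  degree_one : p.2 ≠ 0
  parallel : ∀ (t : ℝ) (x : M) (X : TangentSpace (𝓡 2) x),
    D (fun y => evalAt t y p) x X + t • η x X (evalAt t x p) = 0

/-- `P` is a 2-dimensional space of linear conserved quantities of `d + t η`. -/
structure IsConservedPlane (η : OneForm M) (P : Submodule ℝ (LinPoly M)) : Prop where
  dim_two : finrank ℝ P = 2
  conserved : ∀ p ∈ P, p ≠ 0 → IsLinearConserved η p

/-- Evaluation `P → ℝ^{4,2}` at `t` and `x`. -/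
def ev (P : Submodule ℝ (LinPoly M)) (t : ℝ) (x : M) : P →ₗ[ℝ] R42 :=
  (evalAt t x).comp P.subtype

/-- The metric `g_t(α,β) = (α(t),β(t))` on `P`, computed at the point `x`. -/
def g (P : Submodule ℝ (LinPoly M)) (t : ℝ) (x : M) : LinearMap.BilinForm ℝ P :=
  ip.compl₁₂ (ev P t x) (ev P t x)

/-- The metric `g_∞(α,β) = (α₀,β₁) + (β₀,α₁)` on `P`, computed at the point `x`. -/
def gInf (P : Submodule ℝ (LinPoly M)) (x : M) : LinearMap.BilinForm ℝ P :=
  let c₀ : P →ₗ[ℝ] R42 :=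
    (LinearMap.proj x).comp ((LinearMap.fst ℝ (M → R42) (M → R42)).comp P.subtype)
  let c₁ : P →ₗ[ℝ] R42 :=
    (LinearMap.proj x).comp ((LinearMap.snd ℝ (M → R42) (M → R42)).comp P.subtype)
  ip.compl₁₂ c₀ c₁ + (ip.compl₁₂ c₀ c₁).flip

/-- `P(0)`, evaluated at `x`. -/
def planeAtZero (P : Submodule ℝ (LinPoly M)) (x : M) : Submodule ℝ R42 :=
  P.map (evalAt 0 x)

/-- `f` is an Ω-surface with middle potential `η`, and `P` is a 2-dimensional space of linear
conserved quantities of its middle pencil. -/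
structure IsOmegaWithPlane [IsManifold (𝓡 2) ∞ M] (f : M → Submodule ℝ R42) (η : OneForm M)
    (P : Submodule ℝ (LinPoly M)) : Prop where
  omega : IsOmegaPotential f η
  middle : IsMiddle f η
  plane : IsConservedPlane η P

end Surface

/-! ### Symmetric products -/

/-- `a ⊙ b = ½ (a ⊗ b + b ⊗ a)`. -/
def symProd {V : Type*} [AddCommGroup V] [Module ℝ V] (a b : V) : V ⊗[ℝ] V :=
  (1 / 2 : ℝ) • (a ⊗ₜ[ℝ] b + b ⊗ₜ[ℝ] a)

/-- `S²V`, the symmetric tensors. -/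
def symSq (V : Type*) [AddCommGroup V] [Module ℝ V] : Submodule ℝ (V ⊗[ℝ] V) :=
  Submodule.span ℝ {w | ∃ a b : V, w = symProd a b}

/-- For a bilinear form `h` on `V`, the linear map that sends `a ⊗ b` to the bilinear form
`(v,w) ↦ h(a,v) h(b,w)`. On symmetric tensors, with `h = g_∞`, this is `φ_∞`. -/
def phiInf {V : Type*} [AddCommGroup V] [Module ℝ V] (h : LinearMap.BilinForm ℝ V) :
    V ⊗[ℝ] V →ₗ[ℝ] LinearMap.BilinForm ℝ V :=
  TensorProduct.lift (LinearMap.mk₂ ℝ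
    (fun a b => (LinearMap.mul ℝ ℝ).compl₁₂ (h a) (h b))
    (fun a a' b => by ext v w; simp)
    (fun c a b => by ext v w; simp [mul_assoc])
    (fun a b b' => by ext v w; simp [mul_add])
    (fun c a b => by ext v w; simp [mul_left_comm]))

section Surface2

variable {M : Type*} [TopologicalSpace M] [ChartedSpace E2 M]

/-- `φ_t(α ⊙ β) = α(t) ⊙ β(t)`, at the point `x`. -/
def phi (P : Submodule ℝ (LinPoly M)) (t : ℝ) (x : M) : P ⊗[ℝ] P →ₗ[ℝ] R42 ⊗[ℝ] R42 :=
  TensorProduct.map (ev P t x) (ev P t x)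

/-- `[W] = [φ₀ (φ_∞⁻¹ g_∞)]`, an equality of points of the projective space; `w = φ_∞⁻¹ g_∞` is the
unique element of `S²P` that `φ_∞` sends to `g_∞`. -/
def IsWeingartenClass (P : Submodule ℝ (LinPoly M)) (x : M) (W : R42 ⊗[ℝ] R42) : Prop :=
  ∃ w ∈ symSq P, phiInf (gInf P x) w = gInf P x ∧
    (∀ w' ∈ symSq P, phiInf (gInf P x) w' = gInf P x → w' = w) ∧
    ∃ (hW : W ≠ 0) (hw : phi P 0 x w ≠ 0),
      Projectivization.mk ℝ W hW = Projectivization.mk ℝ (phi P 0 x w) hw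

/-! ### Space forms and linear Weingarten surfaces -/

/-- `𝔮` is a space form vector and `𝔭` a (normalised) point sphere complex. -/
structure IsSpaceForm (𝔮 𝔭 : R42) : Prop where
  unit : ip 𝔭 𝔭 = 1 ∨ ip 𝔭 𝔭 = -1
  orthogonal : ip 𝔮 𝔭 = 0
  ne_zero : 𝔮 ≠ 0

/-- `𝔣 = f ∩ 𝔔³` is the space form projection and `𝔱 = f ∩ 𝔓³` the tangent plane congruence of `f`,
where `𝔔³ = {y ∈ ℒ | (y,𝔮) = -1, (y,𝔭) = 0}` and `𝔓³ = {y ∈ ℒ | (y,𝔮) = 0, (y,𝔭) = -1}`. -/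
structure IsProjection (f : M → Submodule ℝ R42) (𝔮 𝔭 : R42) (𝔣 𝔱 : M → R42) : Prop where
  smooth_point : ContMDiff (𝓡 2) 𝓘(ℝ, R42) ∞ 𝔣
  smooth_plane : ContMDiff (𝓡 2) 𝓘(ℝ, R42) ∞ 𝔱
  point_mem : ∀ x, 𝔣 x ∈ f x
  plane_mem : ∀ x, 𝔱 x ∈ f x
  point_q : ∀ x, ip (𝔣 x) 𝔮 = -1
  point_p : ∀ x, ip (𝔣 x) 𝔭 = 0
  plane_q : ∀ x, ip (𝔱 x) 𝔮 = 0
  plane_p : ∀ x, ip (𝔱 x) 𝔭 = -1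

/-- The points where `𝔣` immerses. -/
def immersedPoints (𝔣 : M → R42) : Set M := {x | Function.Injective (D 𝔣 x)}

/-- `A` is the shape operator of `𝔣` at `x`: `d𝔱 + d𝔣 ∘ A = 0`. Its eigenvalues are the principal
curvatures `κ₁, κ₂`, by Rodrigues' equations. -/
def IsShapeOperator (𝔣 𝔱 : M → R42) (x : M) (A : End ℝ (TangentSpace (𝓡 2) x)) : Prop :=
  ∀ X : TangentSpace (𝓡 2) x, D 𝔱 x X + D 𝔣 x (A X) = 0

/-- Where it immerses, `𝔣` satisfies `a K + 2 b H + c = 0` with `K = κ₁κ₂ = det A` and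
`H = ½ (κ₁ + κ₂) = ½ tr A`; the coefficients do not all vanish. -/
def IsLinearWeingarten (𝔣 𝔱 : M → R42) (a b c : ℝ) : Prop :=
  (a ≠ 0 ∨ b ≠ 0 ∨ c ≠ 0) ∧
  ∀ x ∈ immersedPoints 𝔣, ∃ A : End ℝ (TangentSpace (𝓡 2) x), IsShapeOperator 𝔣 𝔱 x A ∧
    a * LinearMap.det A + 2 * b * ((1 / 2) * LinearMap.trace ℝ _ A) + c = 0

/-- `W = a 𝔮 ⊙ 𝔮 + 2 b 𝔮 ⊙ 𝔭 + c 𝔭 ⊙ 𝔭`. -/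
def weingartenTensor (𝔮 𝔭 : R42) (a b c : ℝ) : R42 ⊗[ℝ] R42 :=
  a • symProd 𝔮 𝔮 + (2 * b) • symProd 𝔮 𝔭 + c • symProd 𝔭 𝔭

/-- `f` projects, in the space form given by `𝔮, 𝔭`, to `𝔣` with tangent plane congruence `𝔱`, and
`𝔣` is a non-tubular linear Weingarten surface, `a K + 2 b H + c = 0`, where it immerses. -/
structure IsNonTubularProjection (f : M → Submodule ℝ R42) (𝔮 𝔭 : R42) (𝔣 𝔱 : M → R42)
    (a b c : ℝ) : Prop where
  spaceForm : IsSpaceForm 𝔮 𝔭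
  projection : IsProjection f 𝔮 𝔭 𝔣 𝔱
  weingarten : IsLinearWeingarten 𝔣 𝔱 a b c
  nonTubular : b ^ 2 - a * c ≠ 0

end Surface2

end LieSphere

end

open LieSphere

namespace LieSphere

/-! ### Linear algebra of `ℝ^{4,2}` -/

/-! A null plane f of ℝ^{4,2} is maximal isotropic and f^⊥/f is positive definite, so a null vector
of f^⊥ lies in f (`IsNullPlane.mem_of_null`). Differentiating the contact condition shows that the
pairings (d_Xσ, d_Yτ) of sections of f are symmetric in X, Y and that dσ modulo f is tensorial in σ.
Away from umbilics these forms can be diagonalised simultaneously and smoothly, which gives local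
lifts σ₁, σ₂ of the curvature spheres with directions X₁, X₂ (`IsLegendre.exists_curvatureFrame`).
Then n₁ = d_{X₂}σ₁ and n₂ = d_{X₁}σ₂ are orthogonal and span a complement of f in f^⊥.

From conserved quantities to linear Weingarten surfaces: in such a frame a middle potential takes
values c σ₁∧n₁ + d σ₂∧n₂ + μ σ₁∧σ₂. The equation (d+tη)p(t) = 0 says that p₀ is constant, dp₁ = -ηp₀
and ηp₁ = 0. Non-degeneracy of the quadratic differential turns the last equation into p₁ ∈ f, and
comparing the second modulo f yields p₁ = C(σ₁,p₀)σ₁ + E(σ₂,p₀)σ₂ with C, E common to all p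
(`IsCurvatureFrame.exists_conserved_form`). So g_∞ is diagonal in the pairings with the curvature
spheres. If it is non-degenerate, the coefficients p₁ can be combined to sections 𝔣, 𝔱 dual to 𝔮, 𝔭
∈ P(0), and diagonality becomes the equation aK + 2bH + c = 0 with (a, b; b, c) proportional to the
inverse of g_∞ (`IsOmegaWithPlane.exists_projection`). A generic choice of 𝔭 in P(0) makes 𝔣 immerse
on a dense set (`IsOmegaWithPlane.exists_dense_projection`).

Conversely, put η = 𝔣 ∧ d(-c𝔣 + b𝔱) + 𝔱 ∧ d(b𝔣 - a𝔱) (`weingartenPotential`). Its exterior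
derivative is -2 times `weingartenForm`, which is (aK + 2bH + c) d𝔣∧d𝔣 where 𝔣 immerses and vanishes
everywhere by density. Evaluated on X₁, X₂, this vanishing says that σ₁ and σ₂ are conjugate for the
form (c, -b; -b, a). Conjugacy makes η a middle potential with diagonal quadratic differential, and
the sign of b² - ac fixes the signature. The conserved quantities are 𝔮 + t(-c𝔣 + b𝔱) and 𝔭 + t(b𝔣 -
a𝔱) (`IsNonTubularProjection.exists_plane`). -/

theorem ip_apply (v w : R42) :
    ip v w = v 0 * w 0 + v 1 * w 1 + v 2 * w 2 + v 3 * w 3 - v 4 * w 4 - v 5 * w 5 := by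
  simp [ip, Matrix.toBilin'_apply', dotProduct, Matrix.mulVec_diagonal, Fin.sum_univ_succ]
  ring_nf

theorem ip_comm (v w : R42) : ip v w = ip w v := by
  rw [ip_apply, ip_apply]; ring

theorem eq_zero_of_ip (v : R42) (h : ∀ w, ip v w = 0) : v = 0 := by
  funext i
  have := h (Pi.single i 1)
  rw [ip_apply] at this
  fin_cases i <;> simpa [Pi.single_apply] using this

theorem ip_nondegenerate : ip.Nondegenerate :=
  ⟨fun v h => eq_zero_of_ip v h, fun v h => eq_zero_of_ip v fun w => by rw [ip_comm]; exact h w⟩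

theorem mem_perp {A : Submodule ℝ R42} {v : R42} : v ∈ perp A ↔ ∀ w ∈ A, ip w v = 0 :=
  LinearMap.BilinForm.mem_orthogonal_iff

theorem ip_eq_zero_of_mem {A : Submodule ℝ R42} {v w : R42} (hv : v ∈ A) (hw : w ∈ perp A) :
    ip v w = 0 := mem_perp.1 hw v hv

/-- The inner product as a continuous bilinear map. -/
noncomputable def ipL : R42 →L[ℝ] R42 →L[ℝ] ℝ :=
  LinearMap.toContinuousLinearMap ((LinearMap.toContinuousLinearMap : (R42 →ₗ[ℝ] ℝ) ≃ₗ[ℝ] _).toLinearMap ∘ₗ ip)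

@[simp] theorem ipL_apply (v w : R42) : ipL v w = ip v w := rfl

/-- An isotropic plane in `ℝ^{4,2}`. -/
structure IsNullPlane (f : Submodule ℝ R42) : Prop where
  rank_two : finrank ℝ f = 2
  isotropic : ∀ v ∈ f, ∀ w ∈ f, ip v w = 0

namespace IsNullPlane

variable {f : Submodule ℝ R42}

theorem le_perp (hf : IsNullPlane f) : f ≤ perp f := fun v hv =>
  mem_perp.2 fun w hw => hf.isotropic w hw v hv

/-- A null vector without negative part is zero, so the projection of f to the two negative
coordinates is injective, hence bijective because f has dimension 2. -/
theorem exists_same_negative (hf : IsNullPlane f) (v : R42) : ∃ w ∈ f, w 4 = v 4 ∧ w 5 = v 5 := by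
  let π : f →ₗ[ℝ] (Fin 2 → ℝ) :=
    { toFun := fun w => ![(w : R42) 4, (w : R42) 5]
      map_add' := fun a b => by ext i; fin_cases i <;> simp
      map_smul' := fun a b => by ext i; fin_cases i <;> simp }
  have hinj : Function.Injective π := by
    rw [injective_iff_map_eq_zero]
    rintro ⟨w, hw⟩ h0
    have h4 : w 4 = 0 := congrFun h0 0
    have h5 : w 5 = 0 := congrFun h0 1
    have hn := hf.isotropic w hw w hw
    rw [ip_apply, h4, h5] at hn
    have h0 : w 0 = 0 := by nlinarith [sq_nonneg (w 0), sq_nonneg (w 1), sq_nonneg (w 2), sq_nonneg (w 3)]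
    have h1 : w 1 = 0 := by nlinarith [sq_nonneg (w 0), sq_nonneg (w 1), sq_nonneg (w 2), sq_nonneg (w 3)]
    have h2 : w 2 = 0 := by nlinarith [sq_nonneg (w 0), sq_nonneg (w 1), sq_nonneg (w 2), sq_nonneg (w 3)]
    have h3 : w 3 = 0 := by nlinarith [sq_nonneg (w 0), sq_nonneg (w 1), sq_nonneg (w 2), sq_nonneg (w 3)]
    ext i
    fin_cases i <;> simpa
  have hsurj : Function.Surjective π :=
    (LinearMap.injective_iff_surjective_of_finrank_eq_finrank (by simp [hf.rank_two])).1 hinj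
  obtain ⟨w, hw⟩ := hsurj ![v 4, v 5]
  exact ⟨w, w.2, congrFun hw 0, congrFun hw 1⟩

/-- Subtracting an element of f with the same negative part does not change (v,v) and leaves a
vector of the positive definite part ℝ⁴. -/
theorem nonneg_of_mem_perp (hf : IsNullPlane f) {v : R42} (hv : v ∈ perp f) : 0 ≤ ip v v := by
  obtain ⟨w, hw, h4, h5⟩ := hf.exists_same_negative v
  have h : ip (v - w) (v - w) = ip v v := by
    have h1 := mem_perp.1 hv w hw
    have h2 := hf.isotropic w hw w hw
    simp only [map_sub, LinearMap.sub_apply, h1, h2, ip_comm v w]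
    ring
  rw [← h, ip_apply]
  simp only [Pi.sub_apply, h4, h5]
  nlinarith [sq_nonneg (v 0 - w 0), sq_nonneg (v 1 - w 1), sq_nonneg (v 2 - w 2),
    sq_nonneg (v 3 - w 3)]

/-- The equality case: the difference lies in the positive definite ℝ⁴ and is null, hence zero. This
is how membership in f is proved throughout. -/
theorem mem_of_null (hf : IsNullPlane f) {v : R42} (hv : v ∈ perp f) (h0 : ip v v = 0) : v ∈ f := by
  obtain ⟨w, hw, h4, h5⟩ := hf.exists_same_negative v
  have h : ip (v - w) (v - w) = 0 := by
    have h1 := mem_perp.1 hv w hw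
    have h2 := hf.isotropic w hw w hw
    simp only [map_sub, LinearMap.sub_apply, h1, h2, ip_comm v w, h0]
    ring
  rw [ip_apply] at h
  simp only [Pi.sub_apply, h4, h5] at h
  have hs := And.intro (sq_nonneg (v 0 - w 0)) (And.intro (sq_nonneg (v 1 - w 1))
    (And.intro (sq_nonneg (v 2 - w 2)) (sq_nonneg (v 3 - w 3))))
  have h0 : v 0 - w 0 = 0 := by nlinarith
  have h1 : v 1 - w 1 = 0 := by nlinarith
  have h2 : v 2 - w 2 = 0 := by nlinarith
  have h3 : v 3 - w 3 = 0 := by nlinarith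
  have : v = w := by
    ext i
    fin_cases i
    · simpa [sub_eq_zero] using h0
    · simpa [sub_eq_zero] using h1
    · simpa [sub_eq_zero] using h2
    · simpa [sub_eq_zero] using h3
    · exact h4.symm
    · exact h5.symm
  exact this ▸ hw

theorem pos_of_notMem (hf : IsNullPlane f) {v : R42} (hv : v ∈ perp f) (h0 : v ∉ f) : 0 < ip v v :=
  lt_of_le_of_ne (hf.nonneg_of_mem_perp hv) fun h => h0 (hf.mem_of_null hv h.symm)

theorem finrank_perp (hf : IsNullPlane f) : finrank ℝ (perp f) = 4 := by
  have := LinearMap.BilinForm.finrank_orthogonal ip_nondegenerate f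
  rw [hf.rank_two, finrank_fin_fun] at this
  exact this

theorem mem_of_perp_perp (hf : IsNullPlane f) {v : R42} (h : ∀ w ∈ perp f, ip w v = 0) : v ∈ f := by
  have hv : v ∈ perp f := mem_perp.2 fun w hw => h w (hf.le_perp hw)
  exact hf.mem_of_null hv (h v hv)

end IsNullPlane

/-- A basis of a null plane `f` together with two orthogonal non-null vectors of `f^⊥`. -/
structure IsAdapted (f : Submodule ℝ R42) (s₁ s₂ n₁ n₂ : R42) : Prop where
  null : IsNullPlane f
  span : f = Submodule.span ℝ {s₁, s₂}
  perp₁ : n₁ ∈ perp f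
  perp₂ : n₂ ∈ perp f
  orth : ip n₁ n₂ = 0
  pos₁ : 0 < ip n₁ n₁
  pos₂ : 0 < ip n₂ n₂

theorem linearIndependent_of_span {f : Submodule ℝ R42} (h2 : finrank ℝ f = 2) {a b : R42}
    (h : f = Submodule.span ℝ {a, b}) : LinearIndependent ℝ ![a, b] := by
  rw [linearIndependent_iff_card_eq_finrank_span]
  have : Set.range ![a, b] = {a, b} := by simp [Set.pair_comm]
  rw [Set.finrank, this, ← h, h2]; simp

theorem span_of_linearIndependent {f : Submodule ℝ R42} (h2 : finrank ℝ f = 2) {a b : R42}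
    (ha : a ∈ f) (hb : b ∈ f) (h : LinearIndependent ℝ ![a, b]) : f = Submodule.span ℝ {a, b} := by
  have hle : Submodule.span ℝ {a, b} ≤ f := by
    rw [Submodule.span_le]; rintro v (rfl | rfl) <;> assumption
  refine (Submodule.eq_of_le_of_finrank_eq hle ?_).symm
  have := linearIndependent_iff_card_eq_finrank_span.1 h
  have hr : Set.range ![a, b] = {a, b} := by simp [Set.pair_comm]
  rw [Set.finrank, hr] at this
  rw [h2, ← this]; simp

namespace IsAdapted

variable {f : Submodule ℝ R42} {s₁ s₂ n₁ n₂ : R42}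

theorem indep (h : IsAdapted f s₁ s₂ n₁ n₂) : LinearIndependent ℝ ![s₁, s₂] :=
  linearIndependent_of_span h.null.rank_two h.span

theorem mem₁ (h : IsAdapted f s₁ s₂ n₁ n₂) : s₁ ∈ f := by
  rw [h.span]; exact Submodule.subset_span (by simp)

theorem mem₂ (h : IsAdapted f s₁ s₂ n₁ n₂) : s₂ ∈ f := by
  rw [h.span]; exact Submodule.subset_span (by simp)

theorem exists_coeff (h : IsAdapted f s₁ s₂ n₁ n₂) {v : R42} (hv : v ∈ f) :
    ∃ x y : ℝ, v = x • s₁ + y • s₂ := by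
  rw [h.span, Submodule.mem_span_pair] at hv
  obtain ⟨x, y, e⟩ := hv
  exact ⟨x, y, e.symm⟩

theorem coeff_eq_zero (h : IsAdapted f s₁ s₂ n₁ n₂) {x y : ℝ} (e : x • s₁ + y • s₂ = 0) :
    x = 0 ∧ y = 0 := LinearIndependent.pair_iff.1 h.indep x y e

/-- A combination of `n₁, n₂` that lies in `f` is trivial. -/
theorem coeff_of_mem (h : IsAdapted f s₁ s₂ n₁ n₂) {x y : ℝ} (e : x • n₁ + y • n₂ ∈ f) :
    x = 0 ∧ y = 0 := by
  have e1 := ip_eq_zero_of_mem e h.perp₁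
  have e2 := ip_eq_zero_of_mem e h.perp₂
  simp only [map_add, map_smul, LinearMap.add_apply, LinearMap.smul_apply, smul_eq_mul, h.orth,
    ip_comm n₂ n₁] at e1 e2
  have p1 := h.pos₁
  have p2 := h.pos₂
  constructor
  · simpa [p1.ne'] using e1
  · simpa [p2.ne'] using e2

/-- Dimension count: ⟨n₁, n₂⟩ meets f trivially, and 2 + 2 = 4 is the dimension of f^⊥. -/
theorem perp_decomp (h : IsAdapted f s₁ s₂ n₁ n₂) {v : R42} (hv : v ∈ perp f) :
    ∃ x y : ℝ, v - x • n₁ - y • n₂ ∈ f := by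
  let L : (ℝ × ℝ) × f →ₗ[ℝ] perp f :=
    LinearMap.codRestrict _ ((LinearMap.coprod
      (LinearMap.coprod (LinearMap.toSpanSingleton ℝ R42 n₁) (LinearMap.toSpanSingleton ℝ R42 n₂))
      f.subtype)) (by
        rintro ⟨⟨x, y⟩, w⟩
        simp only [LinearMap.coprod_apply, LinearMap.toSpanSingleton_apply, Submodule.subtype_apply]
        exact add_mem (add_mem (Submodule.smul_mem _ _ h.perp₁) (Submodule.smul_mem _ _ h.perp₂))
          (h.null.le_perp w.2))
  have hinj : Function.Injective L := by
    rw [injective_iff_map_eq_zero]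
    rintro ⟨⟨x, y⟩, w⟩ hw
    have hw' : x • n₁ + y • n₂ + (w : R42) = 0 := congrArg Subtype.val hw
    obtain ⟨rfl, rfl⟩ := h.coeff_of_mem (x := x) (y := y)
      (by rw [eq_neg_of_add_eq_zero_left hw']; exact neg_mem w.2)
    have : w = 0 := by simpa using hw'
    simp [this]
  have hsurj : Function.Surjective L :=
    (LinearMap.injective_iff_surjective_of_finrank_eq_finrank
      (by simp [h.null.rank_two, h.null.finrank_perp])).1 hinj
  obtain ⟨⟨⟨x, y⟩, w⟩, e⟩ := hsurj ⟨v, hv⟩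
  have e' : x • n₁ + y • n₂ + (w : R42) = v := congrArg Subtype.val e
  refine ⟨x, y, ?_⟩
  rw [← e']
  convert w.2 using 1
  abel

/-- The four vectors span f^⊥, and f^⊥⊥ = f. -/
theorem mem_of_orth (h : IsAdapted f s₁ s₂ n₁ n₂) {v : R42} (h1 : ip s₁ v = 0) (h2 : ip s₂ v = 0)
    (h3 : ip n₁ v = 0) (h4 : ip n₂ v = 0) : v ∈ f := by
  have hfv : ∀ w ∈ f, ip w v = 0 := by
    intro w hw
    obtain ⟨x, y, rfl⟩ := h.exists_coeff hw
    simp [h1, h2]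
  refine h.null.mem_of_perp_perp fun w hw => ?_
  obtain ⟨x, y, e⟩ := h.perp_decomp hw
  have := hfv _ e
  simpa [h3, h4] using this

end IsAdapted

/-! ### Wedge products -/

theorem wedge_apply (a b c : R42) : wedge a b c = ip a c • b - ip b c • a := rfl

theorem wedge_add_left (a a' b : R42) : wedge (a + a') b = wedge a b + wedge a' b := by
  ext1 c; simp only [wedge_apply, map_add, LinearMap.add_apply, _root_.add_apply]; module

theorem wedge_smul_left (r : ℝ) (a b : R42) : wedge (r • a) b = r • wedge a b := by
  ext1 c
  simp only [wedge_apply, map_smul, LinearMap.smul_apply, _root_.smul_apply,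
    smul_eq_mul]
  module

theorem wedge_swap (a b : R42) : wedge a b = -wedge b a := by
  ext1 c; simp only [wedge_apply, _root_.neg_apply]; module

theorem wedge_add_right (a b b' : R42) : wedge a (b + b') = wedge a b + wedge a b' := by
  rw [wedge_swap, wedge_add_left, wedge_swap b, wedge_swap b']; abel

theorem wedge_smul_right (r : ℝ) (a b : R42) : wedge a (r • b) = r • wedge a b := by
  rw [wedge_swap, wedge_smul_left, wedge_swap b]; simp

theorem wedge_self (a : R42) : wedge a a = 0 := by
  ext1 c; simp [wedge_apply]

/-- The wedge product as a continuous bilinear map. -/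
noncomputable def wedgeL : R42 →L[ℝ] R42 →L[ℝ] End42 :=
  ((ContinuousLinearMap.smulRightL ℝ R42 R42).comp ipL) -
    ((ContinuousLinearMap.smulRightL ℝ R42 R42).comp ipL).flip

theorem wedge_mem {A B : Submodule ℝ R42} {a b : R42} (ha : a ∈ A) (hb : b ∈ B) :
    wedge a b ∈ wedgeSub A B := Submodule.subset_span ⟨a, ha, b, hb, rfl⟩

theorem ip_wedge_skew {A B : Submodule ℝ R42} {T : End42} (hT : T ∈ wedgeSub A B) (v w : R42) :
    ip (T v) w + ip v (T w) = 0 := by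
  induction hT using Submodule.span_induction with
  | mem T hT =>
    obtain ⟨a, -, b, -, rfl⟩ := hT
    simp only [wedge_apply, map_sub, map_smul, LinearMap.sub_apply, LinearMap.smul_apply,
      smul_eq_mul, ip_comm v]
    ring
  | zero => simp
  | add S T _ _ hS hT =>
    simp only [_root_.add_apply, map_add, LinearMap.add_apply]; linarith
  | smul r T _ hT =>
    simp only [_root_.smul_apply, map_smul, LinearMap.smul_apply, smul_eq_mul]
    linear_combination r * hT

/-- f is orthogonal both to itself and to f^⊥, so both terms of (a∧b)v vanish. -/
theorem wedge_apply_eq_zero {f : Submodule ℝ R42} (hf : IsNullPlane f) {T : End42}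
    (hT : T ∈ wedgeSub f (perp f)) {v : R42} (hv : v ∈ f) : T v = 0 := by
  induction hT using Submodule.span_induction with
  | mem T hT =>
    obtain ⟨a, ha, b, hb, rfl⟩ := hT
    rw [wedge_apply, hf.isotropic a ha v hv, ip_comm b, mem_perp.1 hb v hv]; simp
  | zero => simp
  | add S T _ _ hS hT => simp [hS, hT]
  | smul r T _ hT => simp [hT]

theorem wedgeSub_pair {a b : R42} {T : End42}
    (hT : T ∈ wedgeSub (Submodule.span ℝ {a, b}) (Submodule.span ℝ {a, b})) :
    ∃ r : ℝ, T = r • wedge a b := by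
  induction hT using Submodule.span_induction with
  | mem T hT =>
    obtain ⟨v, hv, w, hw, rfl⟩ := hT
    obtain ⟨x, y, rfl⟩ := Submodule.mem_span_pair.1 hv
    obtain ⟨x', y', rfl⟩ := Submodule.mem_span_pair.1 hw
    refine ⟨x * y' - y * x', ?_⟩
    simp only [wedge_add_left, wedge_add_right, wedge_smul_left, wedge_smul_right, wedge_self,
      wedge_swap b a]
    module
  | zero => exact ⟨0, by simp⟩
  | add S T _ _ hS hT =>
    obtain ⟨r, rfl⟩ := hS
    obtain ⟨s, rfl⟩ := hT
    exact ⟨r + s, by module⟩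
  | smul r T _ hT =>
    obtain ⟨s, rfl⟩ := hT
    exact ⟨r * s, by module⟩

theorem wedgeSub_triple {a b c : R42} {T : End42}
    (hT : T ∈ wedgeSub (Submodule.span ℝ {a, b, c}) (Submodule.span ℝ {a, b, c})) :
    ∃ x y z : ℝ, T = x • wedge a b + y • wedge a c + z • wedge b c := by
  induction hT using Submodule.span_induction with
  | mem T hT =>
    obtain ⟨v, hv, w, hw, rfl⟩ := hT
    obtain ⟨x, y, z, rfl⟩ := Submodule.mem_span_triple.1 hv
    obtain ⟨x', y', z', rfl⟩ := Submodule.mem_span_triple.1 hw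
    refine ⟨x * y' - y * x', x * z' - z * x', y * z' - z * y', ?_⟩
    simp only [wedge_add_left, wedge_add_right, wedge_smul_left, wedge_smul_right, wedge_self,
      wedge_swap b a, wedge_swap c a, wedge_swap c b]
    module
  | zero => exact ⟨0, 0, 0, by simp⟩
  | add S T _ _ hS hT =>
    obtain ⟨x, y, z, rfl⟩ := hS
    obtain ⟨x', y', z', rfl⟩ := hT
    exact ⟨x + x', y + y', z + z', by module⟩
  | smul r T _ hT =>
    obtain ⟨x, y, z, rfl⟩ := hT
    exact ⟨r * x, r * y, r * z, by module⟩

/-! ### Calculus on surfaces -/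

theorem isOpen_target_preimage {M : Type*} [TopologicalSpace M] (e : OpenPartialHomeomorph M E2) {U : Set M} (hU : IsOpen U) :
    IsOpen (e.target ∩ e.symm ⁻¹' U) := e.symm.isOpen_inter_preimage hU

section Calculus

variable {M : Type*} [TopologicalSpace M] [ChartedSpace E2 M]

theorem D_add {σ τ : M → R42} {x : M} (hσ : MDifferentiableAt (𝓡 2) 𝓘(ℝ, R42) σ x)
    (hτ : MDifferentiableAt (𝓡 2) 𝓘(ℝ, R42) τ x) (X : TangentSpace (𝓡 2) x) :
    D (fun z => σ z + τ z) x X = D σ x X + D τ x X := by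
  have := (hσ.hasMFDerivAt.add hτ.hasMFDerivAt).mfderiv
  exact congrArg (fun L => L X) this

theorem D_const_smul {σ : M → R42} {x : M} (r : ℝ) (hσ : MDifferentiableAt (𝓡 2) 𝓘(ℝ, R42) σ x)
    (X : TangentSpace (𝓡 2) x) : D (fun z => r • σ z) x X = r • D σ x X := by
  have := (hσ.hasMFDerivAt.const_smul r).mfderiv
  exact congrArg (fun L => L X) this

theorem D_comb {σ τ : M → R42} {x : M} (u w : ℝ)
    (hσ : MDifferentiableAt (𝓡 2) 𝓘(ℝ, R42) σ x) (hτ : MDifferentiableAt (𝓡 2) 𝓘(ℝ, R42) τ x)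
    (X : TangentSpace (𝓡 2) x) :
    D (fun z => u • σ z + w • τ z) x X = u • D σ x X + w • D τ x X := by
  rw [D_add (σ := fun z => u • σ z) (τ := fun z => w • τ z) (hσ.const_smul u) (hτ.const_smul w),
    D_const_smul _ hσ, D_const_smul _ hτ]

theorem hasMFDerivAt_pair {σ τ : M → R42} {x : M} (hσ : MDifferentiableAt (𝓡 2) 𝓘(ℝ, R42) σ x)
    (hτ : MDifferentiableAt (𝓡 2) 𝓘(ℝ, R42) τ x) :
    HasMFDerivAt (𝓡 2) 𝓘(ℝ, R42 × R42) (fun z => (σ z, τ z)) x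
      (ContinuousLinearMap.prod (D σ x) (D τ x)) :=
  ⟨hσ.hasMFDerivAt.1.prodMk hτ.hasMFDerivAt.1, hσ.hasMFDerivAt.2.prodMk hτ.hasMFDerivAt.2⟩

theorem mfderiv_ip {σ τ : M → R42} {x : M} (hσ : MDifferentiableAt (𝓡 2) 𝓘(ℝ, R42) σ x)
    (hτ : MDifferentiableAt (𝓡 2) 𝓘(ℝ, R42) τ x) (X : TangentSpace (𝓡 2) x) :
    mfderiv (𝓡 2) 𝓘(ℝ, ℝ) (fun z => ip (σ z) (τ z)) x X
      = ip (D σ x X) (τ x) + ip (σ x) (D τ x X) := by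
  have h1 : HasFDerivAt (fun p : R42 × R42 => ipL p.1 p.2) _ (σ x, τ x) :=
    ipL.isBoundedBilinearMap.hasFDerivAt (σ x, τ x)
  have h2 := h1.hasMFDerivAt.comp (f := fun z => (σ z, τ z)) x
    (hasMFDerivAt_pair hσ hτ)
  have h3 := congrArg (fun L => L X) h2.mfderiv
  refine h3.trans ?_
  rw [add_comm]
  rfl

theorem mdifferentiableAt_ip {σ τ : M → R42} {x : M} (hσ : MDifferentiableAt (𝓡 2) 𝓘(ℝ, R42) σ x)
    (hτ : MDifferentiableAt (𝓡 2) 𝓘(ℝ, R42) τ x) :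
    MDifferentiableAt (𝓡 2) 𝓘(ℝ, ℝ) (fun z => ip (σ z) (τ z)) x := by
  have h1 : HasFDerivAt (fun p : R42 × R42 => ipL p.1 p.2) _ (σ x, τ x) :=
    ipL.isBoundedBilinearMap.hasFDerivAt (σ x, τ x)
  exact (h1.hasMFDerivAt.comp (f := fun z => (σ z, τ z)) x
    (hasMFDerivAt_pair hσ hτ)).mdifferentiableAt

/-- Differentiating an inner product that is locally constant. -/
theorem ip_deriv_eq_zero {σ τ : M → R42} {x : M} (hσ : MDifferentiableAt (𝓡 2) 𝓘(ℝ, R42) σ x)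
    (hτ : MDifferentiableAt (𝓡 2) 𝓘(ℝ, R42) τ x) {c : ℝ} (hc : ∀ᶠ z in 𝓝 x, ip (σ z) (τ z) = c)
    (X : TangentSpace (𝓡 2) x) : ip (D σ x X) (τ x) + ip (σ x) (D τ x X) = 0 := by
  rw [← mfderiv_ip hσ hτ X]
  have : (fun z => ip (σ z) (τ z)) =ᶠ[𝓝 x] fun _ => c := hc
  rw [this.mfderiv_eq, mfderiv_const]
  rfl

theorem D_const (v : R42) (x : M) (X : TangentSpace (𝓡 2) x) : D (fun _ : M => v) x X = 0 := by
  rw [D, mfderiv_const]; rfl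

theorem IsSectionOn.mdifferentiableAt {f : M → Submodule ℝ R42} {U : Set M} {σ : M → R42}
    (h : IsSectionOn f U σ) {x : M} (hx : x ∈ U) : MDifferentiableAt (𝓡 2) 𝓘(ℝ, R42) σ x :=
  (h.smooth.contMDiffAt (h.isOpen.mem_nhds hx)).mdifferentiableAt (by simp)

theorem IsSectionOn.comb {f : M → Submodule ℝ R42} {U V : Set M} {σ τ : M → R42}
    (h : IsSectionOn f U σ) (h' : IsSectionOn f V τ) (u w : ℝ) :
    IsSectionOn f (U ∩ V) (fun z => u • σ z + w • τ z) where
  isOpen := h.isOpen.inter h'.isOpen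
  smooth := ((contMDiffOn_const (I := 𝓡 2) (I' := 𝓘(ℝ, ℝ)) (c := u)).smul (h.smooth.mono inter_subset_left)).add
    ((contMDiffOn_const (I := 𝓡 2) (I' := 𝓘(ℝ, ℝ)) (c := w)).smul (h'.smooth.mono inter_subset_right))
  mem y hy := add_mem (Submodule.smul_mem _ _ (h.mem y hy.1)) (Submodule.smul_mem _ _ (h'.mem y hy.2))

theorem IsLegendre.null {f : M → Submodule ℝ R42} (hf : IsLegendre f) (x : M) : IsNullPlane (f x) :=
  ⟨hf.rank_two x, hf.isotropic x⟩

theorem IsLegendre.contact_ip {f : M → Submodule ℝ R42} (hf : IsLegendre f) {U : Set M} {σ : M → R42}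
    (h : IsSectionOn f U σ) {x : M} (hx : x ∈ U) (X : TangentSpace (𝓡 2) x) {v : R42} (hv : v ∈ f x) :
    ip (D σ x X) v = 0 := by
  rw [ip_comm]; exact mem_perp.1 (hf.contact U σ h x hx X) v hv

theorem exists_chart_point (x : M) :
    ∃ e ∈ atlas E2 M, ∃ y ∈ e.target, e.symm y = x :=
  ⟨chartAt E2 x, chart_mem_atlas E2 x, chartAt E2 x x, mem_chart_target E2 x,
    (chartAt E2 x).left_inv (mem_chart_source E2 x)⟩

variable [IsManifold (𝓡 2) ∞ M]

theorem fderiv_comp_symm {F : Type*} [NormedAddCommGroup F] [NormedSpace ℝ F] {σ : M → F}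
    {e : OpenPartialHomeomorph M E2} (he : e ∈ atlas E2 M)
    {y : E2} (hy : y ∈ e.target) (hσ : MDifferentiableAt (𝓡 2) 𝓘(ℝ, F) σ (e.symm y)) :
    fderiv ℝ (fun z => σ (e.symm z)) y =
      (mfderiv (𝓡 2) 𝓘(ℝ, F) σ (e.symm y)).comp (mfderiv 𝓘(ℝ, E2) (𝓡 2) e.symm y) := by
  have : IsManifold (𝓡 2) 1 M := IsManifold.of_le (n := ∞) (by simp)
  have h := mfderiv_comp (I := 𝓘(ℝ, E2)) (I' := 𝓡 2) (I'' := 𝓘(ℝ, F)) y (g := σ) (f := e.symm) hσ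
    (mdifferentiableAt_atlas_symm he hy)
  rw [← mfderiv_eq_fderiv]
  exact h

theorem mfderiv_symm_surjective {e : OpenPartialHomeomorph M E2} (he : e ∈ atlas E2 M)
    {y : E2} (hy : y ∈ e.target) : Function.Surjective (mfderiv 𝓘(ℝ, E2) (𝓡 2) e.symm y) := by
  have : IsManifold (𝓡 2) 1 M := IsManifold.of_le (n := ∞) (by simp)
  exact (mdifferentiable_of_mem_atlas he).symm.mfderiv_surjective hy

theorem mfderiv_symm_injective {e : OpenPartialHomeomorph M E2} (he : e ∈ atlas E2 M)
    {y : E2} (hy : y ∈ e.target) : Function.Injective (mfderiv 𝓘(ℝ, E2) (𝓡 2) e.symm y) := by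
  have : IsManifold (𝓡 2) 1 M := IsManifold.of_le (n := ∞) (by simp)
  exact (mdifferentiable_of_mem_atlas he).symm.mfderiv_injective hy

theorem contMDiffOn_symm_atlas {e : OpenPartialHomeomorph M E2} (he : e ∈ atlas E2 M) :
    ContMDiffOn 𝓘(ℝ, E2) (𝓡 2) ∞ e.symm e.target :=
  contMDiffOn_symm_of_mem_maximalAtlas (IsManifold.subset_maximalAtlas he)

theorem contMDiffOn_atlas {e : OpenPartialHomeomorph M E2} (he : e ∈ atlas E2 M) :
    ContMDiffOn (𝓡 2) 𝓘(ℝ, E2) ∞ e e.source :=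
  contMDiffOn_of_mem_maximalAtlas (IsManifold.subset_maximalAtlas he)

theorem contDiffOn_comp_symm {σ : M → R42} {U : Set M}
    {e : OpenPartialHomeomorph M E2} (he : e ∈ atlas E2 M)
    (hσ : ContMDiffOn (𝓡 2) 𝓘(ℝ, R42) ∞ σ U) :
    ContDiffOn ℝ ∞ (fun z => σ (e.symm z)) (e.target ∩ e.symm ⁻¹' U) := by
  rw [← contMDiffOn_iff_contDiffOn]
  exact hσ.comp ((contMDiffOn_symm_atlas he).mono inter_subset_left) inter_subset_right

/-- A function with vanishing derivative on a connected surface is constant. -/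
theorem eq_of_mfderiv_eq_zero [ConnectedSpace M] {F : Type*} [NormedAddCommGroup F]
    [NormedSpace ℝ F] {h : M → F} (hd : ∀ x, MDifferentiableAt (𝓡 2) 𝓘(ℝ, F) h x)
    (h0 : ∀ x, ∀ X : TangentSpace (𝓡 2) x, mfderiv (𝓡 2) 𝓘(ℝ, F) h x X = 0) (x y : M) : h x = h y := by
  have hloc : IsLocallyConstant h := by
    rw [IsLocallyConstant.iff_eventually_eq]
    intro x
    set e := chartAt E2 x with he
    have hea : e ∈ atlas E2 M := chart_mem_atlas E2 x
    obtain ⟨r, hr, hball⟩ := Metric.isOpen_iff.1 e.open_target (e x) (mem_chart_target E2 x)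
    have : IsManifold (𝓡 2) 1 M := IsManifold.of_le (n := ∞) (by simp)
    have hdiff : DifferentiableOn ℝ (fun z => h (e.symm z)) (Metric.ball (e x) r) := by
      intro z hz
      have : MDifferentiableAt 𝓘(ℝ, E2) 𝓘(ℝ, F) (fun z => h (e.symm z)) z :=
        (hd (e.symm z)).comp z (mdifferentiableAt_atlas_symm hea (hball hz))
      exact this.differentiableAt.differentiableWithinAt
    have hzero : EqOn (fderiv ℝ (fun z => h (e.symm z))) 0 (Metric.ball (e x) r) := by
      intro z hz
      rw [fderiv_comp_symm hea (hball hz) (hd _)]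
      ext v
      exact h0 _ _
    have hmem : e ⁻¹' Metric.ball (e x) r ∩ e.source ∈ 𝓝 x :=
      Filter.inter_mem ((e.continuousAt (mem_chart_source E2 x)).preimage_mem_nhds
        (Metric.ball_mem_nhds _ hr)) (e.open_source.mem_nhds (mem_chart_source E2 x))
    filter_upwards [hmem] with z hz
    have := Metric.isOpen_ball.is_const_of_fderiv_eq_zero
      (convex_ball (e x) r).isPreconnected hdiff hzero hz.1 (Metric.mem_ball_self hr)
    simpa [e.left_inv hz.2, e.left_inv (mem_chart_source E2 x)] using this
  exact hloc.apply_eq_of_isPreconnected isPreconnected_univ (mem_univ x) (mem_univ y)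

/-- The derivative of a smooth map along a smooth vector field is smooth. -/
theorem contMDiffOn_D {σ : M → R42} {U : Set M} (hU : IsOpen U)
    (hσ : ContMDiffOn (𝓡 2) 𝓘(ℝ, R42) ∞ σ U) {X : ∀ x : M, TangentSpace (𝓡 2) x}
    (hX : ContMDiffOn (𝓡 2) (𝓡 2).tangent ∞ (fun y => (⟨y, X y⟩ : TangentBundle (𝓡 2) M)) U) :
    ContMDiffOn (𝓡 2) 𝓘(ℝ, R42) ∞ (fun z => D σ z (X z)) U := by
  have : IsManifold (𝓡 2) 1 M := IsManifold.of_le (n := ∞) (by simp)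
  have h1 := hσ.contMDiffOn_tangentMapWithin (m := ∞) (by simp) hU.uniqueMDiffOn
  have h2 := h1.comp hX (fun y hy => hy)
  have h3 := (contMDiff_snd_tangentBundle_modelSpace R42 𝓘(ℝ, R42) (n := ∞)).comp_contMDiffOn h2
  refine h3.congr fun z hz => ?_
  simp only [D, Function.comp, tangentMapWithin]
  rw [mfderivWithin_of_isOpen hU hz]
  rfl

/-! ### The derivative of sections of a Legendre map -/

/-- The derivative of the contact condition, in a chart. -/
theorem IsLegendre.second_contact {f : M → Submodule ℝ R42} (hf : IsLegendre f) {U V : Set M}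
    {σ τ : M → R42} (hσ : IsSectionOn f U σ) (hτ : IsSectionOn f V τ)
    {e : OpenPartialHomeomorph M E2} (he : e ∈ atlas E2 M) {y : E2} (hy : y ∈ e.target)
    (hyU : e.symm y ∈ U) (hyV : e.symm y ∈ V) (v w : E2) :
    ip (fderiv ℝ (fderiv ℝ (fun z => σ (e.symm z))) y w v) (τ (e.symm y)) +
      ip (fderiv ℝ (fun z => σ (e.symm z)) y v) (fderiv ℝ (fun z => τ (e.symm z)) y w) = 0 := by
  have hW : IsOpen (e.target ∩ e.symm ⁻¹' (U ∩ V)) :=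
    isOpen_target_preimage e (hσ.isOpen.inter hτ.isOpen)
  have hyW : y ∈ e.target ∩ e.symm ⁻¹' (U ∩ V) := ⟨hy, hyU, hyV⟩
  have hs := contDiffOn_comp_symm he (hσ.smooth.mono (inter_subset_left (t := V)))
  have ht := contDiffOn_comp_symm he (hτ.smooth.mono (inter_subset_right (s := U)))
  have hs' := hs.contDiffAt (hW.mem_nhds hyW)
  have ht' := (ht.contDiffAt (hW.mem_nhds hyW)).differentiableAt (by simp)
  have hds : DifferentiableAt ℝ (fderiv ℝ (fun z => σ (e.symm z))) y :=
    (hs'.fderiv_right (m := 1) (by norm_cast)).differentiableAt (by simp)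
  have hB := ipL.isBoundedBilinearMap.hasFDerivAt
    (fderiv ℝ (fun z => σ (e.symm z)) y v, τ (e.symm y))
  have h1 : HasFDerivAt (fun z => fderiv ℝ (fun z => σ (e.symm z)) z v)
      ((ContinuousLinearMap.apply ℝ R42 v).comp (fderiv ℝ (fderiv ℝ (fun z => σ (e.symm z))) y)) y :=
    (ContinuousLinearMap.apply ℝ R42 v).hasFDerivAt.comp y hds.hasFDerivAt
  have h2 := hB.comp (f := fun z => (fderiv ℝ (fun z => σ (e.symm z)) z v, τ (e.symm z))) y
    (h1.prodMk ht'.hasFDerivAt)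
  -- By the contact condition (d_vσ, τ) vanishes identically near y; the claim is its derivative in
  -- direction w.
  have hz : ((fun p : R42 × R42 => ipL p.1 p.2) ∘
      fun z => (fderiv ℝ (fun z => σ (e.symm z)) z v, τ (e.symm z))) =ᶠ[𝓝 y] fun _ => 0 := by
    filter_upwards [hW.mem_nhds hyW] with z hz
    simp only [Function.comp, ipL_apply]
    rw [fderiv_comp_symm he hz.1 (hσ.mdifferentiableAt hz.2.1)]
    exact hf.contact_ip hσ hz.2.1 _ (hτ.mem _ hz.2.2)
  have h3 := h2.congr_of_eventuallyEq hz.symm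
  have h4 := congrArg (fun L => L w) (h3.unique (hasFDerivAt_const (0 : ℝ) y))
  simp only [ContinuousLinearMap.coe_comp, Function.comp] at h4
  refine Eq.trans ?_ h4
  rw [add_comm]
  rfl

/-- The second fundamental form of a Legendre map is symmetric. -/
theorem IsLegendre.symm_deriv {f : M → Submodule ℝ R42} (hf : IsLegendre f) {U V : Set M}
    {σ τ : M → R42} (hσ : IsSectionOn f U σ) (hτ : IsSectionOn f V τ) {x : M} (hU : x ∈ U) (hV : x ∈ V)
    (X Y : TangentSpace (𝓡 2) x) : ip (D σ x X) (D τ x Y) = ip (D σ x Y) (D τ x X) := by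
  obtain ⟨e, he, y, hy, rfl⟩ := exists_chart_point x
  obtain ⟨v, rfl⟩ := mfderiv_symm_surjective he hy X
  obtain ⟨w, rfl⟩ := mfderiv_symm_surjective he hy Y
  have h1 := hf.second_contact hσ hτ he hy hU hV v w
  have h2 := hf.second_contact hσ hτ he hy hU hV w v
  have hs := (contDiffOn_comp_symm he hσ.smooth).contDiffAt
    ((isOpen_target_preimage e hσ.isOpen).mem_nhds ⟨hy, hU⟩)
  -- The second derivative of σ is symmetric, so the first terms of `h1` and `h2` agree and the
  -- second ones must agree too.
  have hsymm := (hs.isSymmSndFDerivAt (by simpa using WithTop.coe_le_coe.2 (le_top : (2 : ℕ∞) ≤ ⊤))) v w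
  rw [hsymm] at h2
  rw [fderiv_comp_symm he hy (hσ.mdifferentiableAt hU),
    fderiv_comp_symm he hy (hτ.mdifferentiableAt hV)] at h1 h2
  simp only [D]
  exact add_left_cancel (h1.trans h2.symm)

/-- The differentiated contact condition with τ = σ gives (dσ(X), dσ(X)) = 0 when σ(x) = 0; so dσ(X)
is a null vector of f^⊥ and lies in f. This makes dσ modulo f tensorial without expanding σ in a
local frame. -/
theorem IsLegendre.deriv_mem_of_eq_zero {f : M → Submodule ℝ R42} (hf : IsLegendre f) {U : Set M}
    {σ : M → R42} (hσ : IsSectionOn f U σ) {x : M} (hU : x ∈ U) (h0 : σ x = 0)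
    (X : TangentSpace (𝓡 2) x) : D σ x X ∈ f x := by
  refine (hf.null x).mem_of_null (hf.contact U σ hσ x hU X) ?_
  obtain ⟨e, he, y, hy, rfl⟩ := exists_chart_point x
  obtain ⟨v, rfl⟩ := mfderiv_symm_surjective he hy X
  have h1 := hf.second_contact hσ hσ he hy hU hU v v
  rw [h0, fderiv_comp_symm he hy (hσ.mdifferentiableAt hU), map_zero, zero_add] at h1
  exact h1

/-- Modulo `f`, the derivative of a section at a point depends only on its value there. -/
theorem IsLegendre.deriv_sub_mem {f : M → Submodule ℝ R42} (hf : IsLegendre f) {U V W : Set M}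
    {σ τ ρ : M → R42} (hσ : IsSectionOn f U σ) (hτ : IsSectionOn f V τ) (hρ : IsSectionOn f W ρ)
    {x : M} (hU : x ∈ U) (hV : x ∈ V) (hW : x ∈ W) {u w : ℝ} (h : ρ x = u • σ x + w • τ x)
    (X : TangentSpace (𝓡 2) x) : D ρ x X - (u • D σ x X + w • D τ x X) ∈ f x := by
  have hc := hσ.comb hτ u w
  have h1 := hρ.comb hc 1 (-1)
  have h2 := hf.deriv_mem_of_eq_zero h1 ⟨hW, hU, hV⟩ (by rw [h]; module) X
  rw [D_comb _ _ (hρ.mdifferentiableAt hW) (hc.mdifferentiableAt ⟨hU, hV⟩),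
    D_comb _ _ (hσ.mdifferentiableAt hU) (hτ.mdifferentiableAt hV)] at h2
  convert h2 using 1
  module

/-- `X = 0` if the derivatives in direction `X` of two sections that span `f` lie in `f`. -/
theorem IsLegendre.eq_zero_of_deriv_mem {f : M → Submodule ℝ R42} (hf : IsLegendre f) {U V : Set M}
    {σ τ : M → R42} (hσ : IsSectionOn f U σ) (hτ : IsSectionOn f V τ)
    {x : M} (hU : x ∈ U) (hV : x ∈ V) (hspan : f x = Submodule.span ℝ {σ x, τ x})
    {X : TangentSpace (𝓡 2) x} (h1 : D σ x X ∈ f x) (h2 : D τ x X ∈ f x) : X = 0 := by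
  refine hf.immersion x X fun v hv W ρ hρ hW e => ?_
  rw [hspan, Submodule.mem_span_pair] at hv
  obtain ⟨u, w, hv⟩ := hv
  have := hf.deriv_sub_mem hσ hτ hρ hU hV hW (u := u) (w := w) (by rw [e, hv]) X
  simpa using add_mem this (add_mem (Submodule.smul_mem _ u h1) (Submodule.smul_mem _ w h2))

end Calculus

/-! ### Curvature frames -/

/-- Gram–Schmidt: a and (a,a)b - (a,b)a are orthogonal and of positive square, hence complete a
basis of f to an adapted one. -/
theorem IsNullPlane.gram_mem {f : Submodule ℝ R42} (hf : IsNullPlane f) {a b v : R42}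
    (ha : a ∈ perp f) (hb : b ∈ perp f) (hv : v ∈ perp f) (hpos : 0 < ip a a)
    (hdet : 0 < ip a a * ip b b - ip a b * ip a b) (h1 : ip a v = 0) (h2 : ip b v = 0) : v ∈ f := by
  obtain ⟨B⟩ : Nonempty (Basis (Fin 2) ℝ f) := ⟨finBasisOfFinrankEq ℝ f hf.rank_two⟩
  have hspan : f = Submodule.span ℝ {(B 0 : R42), (B 1 : R42)} := by
    have := congrArg (Submodule.map f.subtype) B.span_eq
    rw [Submodule.map_span, Submodule.map_top, Submodule.range_subtype] at this
    refine this.symm.trans ?_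
    congr 1
    ext w
    simp only [mem_image, mem_range, mem_insert_iff, mem_singleton_iff, Fin.exists_fin_two]
    constructor
    · rintro ⟨_, rfl | rfl, rfl⟩ <;> simp
    · rintro (rfl | rfl)
      · exact ⟨_, Or.inl rfl, rfl⟩
      · exact ⟨_, Or.inr rfl, rfl⟩
  have had : IsAdapted f (B 0) (B 1) a (ip a a • b - ip a b • a) :=
    { null := hf
      span := hspan
      perp₁ := ha
      perp₂ := sub_mem (Submodule.smul_mem _ _ hb) (Submodule.smul_mem _ _ ha)
      orth := by simp only [map_sub, map_smul, smul_eq_mul]; ring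
      pos₁ := hpos
      pos₂ := by
        simp only [map_sub, map_smul, smul_eq_mul, LinearMap.sub_apply, LinearMap.smul_apply,
          ip_comm b a]
        nlinarith }
  exact had.mem_of_orth (mem_perp.1 hv _ (B 0).2) (mem_perp.1 hv _ (B 1).2) h1 (by simp [h1, h2])

section Frames

variable {M : Type*} [TopologicalSpace M] [ChartedSpace E2 M]

theorem finrank_tangentSpace (x : M) : finrank ℝ (TangentSpace (𝓡 2) x) = 2 :=
  finrank_euclideanSpace_fin (𝕜 := ℝ) (n := 2)

theorem exists_basis_tangentSpace {x : M} {X Y : TangentSpace (𝓡 2) x}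
    (h : LinearIndependent ℝ ![X, Y]) :
    ∃ b : Basis (Fin 2) ℝ (TangentSpace (𝓡 2) x), b 0 = X ∧ b 1 = Y := by
  refine ⟨basisOfLinearIndependentOfCardEqFinrank h (by rw [finrank_tangentSpace]; simp), ?_, ?_⟩ <;>
  simp

variable [IsManifold (𝓡 2) ∞ M]

/-- Pointwise curvature directions yield adapted bases. -/
theorem IsLegendre.adapted_of_directions {f : M → Submodule ℝ R42} (hf : IsLegendre f) {U V : Set M}
    {σ τ : M → R42} (hσ : IsSectionOn f U σ) (hτ : IsSectionOn f V τ)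
    {x : M} (hU : x ∈ U) (hV : x ∈ V) (hspan : f x = Submodule.span ℝ {σ x, τ x})
    {X Y : TangentSpace (𝓡 2) x} (hX : X ≠ 0) (hY : Y ≠ 0) (h1 : D σ x X ∈ f x)
    (h2 : D τ x Y ∈ f x) :
    IsAdapted (f x) (σ x) (τ x) (D σ x Y) (D τ x X) ∧ LinearIndependent ℝ ![X, Y] := by
  -- If both dσ(Y) and dτ(Y) lay in f, the immersion condition would force Y = 0; the same holds for
  -- X.
  have n1 : D σ x Y ∉ f x := fun h => hY (hf.eq_zero_of_deriv_mem hσ hτ hU hV hspan h h2)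
  have n2 : D τ x X ∉ f x := fun h => hX (hf.eq_zero_of_deriv_mem hσ hτ hU hV hspan h1 h)
  have p1 := hf.contact U σ hσ x hU
  have p2 := hf.contact V τ hτ x hV
  refine ⟨⟨hf.null x, hspan, p1 Y, p2 X, ?_, (hf.null x).pos_of_notMem (p1 Y) n1,
    (hf.null x).pos_of_notMem (p2 X) n2⟩, ?_⟩
  -- By symmetry (dσ(Y), dτ(X)) = (dσ(X), dτ(Y)), and both entries on the right lie in the isotropic
  -- f.
  · rw [hf.symm_deriv hσ hτ hU hV]
    exact (hf.null x).isotropic _ h1 _ h2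
  · rw [LinearIndependent.pair_iff]
    intro u w e
    have hu : w • D σ x Y ∈ f x := by
      have : w • D σ x Y = -(u • D σ x X) := by
        have := congrArg (D σ x) e
        rw [map_add, map_smul, map_smul, map_zero] at this
        exact eq_neg_of_add_eq_zero_right this
      rw [this]
      exact neg_mem (Submodule.smul_mem _ _ h1)
    have hw : w = 0 := by
      by_contra h
      exact n1 ((Submodule.smul_mem_iff _ h).1 hu)
    subst hw
    simpa [hX] using e

/-- Modulo f, d(uσ + wτ)(X) = (uμ + w) dτ(X), and dτ is injective modulo f. So uσ + wτ has a
curvature direction only if w = -uμ, and then every direction is one. -/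
theorem IsLegendre.umbilic {f : M → Submodule ℝ R42} (hf : IsLegendre f) {U V : Set M}
    {σ τ : M → R42} (hσ : IsSectionOn f U σ) (hτ : IsSectionOn f V τ)
    {x : M} (hU : x ∈ U) (hV : x ∈ V) (hspan : f x = Submodule.span ℝ {σ x, τ x})
    (hinj : ∀ X : TangentSpace (𝓡 2) x, D τ x X ∈ f x → X = 0) (μ : ℝ)
    (hμ : ∀ X : TangentSpace (𝓡 2) x, D σ x X - μ • D τ x X ∈ f x) :
    ∃! s : Submodule ℝ R42, IsCurvatureSphere f x s := by
  have hli := linearIndependent_of_span (hf.rank_two x) hspan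
  have hne : σ x - μ • τ x ≠ 0 := by
    intro h
    have := (LinearIndependent.pair_iff.1 hli 1 (-μ) (by rw [← h]; module)).1
    exact one_ne_zero this
  have hσm := hσ.mem x hU
  have hτm := hτ.mem x hV
  refine ⟨Submodule.span ℝ {σ x - μ • τ x}, ⟨finrank_span_singleton hne, ?_, ⊤, ?_, ?_⟩, ?_⟩
  · rw [Submodule.span_singleton_le_iff_mem]
    exact sub_mem hσm (Submodule.smul_mem _ _ hτm)
  · intro h
    have h2 := finrank_tangentSpace x
    rw [← finrank_top, h, finrank_bot] at h2
    exact absurd h2 (by norm_num)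
  · intro X _ v hv W ρ' hρ' hW e
    obtain ⟨k, rfl⟩ := Submodule.mem_span_singleton.1 hv
    have := hf.deriv_sub_mem hσ hτ hρ' hU hV hW (u := k) (w := -(k * μ)) (by rw [e]; module) X
    convert add_mem this (Submodule.smul_mem _ k (hμ X)) using 1
    module
  · rintro s ⟨hs1, hs2, T, hT, hs3⟩
    obtain ⟨v, hv, hsv⟩ : ∃ v ∈ s, v ≠ 0 := by
      obtain ⟨v, hv0, -⟩ := finrank_eq_one_iff'.1 hs1
      exact ⟨v, v.2, fun h => hv0 (Subtype.ext h)⟩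
    obtain ⟨X, hXT, hX⟩ := T.ne_bot_iff.1 hT
    have hvf := hs2 hv
    rw [hspan, Submodule.mem_span_pair] at hvf
    obtain ⟨u, w, rfl⟩ := hvf
    have hb := hs3 X hXT _ hv _ _ (hσ.comb hτ u w) ⟨hU, hV⟩ rfl
    rw [D_comb _ _ (hσ.mdifferentiableAt hU) (hτ.mdifferentiableAt hV)] at hb
    have h3 : (u * μ + w) • D τ x X ∈ f x := by
      convert sub_mem hb (Submodule.smul_mem _ u (hμ X)) using 1
      module
    have h4 : u * μ + w = 0 := by
      by_contra h
      exact hX (hinj X ((Submodule.smul_mem_iff _ h).1 h3))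
    have hw : w = -(u * μ) := by linarith
    subst hw
    have hle : Submodule.span ℝ {u • σ x + -(u * μ) • τ x} ≤ s :=
      (Submodule.span_singleton_le_iff_mem _ _).2 hv
    have hle2 : Submodule.span ℝ {u • σ x + -(u * μ) • τ x} ≤ Submodule.span ℝ {σ x - μ • τ x} :=
      (Submodule.span_singleton_le_iff_mem _ _).2
        (Submodule.mem_span_singleton.2 ⟨u, by module⟩)
    have : FiniteDimensional ℝ s := FiniteDimensional.of_finrank_eq_succ hs1
    rw [← Submodule.eq_of_le_of_finrank_eq hle (by rw [finrank_span_singleton hsv, hs1]),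
      Submodule.eq_of_le_of_finrank_eq hle2
        (by rw [finrank_span_singleton hsv, finrank_span_singleton hne])]

/-- Near any point there is a local frame whose second member is not a curvature sphere there. -/
theorem IsLegendre.exists_good_frame {f : M → Submodule ℝ R42} (hf : IsLegendre f) (x : M) :
    ∃ (U : Set M) (σ τ : M → R42), x ∈ U ∧ IsSectionOn f U σ ∧ IsSectionOn f U τ ∧
      (∀ y ∈ U, f y = Submodule.span ℝ {σ y, τ y}) ∧
      ∀ X : TangentSpace (𝓡 2) x, D τ x X ∈ f x → X = 0 := by
  obtain ⟨U, σ, τ, hx, hσ, hτ, hspan⟩ := hf.smooth x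
  by_cases h1 : ∀ X : TangentSpace (𝓡 2) x, D τ x X ∈ f x → X = 0
  · exact ⟨U, σ, τ, hx, hσ, hτ, hspan, h1⟩
  by_cases h2 : ∀ X : TangentSpace (𝓡 2) x, D σ x X ∈ f x → X = 0
  · exact ⟨U, τ, σ, hx, hτ, hσ, fun y hy => by rw [hspan y hy, Set.pair_comm], h2⟩
  push Not at h1 h2
  obtain ⟨Y, hY, hY0⟩ := h1
  obtain ⟨X, hX, hX0⟩ := h2
  obtain ⟨had, hli⟩ := hf.adapted_of_directions hσ hτ hx hx (hspan x hx) hX0 hY0 hX hY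
  -- If both σ and τ are curvature spheres at x, then σ + τ is not: modulo f its derivative along
  -- z₀X + z₁Y is z₁ dσ(Y) + z₀ dτ(X), with independent summands.
  have hc := hσ.comb hτ 1 1
  rw [inter_self] at hc
  refine ⟨U, σ, _, hx, hσ, hc, fun y hy => ?_, fun Z hZ => ?_⟩
  · rw [hspan y hy]
    apply le_antisymm <;> rw [Submodule.span_le]
    · rintro v (rfl | rfl)
      · exact Submodule.subset_span (by simp)
      · exact Submodule.mem_span_pair.2 ⟨-1, 1, by module⟩
    · rintro v (rfl | rfl)
      · exact Submodule.subset_span (by simp)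
      · exact Submodule.mem_span_pair.2 ⟨1, 1, by module⟩
  · obtain ⟨b, rfl, rfl⟩ := exists_basis_tangentSpace hli
    have hZb := b.sum_repr Z
    rw [Fin.sum_univ_two] at hZb
    rw [← hZb, D_comb _ _ (hσ.mdifferentiableAt hx) (hτ.mdifferentiableAt hx)] at hZ
    simp only [map_add, map_smul, one_smul] at hZ
    have h3 : b.repr Z 1 • D σ x (b 1) + b.repr Z 0 • D τ x (b 0) ∈ f x := by
      convert sub_mem (sub_mem hZ (Submodule.smul_mem _ (b.repr Z 0) hX))
        (Submodule.smul_mem _ (b.repr Z 1) hY) using 1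
      module
    obtain ⟨e1, e2⟩ := had.coeff_of_mem h3
    rw [← hZb, e1, e2]; simp

end Frames

/-! ### Smooth eigenvalues and eigenvectors of symmetric `2 × 2` pencils -/

/-- When ac - b² > 0 the right-hand side is a sum of two non-negative terms, so the discriminant of
det((p,q;q,r) - l(a,b;b,c)) vanishes only for proportional forms. -/
theorem discr_identity (a b c p q r : ℝ) :
    a ^ 2 * ((a * r + c * p - 2 * b * q) ^ 2 - 4 * (a * c - b * b) * (p * r - q * q)) =
      (a * (a * r - c * p) - 2 * b * (a * q - b * p)) ^ 2 +
        4 * (a * c - b * b) * (a * q - b * p) ^ 2 := by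
  ring

/-- A symmetric form is proportional to a positive definite one if the discriminant of the
pencil is not positive. -/
theorem proportional_of_discr_nonpos {a b c p q r : ℝ} (ha : 0 < a) (hd : 0 < a * c - b * b)
    (h : ¬ 0 < (a * r + c * p - 2 * b * q) ^ 2 - 4 * (a * c - b * b) * (p * r - q * q)) :
    ∃ μ : ℝ, p = μ * a ∧ q = μ * b ∧ r = μ * c := by
  have hid := discr_identity a b c p q r
  have h1 : (a * q - b * p) ^ 2 = 0 := by
    nlinarith [sq_nonneg (a * (a * r - c * p) - 2 * b * (a * q - b * p)), sq_nonneg (a * q - b * p),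
      mul_nonneg hd.le (sq_nonneg (a * q - b * p)), sq_nonneg a]
  have h2 : (a * (a * r - c * p) - 2 * b * (a * q - b * p)) ^ 2 = 0 := by
    nlinarith [sq_nonneg (a * (a * r - c * p) - 2 * b * (a * q - b * p)), sq_nonneg a]
  have h1' : a * q - b * p = 0 := by simpa using h1
  have h2' : a * (a * r - c * p) = 0 := by simpa [h1'] using h2
  have h3 : a * r - c * p = 0 := by simpa [ha.ne'] using h2'
  refine ⟨p / a, by field_simp, ?_, ?_⟩ <;> field_simp <;> linarith

/-- The kernel of a singular symmetric matrix (p, q; q, r) contains (-q, p) and (r, -q). At a point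
where the matrix is non-zero, p or r is non-zero, since p = 0 forces q = 0; the corresponding vector
works nearby. -/
theorem exists_smooth_kernel {W : Set E2} (hW : IsOpen W) {y₀ : E2} (hy : y₀ ∈ W) {p q r : E2 → ℝ}
    (hp : ContDiffOn ℝ ∞ p W) (hq : ContDiffOn ℝ ∞ q W) (hr : ContDiffOn ℝ ∞ r W)
    (hdet : ∀ y ∈ W, p y * r y - q y * q y = 0) (hne : ¬ (p y₀ = 0 ∧ q y₀ = 0 ∧ r y₀ = 0)) :
    ∃ W' ⊆ W, IsOpen W' ∧ y₀ ∈ W' ∧ ∃ ξ : E2 → E2, ContDiffOn ℝ ∞ ξ W' ∧ ∀ y ∈ W',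
      ξ y ≠ 0 ∧ p y * ξ y 0 + q y * ξ y 1 = 0 ∧ q y * ξ y 0 + r y * ξ y 1 = 0 := by
  have hvec : ∀ {W' : Set E2} {u v : E2 → ℝ}, ContDiffOn ℝ ∞ u W' → ContDiffOn ℝ ∞ v W' →
      ContDiffOn ℝ ∞ (fun y => !₂[u y, v y]) W' := by
    intro W' u v hu hv
    rw [contDiffOn_euclidean]
    intro i
    fin_cases i
    · simpa using hu
    · simpa using hv
  by_cases h : p y₀ = 0
  · have hq0 : q y₀ = 0 := by
      have := hdet y₀ hy
      rw [h] at this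
      nlinarith
    have hr0 : r y₀ ≠ 0 := fun hr0 => hne ⟨h, hq0, hr0⟩
    refine ⟨W ∩ r ⁻¹' {0}ᶜ, inter_subset_left,
      hr.continuousOn.isOpen_inter_preimage hW isOpen_compl_singleton, ⟨hy, hr0⟩,
      fun y => !₂[r y, -q y], (hvec hr hq.neg).mono inter_subset_left, fun y hyW => ⟨?_, ?_, ?_⟩⟩
    · intro h0
      exact hyW.2 (by simpa using congrArg (fun v : E2 => v 0) h0)
    · have := hdet y hyW.1
      simp; linarith
    · simp; ring
  · refine ⟨W ∩ p ⁻¹' {0}ᶜ, inter_subset_left,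
      hp.continuousOn.isOpen_inter_preimage hW isOpen_compl_singleton, ⟨hy, h⟩,
      fun y => !₂[-q y, p y], (hvec hq.neg hp).mono inter_subset_left, fun y hyW => ⟨?_, ?_, ?_⟩⟩
    · intro h0
      exact hyW.2 (by simpa using congrArg (fun v : E2 => v 1) h0)
    · simp; ring
    · have := hdet y hyW.1
      simp; linarith

section Existence

variable {M : Type*} [TopologicalSpace M] [ChartedSpace E2 M]

/-- The tangent vector at `e.symm y` with coordinates `v` in the chart `e`. -/
noncomputable def coordVec (e : OpenPartialHomeomorph M E2) (y : E2) :
    E2 →L[ℝ] TangentSpace (𝓡 2) (e.symm y) :=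
  mfderiv 𝓘(ℝ, E2) (𝓡 2) e.symm y

/-- The vector field on `M` with coordinate expression `ξ` in the chart `e`. -/
noncomputable def chartField (e : OpenPartialHomeomorph M E2) (ξ : E2 → E2) (x : M) :
    TangentSpace (𝓡 2) x :=
  (mfderiv 𝓘(ℝ, E2) (𝓡 2) e.symm (e x) (ξ (e x)) : E2)

theorem chartField_symm {e : OpenPartialHomeomorph M E2} (ξ : E2 → E2) {z : E2} (hz : z ∈ e.target) :
    chartField e ξ (e.symm z) = coordVec e z (ξ z) := by
  simp only [chartField, coordVec]
  rw [e.right_inv hz]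
  rfl

/-- The coefficients of the form `(dσ, dτ)` in a chart. -/
noncomputable def coordForm (e : OpenPartialHomeomorph M E2) (σ τ : M → R42) (i j : Fin 2) (y : E2) : ℝ :=
  ip (fderiv ℝ (fun z => σ (e.symm z)) y (EuclideanSpace.single i 1))
    (fderiv ℝ (fun z => τ (e.symm z)) y (EuclideanSpace.single j 1))

variable [IsManifold (𝓡 2) ∞ M]

theorem coordVec_surjective {e : OpenPartialHomeomorph M E2} (he : e ∈ atlas E2 M)
    {y : E2} (hy : y ∈ e.target) : Function.Surjective (coordVec e y) :=
  mfderiv_symm_surjective he hy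

theorem coordVec_injective {e : OpenPartialHomeomorph M E2} (he : e ∈ atlas E2 M)
    {y : E2} (hy : y ∈ e.target) : Function.Injective (coordVec e y) :=
  mfderiv_symm_injective he hy

theorem D_coordVec {σ : M → R42} {e : OpenPartialHomeomorph M E2} (he : e ∈ atlas E2 M) {y : E2}
    (hy : y ∈ e.target) (hσ : MDifferentiableAt (𝓡 2) 𝓘(ℝ, R42) σ (e.symm y)) (v : E2) :
    D σ (e.symm y) (coordVec e y v) = fderiv ℝ (fun z => σ (e.symm z)) y v := by
  rw [fderiv_comp_symm he hy hσ]; rfl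

theorem contMDiffOn_chartField {e : OpenPartialHomeomorph M E2} (he : e ∈ atlas E2 M) {W : Set E2}
    (hW : W ⊆ e.target) {ξ : E2 → E2} (hξ : ContDiffOn ℝ ∞ ξ W) :
    ContMDiffOn (𝓡 2) (𝓡 2).tangent ∞ (fun y => (⟨y, chartField e ξ y⟩ : TangentBundle (𝓡 2) M))
      (e.source ∩ e ⁻¹' W) := by
  have : IsManifold (𝓡 2) 1 M := IsManifold.of_le (n := ∞) (by simp)
  have h1 := (contMDiffOn_symm_atlas he).contMDiffOn_tangentMapWithin (m := ∞) (by simp)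
    e.open_target.uniqueMDiffOn
  have h2 : ContMDiffOn 𝓘(ℝ, E2) 𝓘(ℝ, E2).tangent ∞
      (fun y => (⟨y, ξ y⟩ : TangentBundle 𝓘(ℝ, E2) E2)) W :=
    contMDiffOn_vectorSpace_iff_contDiffOn.2 hξ
  have h3 := (h1.comp h2 (fun y hy => hW hy)).comp
    ((contMDiffOn_atlas he).mono (inter_subset_left (t := e ⁻¹' W))) (fun y hy => hy.2)
  refine h3.congr fun y hy => ?_
  obtain ⟨z, hz, rfl⟩ : ∃ z ∈ e.target, e.symm z = y := ⟨e y, e.map_source hy.1, e.left_inv hy.1⟩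
  simp only [Function.comp, tangentMapWithin]
  rw [chartField_symm ξ hz, e.right_inv hz, mfderivWithin_of_isOpen e.open_target hz]
  rfl

theorem contDiffOn_coordForm {f : M → Submodule ℝ R42} {e : OpenPartialHomeomorph M E2}
    (he : e ∈ atlas E2 M) {U : Set M} {σ τ : M → R42} (hσ : IsSectionOn f U σ)
    (hτ : IsSectionOn f U τ) (i j : Fin 2) :
    ContDiffOn ℝ ∞ (coordForm e σ τ i j) (e.target ∩ e.symm ⁻¹' U) := by
  have hW := isOpen_target_preimage e hσ.isOpen
  have h1 := ((contDiffOn_comp_symm he hσ.smooth).fderiv_of_isOpen hW (m := ∞) (by simp)).clm_apply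
    (contDiffOn_const (c := EuclideanSpace.single i (1 : ℝ)))
  have h2 := ((contDiffOn_comp_symm he hτ.smooth).fderiv_of_isOpen hW (m := ∞) (by simp)).clm_apply
    (contDiffOn_const (c := EuclideanSpace.single j (1 : ℝ)))
  exact (ipL.contDiff.comp_contDiffOn h1).clm_apply h2

theorem IsLegendre.coordForm_symm {f : M → Submodule ℝ R42} (hf : IsLegendre f)
    {e : OpenPartialHomeomorph M E2} (he : e ∈ atlas E2 M) {U : Set M} {σ τ : M → R42}
    (hσ : IsSectionOn f U σ) (hτ : IsSectionOn f U τ) (i j : Fin 2) {y : E2} (hy : y ∈ e.target)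
    (hyU : e.symm y ∈ U) : coordForm e σ τ i j y = coordForm e σ τ j i y := by
  simp only [coordForm, ← D_coordVec he hy (hσ.mdifferentiableAt hyU),
    ← D_coordVec he hy (hτ.mdifferentiableAt hyU)]
  exact hf.symm_deriv hσ hτ hyU hyU _ _

theorem euclidean_two_decomp (v : E2) :
    v = v 0 • EuclideanSpace.single (0 : Fin 2) (1 : ℝ) +
      v 1 • EuclideanSpace.single (1 : Fin 2) (1 : ℝ) := by
  ext i; fin_cases i <;> simp

/-- Eigenvectors of the pencil of fundamental forms give curvature directions. -/
theorem IsLegendre.mem_of_kernel {f : M → Submodule ℝ R42} (hf : IsLegendre f)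
    {e : OpenPartialHomeomorph M E2} (he : e ∈ atlas E2 M) {U : Set M} {σ τ : M → R42}
    (hσ : IsSectionOn f U σ) (hτ : IsSectionOn f U τ) {y : E2} (hy : y ∈ e.target)
    (hyU : e.symm y ∈ U) (hpos : 0 < coordForm e τ τ 0 0 y)
    (hdet : 0 < coordForm e τ τ 0 0 y * coordForm e τ τ 1 1 y -
      coordForm e τ τ 0 1 y * coordForm e τ τ 0 1 y) {l : ℝ} {ξ : E2}
    (h1 : (coordForm e σ τ 0 0 y - l * coordForm e τ τ 0 0 y) * ξ 0 +
      (coordForm e σ τ 0 1 y - l * coordForm e τ τ 0 1 y) * ξ 1 = 0)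
    (h2 : (coordForm e σ τ 0 1 y - l * coordForm e τ τ 0 1 y) * ξ 0 +
      (coordForm e σ τ 1 1 y - l * coordForm e τ τ 1 1 y) * ξ 1 = 0) :
    D σ (e.symm y) (coordVec e y ξ) -
      l • D τ (e.symm y) (coordVec e y ξ) ∈ f (e.symm y) := by
  have es := D_coordVec he hy (hσ.mdifferentiableAt hyU)
  have et := D_coordVec he hy (hτ.mdifferentiableAt hyU)
  have ps : ∀ v, fderiv ℝ (fun z => σ (e.symm z)) y v ∈ perp (f (e.symm y)) := fun v => by
    rw [← es]; exact hf.contact U σ hσ _ hyU _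
  have pt : ∀ v, fderiv ℝ (fun z => τ (e.symm z)) y v ∈ perp (f (e.symm y)) := fun v => by
    rw [← et]; exact hf.contact U τ hτ _ hyU _
  have hs := hf.coordForm_symm he hσ hτ 0 1 hy hyU
  have hdec : ∀ L : E2 →L[ℝ] R42, L ξ = ξ 0 • L (EuclideanSpace.single 0 1) +
      ξ 1 • L (EuclideanSpace.single 1 1) := fun L => by
    rw [← map_smul, ← map_smul, ← map_add, ← euclidean_two_decomp]
  rw [es, et]
  -- The kernel equations say that dσ(ξ) - l dτ(ξ) is orthogonal to both coordinate derivatives of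
  -- τ, and these span a positive definite plane in f^⊥.
  refine (hf.null _).gram_mem (pt (EuclideanSpace.single 0 1)) (pt (EuclideanSpace.single 1 1))
    (sub_mem (ps ξ) (Submodule.smul_mem _ _ (pt ξ))) hpos hdet ?_ ?_
  · rw [← h1, hs, hdec, hdec]
    simp only [coordForm, map_sub, map_add, map_smul, smul_eq_mul]
    rw [ip_comm _ (fderiv ℝ (fun z => σ (e.symm z)) y (EuclideanSpace.single 0 1)),
      ip_comm _ (fderiv ℝ (fun z => σ (e.symm z)) y (EuclideanSpace.single 1 1))]
    ring
  · rw [← h2, hdec, hdec]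
    simp only [coordForm, map_sub, map_add, map_smul, smul_eq_mul]
    rw [ip_comm _ (fderiv ℝ (fun z => σ (e.symm z)) y (EuclideanSpace.single 0 1)),
      ip_comm _ (fderiv ℝ (fun z => σ (e.symm z)) y (EuclideanSpace.single 1 1)),
      ip_comm (fderiv ℝ (fun z => τ (e.symm z)) y (EuclideanSpace.single 1 1))
        (fderiv ℝ (fun z => τ (e.symm z)) y (EuclideanSpace.single 0 1))]
    ring

/-- Turns a smooth eigenvalue l of the pencil (dσ,dτ) - l(dτ,dτ) into a smooth principal vector
field. `hne` says that the eigenvalue is simple at y₀, so that the kernel is a line. -/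
theorem IsLegendre.exists_direction {f : M → Submodule ℝ R42} (hf : IsLegendre f)
    {e : OpenPartialHomeomorph M E2} (he : e ∈ atlas E2 M) {U : Set M} {σ τ : M → R42}
    (hσ : IsSectionOn f U σ) (hτ : IsSectionOn f U τ) {W : Set E2} (hW : IsOpen W)
    (hWU : W ⊆ e.target ∩ e.symm ⁻¹' U) {y₀ : E2} (hy₀ : y₀ ∈ W)
    (hpos : ∀ y ∈ W, 0 < coordForm e τ τ 0 0 y)
    (hdet : ∀ y ∈ W, 0 < coordForm e τ τ 0 0 y * coordForm e τ τ 1 1 y -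
      coordForm e τ τ 0 1 y * coordForm e τ τ 0 1 y) {l : E2 → ℝ} (hl : ContDiffOn ℝ ∞ l W)
    (hroot : ∀ y ∈ W, (coordForm e σ τ 0 0 y - l y * coordForm e τ τ 0 0 y) *
      (coordForm e σ τ 1 1 y - l y * coordForm e τ τ 1 1 y) -
      (coordForm e σ τ 0 1 y - l y * coordForm e τ τ 0 1 y) *
      (coordForm e σ τ 0 1 y - l y * coordForm e τ τ 0 1 y) = 0)
    (hne : ¬ (coordForm e σ τ 0 0 y₀ - l y₀ * coordForm e τ τ 0 0 y₀ = 0 ∧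
      coordForm e σ τ 0 1 y₀ - l y₀ * coordForm e τ τ 0 1 y₀ = 0 ∧
      coordForm e σ τ 1 1 y₀ - l y₀ * coordForm e τ τ 1 1 y₀ = 0)) :
    ∃ W' ⊆ W, IsOpen W' ∧ y₀ ∈ W' ∧ ∃ X : ∀ x : M, TangentSpace (𝓡 2) x,
      ContMDiffOn (𝓡 2) (𝓡 2).tangent ∞ (fun y => (⟨y, X y⟩ : TangentBundle (𝓡 2) M))
        (e.source ∩ e ⁻¹' W') ∧
      ∀ x ∈ e.source ∩ e ⁻¹' W', X x ≠ 0 ∧ D σ x (X x) - l (e x) • D τ x (X x) ∈ f x := by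
  have hs := fun i j => (contDiffOn_coordForm he hσ hτ i j).mono hWU
  have ht := fun i j => (contDiffOn_coordForm he hτ hτ i j).mono hWU
  obtain ⟨W', hW'W, hW', hyW', ξ, hξ, hker⟩ := exists_smooth_kernel hW hy₀
    ((hs 0 0).sub (hl.mul (ht 0 0))) ((hs 0 1).sub (hl.mul (ht 0 1)))
    ((hs 1 1).sub (hl.mul (ht 1 1))) hroot hne
  refine ⟨W', hW'W, hW', hyW', chartField e ξ, contMDiffOn_chartField he
    (hW'W.trans (hWU.trans inter_subset_left)) hξ, ?_⟩
  rintro x ⟨hx1, hx2⟩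
  obtain ⟨z, hz, rfl⟩ : ∃ z ∈ e.target, e.symm z = x := ⟨e x, e.map_source hx1, e.left_inv hx1⟩
  rw [mem_preimage, e.right_inv hz] at hx2
  rw [chartField_symm ξ hz, e.right_inv hz]
  obtain ⟨k0, k1, k2⟩ := hker z hx2
  have hzW := hW'W hx2
  refine ⟨fun h => k0 (coordVec_injective he hz (h.trans (map_zero _).symm)), ?_⟩
  exact hf.mem_of_kernel he hσ hτ hz (hWU hzW).2 (hpos z hzW) (hdet z hzW) k1 k2

/-- Assembling a curvature frame from principal curvatures and principal directions. -/
theorem IsLegendre.curvatureFrame_of_eigen {f : M → Submodule ℝ R42} (hf : IsLegendre f)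
    {U V : Set M} {σ τ : M → R42} (hσ : IsSectionOn f U σ) (hτ : IsSectionOn f U τ)
    (hspan : ∀ y ∈ U, f y = Submodule.span ℝ {σ y, τ y}) (hV : IsOpen V) (hVU : V ⊆ U)
    {l₁ l₂ : M → ℝ} (hl₁ : ContMDiffOn (𝓡 2) 𝓘(ℝ, ℝ) ∞ l₁ V)
    (hl₂ : ContMDiffOn (𝓡 2) 𝓘(ℝ, ℝ) ∞ l₂ V) (hne : ∀ y ∈ V, l₁ y ≠ l₂ y)
    {X₁ X₂ : ∀ x : M, TangentSpace (𝓡 2) x}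
    (s₁ : ContMDiffOn (𝓡 2) (𝓡 2).tangent ∞ (fun y => (⟨y, X₁ y⟩ : TangentBundle (𝓡 2) M)) V)
    (s₂ : ContMDiffOn (𝓡 2) (𝓡 2).tangent ∞ (fun y => (⟨y, X₂ y⟩ : TangentBundle (𝓡 2) M)) V)
    (d₁ : ∀ y ∈ V, X₁ y ≠ 0 ∧ D σ y (X₁ y) - l₁ y • D τ y (X₁ y) ∈ f y)
    (d₂ : ∀ y ∈ V, X₂ y ≠ 0 ∧ D σ y (X₂ y) - l₂ y • D τ y (X₂ y) ∈ f y) :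
    IsCurvatureFrame f V (fun y => σ y - l₁ y • τ y) (fun y => σ y - l₂ y • τ y) X₁ X₂ := by
  have hsec : ∀ {l : M → ℝ}, ContMDiffOn (𝓡 2) 𝓘(ℝ, ℝ) ∞ l V →
      IsSectionOn f V (fun y => σ y - l y • τ y) := fun {l} hl =>
    ⟨hV, (hσ.smooth.mono hVU).sub (hl.smul (hτ.smooth.mono hVU)), fun y hy =>
      sub_mem (hσ.mem y (hVU hy)) (Submodule.smul_mem _ _ (hτ.mem y (hVU hy)))⟩
  have hli := fun y (hy : y ∈ V) => linearIndependent_of_span (hf.rank_two y) (hspan y (hVU hy))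
  -- The derivative of l never enters: it multiplies τ, which lies in f.
  have hdir : ∀ {l : M → ℝ} {X : ∀ x : M, TangentSpace (𝓡 2) x},
      (∀ y ∈ V, X y ≠ 0 ∧ D σ y (X y) - l y • D τ y (X y) ∈ f y) → ∀ y ∈ V, ∀ k : ℝ,
      BetaVanishes f y (X y) (k • (σ y - l y • τ y)) := by
    intro l X hd y hy k W ρ hρ hW e
    have := hf.deriv_sub_mem hσ hτ hρ (hVU hy) (hVU hy) hW (u := k) (w := -(k * l y))
      (by rw [e]; module) (X y)
    convert add_mem this (Submodule.smul_mem _ k (hd y hy).2) using 1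
    module
  have hsph : ∀ {l : M → ℝ} {X : ∀ x : M, TangentSpace (𝓡 2) x},
      (∀ y ∈ V, X y ≠ 0 ∧ D σ y (X y) - l y • D τ y (X y) ∈ f y) → ∀ y ∈ V,
      IsCurvatureSphere f y (Submodule.span ℝ {σ y - l y • τ y}) := by
    intro l X hd y hy
    refine ⟨finrank_span_singleton fun h => ?_, ?_, Submodule.span ℝ {X y}, ?_, ?_⟩
    · exact one_ne_zero
        (LinearIndependent.pair_iff.1 (hli y hy) 1 (-l y) (by rw [← h]; module)).1
    · rw [Submodule.span_singleton_le_iff_mem]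
      exact sub_mem (hσ.mem y (hVU hy)) (Submodule.smul_mem _ _ (hτ.mem y (hVU hy)))
    · rw [Ne, Submodule.span_singleton_eq_bot]
      exact (hd y hy).1
    · intro Z hZ v hv W ρ hρ hW e
      obtain ⟨k, rfl⟩ := Submodule.mem_span_singleton.1 hv
      obtain ⟨c, rfl⟩ := Submodule.mem_span_singleton.1 hZ
      rw [map_smul]
      exact Submodule.smul_mem _ _ (hdir hd y hy k W ρ hρ hW e)
  exact
    { section₁ := hsec hl₁
      section₂ := hsec hl₂
      sphere₁ := hsph d₁
      sphere₂ := hsph d₂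
      indep := fun y hy => by
        rw [LinearIndependent.pair_iff]
        intro u w e
        have h := LinearIndependent.pair_iff.1 (hli y hy) (u + w) (-(u * l₁ y + w * l₂ y))
          (by rw [← e]; module)
        have hw : w * (l₁ y - l₂ y) = 0 := by linear_combination l₁ y * h.1 + h.2
        have hw0 : w = 0 := (mul_eq_zero.1 hw).resolve_right (sub_ne_zero.2 (hne y hy))
        exact ⟨by linarith [h.1], hw0⟩
      smooth₁ := s₁
      smooth₂ := s₂
      ne_zero₁ := fun y hy => (d₁ y hy).1
      ne_zero₂ := fun y hy => (d₂ y hy).1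
      direction₁ := fun y hy => by simpa using hdir d₁ y hy 1
      direction₂ := fun y hy => by simpa using hdir d₂ y hy 1 }

/-- Locally, an umbilic-free Legendre map has a curvature frame. -/
theorem IsLegendre.exists_curvatureFrame {f : M → Submodule ℝ R42} (hf : IsLegendre f)
    (hu : UmbilicFree f) (x : M) :
    ∃ (U : Set M) (σ₁ σ₂ : M → R42) (X₁ X₂ : ∀ x : M, TangentSpace (𝓡 2) x),
      x ∈ U ∧ IsCurvatureFrame f U σ₁ σ₂ X₁ X₂ := by
  obtain ⟨U, σ, τ, hxU, hσ, hτ, hspan, hinj⟩ := hf.exists_good_frame x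
  obtain ⟨e, he, y₀, hy₀, rfl⟩ := exists_chart_point x
  have hUo := isOpen_target_preimage e hσ.isOpen
  have hs := contDiffOn_coordForm he hσ hτ
  have ht := contDiffOn_coordForm he hτ hτ
  have es := D_coordVec he hy₀ (hσ.mdifferentiableAt hxU)
  have et := D_coordVec he hy₀ (hτ.mdifferentiableAt hxU)
  have pt : ∀ v, fderiv ℝ (fun z => τ (e.symm z)) y₀ v ∈ perp (f (e.symm y₀)) := fun v => by
    rw [← et]; exact hf.contact U τ hτ _ hxU _
  have hnm : ∀ v : E2, v ≠ 0 → 0 < ip (fderiv ℝ (fun z => τ (e.symm z)) y₀ v)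
      (fderiv ℝ (fun z => τ (e.symm z)) y₀ v) := fun v hv =>
    (hf.null _).pos_of_notMem (pt v) fun h => hv (coordVec_injective he hy₀
      ((hinj _ (by rw [et]; exact h)).trans (map_zero _).symm))
  set a := coordForm e τ τ 0 0 with ha
  set b := coordForm e τ τ 0 1 with hb
  set c := coordForm e τ τ 1 1 with hc
  set p := coordForm e σ τ 0 0 with hp
  set q := coordForm e σ τ 0 1 with hq
  set r := coordForm e σ τ 1 1 with hr
  have hpos : 0 < a y₀ := hnm _ (by simp)
  have hdet : 0 < a y₀ * c y₀ - b y₀ * b y₀ := by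
    have h := hnm (a y₀ • EuclideanSpace.single 1 1 - b y₀ • EuclideanSpace.single 0 1) (fun h0 => by
      have := congrArg (fun v : E2 => v 1) h0
      simp at this
      exact hpos.ne' this)
    have h2 : 0 < a y₀ * (a y₀ * c y₀ - b y₀ * b y₀) := by
      convert h using 1
      simp only [map_sub, map_smul, LinearMap.sub_apply, LinearMap.smul_apply, smul_eq_mul]
      rw [ip_comm (fderiv ℝ (fun z => τ (e.symm z)) y₀ (EuclideanSpace.single 1 1))
        (fderiv ℝ (fun z => τ (e.symm z)) y₀ (EuclideanSpace.single 0 1))]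
      simp only [ha, hb, hc, coordForm]
      ring
    exact (mul_pos_iff_of_pos_left hpos).1 h2
  -- A non-positive discriminant makes the two forms proportional, and then x is umbilic.
  have hdisc : 0 < (a y₀ * r y₀ + c y₀ * p y₀ - 2 * b y₀ * q y₀) ^ 2 -
      4 * (a y₀ * c y₀ - b y₀ * b y₀) * (p y₀ * r y₀ - q y₀ * q y₀) := by
    by_contra hd
    obtain ⟨μ, h1, h2, h3⟩ := proportional_of_discr_nonpos hpos hdet hd
    refine hu _ (hf.umbilic hσ hτ hxU hxU (hspan _ hxU) hinj μ fun X => ?_)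
    obtain ⟨v, rfl⟩ := coordVec_surjective he hy₀ X
    refine hf.mem_of_kernel he hσ hτ hy₀ hxU hpos hdet ?_ ?_
    · rw [← hp, ← hq, ← ha, ← hb, h1, h2]; ring
    · rw [← hq, ← hr, ← hb, ← hc, h2, h3]; ring
  set δ : E2 → ℝ := fun y => a y * c y - b y * b y with hδ
  set m : E2 → ℝ := fun y => a y * r y + c y * p y - 2 * b y * q y with hm
  set Δ : E2 → ℝ := fun y => m y ^ 2 - 4 * δ y * (p y * r y - q y * q y) with hΔ
  have sδ : ContDiffOn ℝ ∞ δ (e.target ∩ e.symm ⁻¹' U) :=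
    ((ht 0 0).mul (ht 1 1)).sub ((ht 0 1).mul (ht 0 1))
  have sm : ContDiffOn ℝ ∞ m (e.target ∩ e.symm ⁻¹' U) :=
    (((ht 0 0).mul (hs 1 1)).add ((ht 1 1).mul (hs 0 0))).sub
      ((contDiffOn_const.mul (ht 0 1)).mul (hs 0 1))
  have sΔ : ContDiffOn ℝ ∞ Δ (e.target ∩ e.symm ⁻¹' U) :=
    (sm.pow 2).sub ((contDiffOn_const.mul sδ).mul
      (((hs 0 0).mul (hs 1 1)).sub ((hs 0 1).mul (hs 0 1))))
  have hn := hUo.mem_nhds (⟨hy₀, hxU⟩ : y₀ ∈ e.target ∩ e.symm ⁻¹' U)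
  have hev : ∀ᶠ y in 𝓝 y₀, y ∈ e.target ∩ e.symm ⁻¹' U ∧ 0 < a y ∧ 0 < δ y ∧ 0 < Δ y :=
    (Filter.eventually_mem_set.2 hn).and <|
      (((ht 0 0).continuousOn.continuousAt hn).eventually_const_lt hpos).and <|
      ((sδ.continuousOn.continuousAt hn).eventually_const_lt hdet).and
      ((sΔ.continuousOn.continuousAt hn).eventually_const_lt hdisc)
  obtain ⟨W, hWsub, hW, hyW⟩ := mem_nhds_iff.1 hev
  have hWU : W ⊆ e.target ∩ e.symm ⁻¹' U := fun y hy => (hWsub hy).1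
  -- The eigenvalues are l = (m ± √Δ)/(2δ), the roots of δl² - ml + (pr - q²); they are smooth and
  -- distinct because Δ > 0 on W.
  have key : ∀ ε : ℝ, ε ^ 2 = 1 → ∃ l : E2 → ℝ, ContDiffOn ℝ ∞ l W ∧
      (∀ y ∈ W, 2 * δ y * l y = m y + ε * Real.sqrt (Δ y)) ∧
      ∃ W' ⊆ W, IsOpen W' ∧ y₀ ∈ W' ∧ ∃ X : ∀ x : M, TangentSpace (𝓡 2) x,
        ContMDiffOn (𝓡 2) (𝓡 2).tangent ∞ (fun y => (⟨y, X y⟩ : TangentBundle (𝓡 2) M))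
          (e.source ∩ e ⁻¹' W') ∧
        ∀ x ∈ e.source ∩ e ⁻¹' W', X x ≠ 0 ∧ D σ x (X x) - l (e x) • D τ x (X x) ∈ f x := by
    intro ε hε
    have sl : ContDiffOn ℝ ∞ (fun y => (m y + ε * Real.sqrt (Δ y)) / (2 * δ y)) W :=
      ((sm.mono hWU).add (contDiffOn_const.mul
        ((sΔ.mono hWU).sqrt fun y hy => (hWsub hy).2.2.2.ne'))).div
        (contDiffOn_const.mul (sδ.mono hWU)) fun y hy =>
          mul_ne_zero two_ne_zero (hWsub hy).2.2.1.ne'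
    have hl : ∀ y ∈ W, 2 * δ y * ((m y + ε * Real.sqrt (Δ y)) / (2 * δ y)) =
        m y + ε * Real.sqrt (Δ y) := fun y hy =>
      mul_div_cancel₀ _ (mul_ne_zero two_ne_zero (hWsub hy).2.2.1.ne')
    refine ⟨_, sl, hl, hf.exists_direction he hσ hτ hW hWU hyW (fun y hy => (hWsub hy).2.1)
      (fun y hy => (hWsub hy).2.2.1) sl (fun y hy => ?_) ?_⟩
    · have h1 := hl y hy
      have h2 : Real.sqrt (Δ y) ^ 2 = Δ y := Real.sq_sqrt (hWsub hy).2.2.2.le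
      have h3 : δ y ≠ 0 := (hWsub hy).2.2.1.ne'
      set l := (m y + ε * Real.sqrt (Δ y)) / (2 * δ y)
      have h4 : (2 * δ y * l - m y) ^ 2 = Δ y := by
        rw [h1]
        linear_combination ε ^ 2 * h2 + Δ y * hε
      have h5 : 4 * δ y * ((p y - l * a y) * (r y - l * c y) -
          (q y - l * b y) * (q y - l * b y)) = 0 := by
        simp only [hΔ, hm, hδ] at h4 ⊢
        linear_combination h4
      exact (mul_eq_zero.1 h5).resolve_left (mul_ne_zero four_ne_zero h3)
    · rintro ⟨h1, h2, h3⟩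
      set l := (m y₀ + ε * Real.sqrt (Δ y₀)) / (2 * δ y₀)
      have h4 : Δ y₀ = 0 := by
        have h1' : p y₀ = l * a y₀ := by linarith
        have h2' : q y₀ = l * b y₀ := by linarith
        have h3' : r y₀ = l * c y₀ := by linarith
        simp only [hΔ, hm, hδ, h1', h2', h3']
        ring
      exact hdisc.ne' h4
  obtain ⟨l₁, sl₁, hl₁, W₁, hW₁W, hW₁, hyW₁, X₁, sX₁, hX₁⟩ := key 1 (by norm_num)
  obtain ⟨l₂, sl₂, hl₂, W₂, hW₂W, hW₂, hyW₂, X₂, sX₂, hX₂⟩ := key (-1) (by norm_num)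
  have hV₁ : e.source ∩ e ⁻¹' (W₁ ∩ W₂) ⊆ e.source ∩ e ⁻¹' W₁ := fun y hy => ⟨hy.1, hy.2.1⟩
  have hV₂ : e.source ∩ e ⁻¹' (W₁ ∩ W₂) ⊆ e.source ∩ e ⁻¹' W₂ := fun y hy => ⟨hy.1, hy.2.2⟩
  have hVs : e.source ∩ e ⁻¹' (W₁ ∩ W₂) ⊆ e.source := inter_subset_left
  have hsl : ∀ {l : E2 → ℝ}, ContDiffOn ℝ ∞ l W →
      ContMDiffOn (𝓡 2) 𝓘(ℝ, ℝ) ∞ (fun y => l (e y)) (e.source ∩ e ⁻¹' (W₁ ∩ W₂)) := fun {l} hl =>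
    (contMDiffOn_iff_contDiffOn.2 hl).comp ((contMDiffOn_atlas he).mono hVs)
      fun y hy => hW₁W hy.2.1
  refine ⟨e.source ∩ e ⁻¹' (W₁ ∩ W₂), _, _, X₁, X₂, ?_, hf.curvatureFrame_of_eigen hσ hτ hspan
    (e.isOpen_inter_preimage (hW₁.inter hW₂)) (fun y hy => ?_) (hsl sl₁) (hsl sl₂)
    (fun y hy h => ?_) (sX₁.mono hV₁) (sX₂.mono hV₂) (fun y hy => hX₁ y (hV₁ hy))
    (fun y hy => hX₂ y (hV₂ hy))⟩
  · refine ⟨e.map_target hy₀, ?_⟩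
    rw [mem_preimage, e.right_inv hy₀]
    exact ⟨hyW₁, hyW₂⟩
  · have := (hWU (hW₁W hy.2.1)).2
    rwa [mem_preimage, e.left_inv hy.1] at this
  · have hyW := hW₁W hy.2.1
    have h1 := hl₁ _ hyW
    have h2 := hl₂ _ hyW
    have h3 : 0 < Real.sqrt (Δ (e y)) := Real.sqrt_pos.2 (hWsub hyW).2.2.2
    have h' : l₁ (e y) = l₂ (e y) := h
    rw [h'] at h1
    linarith

end Existence

/-! ### The shape of a middle potential in a curvature frame -/

/-- T annihilates f, whereas on s₁ the terms y s₁∧u₁ and z n₁∧u₁ produce y(n₁,n₁)s₁ + z(n₁,n₁)n₁.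
Hence y = z = 0, and likewise for s₂, so no second derivatives u₁, u₂ survive. -/
theorem IsAdapted.middle_form {f : Submodule ℝ R42} {s₁ s₂ n₁ n₂ u₁ u₂ : R42}
    (h : IsAdapted f s₁ s₂ n₁ n₂) (h₁₁ : ip s₁ u₁ = -ip n₁ n₁) (h₁₂ : ip s₁ u₂ = 0)
    (h₂₁ : ip s₂ u₁ = 0) (h₂₂ : ip s₂ u₂ = -ip n₂ n₂) {T A m : End42}
    (hT : T ∈ wedgeSub f (perp f))
    (hA : A ∈ wedgeSub (Submodule.span ℝ {s₁, n₁, u₁}) (Submodule.span ℝ {s₁, n₁, u₁}) ⊔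
      wedgeSub (Submodule.span ℝ {s₂, n₂, u₂}) (Submodule.span ℝ {s₂, n₂, u₂}))
    (hm : m ∈ wedgeSub f f) (e : T = A + m) :
    ∃ c d μ : ℝ, T = c • wedge s₁ n₁ + d • wedge s₂ n₂ + μ • wedge s₁ s₂ := by
  rw [h.span] at hm
  obtain ⟨μ, rfl⟩ := wedgeSub_pair hm
  obtain ⟨A₁, hA₁, A₂, hA₂, rfl⟩ := Submodule.mem_sup.1 hA
  obtain ⟨x, y, z, rfl⟩ := wedgeSub_triple hA₁
  obtain ⟨x', y', z', rfl⟩ := wedgeSub_triple hA₂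
  have i11 := h.null.isotropic _ h.mem₁ _ h.mem₁
  have i12 := h.null.isotropic _ h.mem₁ _ h.mem₂
  have i22 := h.null.isotropic _ h.mem₂ _ h.mem₂
  have s1n1 := ip_eq_zero_of_mem h.mem₁ h.perp₁
  have s1n2 := ip_eq_zero_of_mem h.mem₁ h.perp₂
  have s2n1 := ip_eq_zero_of_mem h.mem₂ h.perp₁
  have s2n2 := ip_eq_zero_of_mem h.mem₂ h.perp₂
  have e1 := wedge_apply_eq_zero h.null hT h.mem₁
  have e2 := wedge_apply_eq_zero h.null hT h.mem₂
  rw [e] at e1 e2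
  simp only [_root_.add_apply, _root_.smul_apply, wedge_apply, ip_comm _ s₁, ip_comm n₁ s₂,
    ip_comm n₂ s₂, ip_comm u₁ s₂, ip_comm u₂ s₂, i11, i12, i22, s1n1, s1n2, s2n1, s2n2,
    h₁₁, h₁₂, h₂₁, h₂₂] at e1 e2
  have p1 := h.pos₁
  have p2 := h.pos₂
  have q1 : (z * ip n₁ n₁) • n₁ + (0 : ℝ) • n₂ = -((y * ip n₁ n₁) • s₁) :=
    eq_neg_of_add_eq_zero_left (by rw [← e1]; module)
  have q2 : (0 : ℝ) • n₁ + (z' * ip n₂ n₂) • n₂ = -((y' * ip n₂ n₂) • s₂) :=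
    eq_neg_of_add_eq_zero_left (by rw [← e2]; module)
  have z0 : z * ip n₁ n₁ = 0 :=
    (h.coeff_of_mem (q1 ▸ neg_mem (Submodule.smul_mem _ _ h.mem₁))).1
  have z0' : z' * ip n₂ n₂ = 0 :=
    (h.coeff_of_mem (q2 ▸ neg_mem (Submodule.smul_mem _ _ h.mem₂))).2
  have y0 : y * ip n₁ n₁ = 0 := (h.coeff_eq_zero (x := y * ip n₁ n₁) (y := 0) (by
    rw [z0] at q1
    rw [← neg_eq_zero, neg_add, ← q1]; module)).1
  have y0' : y' * ip n₂ n₂ = 0 := (h.coeff_eq_zero (x := 0) (y := y' * ip n₂ n₂) (by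
    rw [z0'] at q2
    rw [← neg_eq_zero, neg_add, ← q2]; module)).2
  have hz := (mul_eq_zero.1 z0).resolve_right p1.ne'
  have hz' := (mul_eq_zero.1 z0').resolve_right p2.ne'
  have hy := (mul_eq_zero.1 y0).resolve_right p1.ne'
  have hy' := (mul_eq_zero.1 y0').resolve_right p2.ne'
  refine ⟨x, x', μ, ?_⟩
  rw [e, hz, hz', hy, hy']
  module

theorem trace_of_pair {f : Submodule ℝ R42} (h2 : finrank ℝ f = 2) {a b : R42} (ha : a ∈ f)
    (hb : b ∈ f) (hspan : f = Submodule.span ℝ {a, b}) (L : f →ₗ[ℝ] f) {x y z w : ℝ}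
    (h₁ : (L ⟨a, ha⟩ : R42) = x • a + y • b) (h₂ : (L ⟨b, hb⟩ : R42) = z • a + w • b) :
    LinearMap.trace ℝ f L = x + w := by
  have hli := linearIndependent_of_span h2 hspan
  have hli' : LinearIndependent ℝ ![(⟨a, ha⟩ : f), ⟨b, hb⟩] := by
    rw [LinearIndependent.pair_iff] at hli ⊢
    intro s t e
    exact hli s t (congrArg Subtype.val e)
  let B := basisOfLinearIndependentOfCardEqFinrank hli' (by simp [h2])
  have hB0 : B 0 = ⟨a, ha⟩ := by simp [B]
  have hB1 : B 1 = ⟨b, hb⟩ := by simp [B]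
  have e1 : L (B 0) = x • B 0 + y • B 1 := by
    rw [hB0, hB1]; exact Subtype.ext h₁
  have e2 : L (B 1) = z • B 0 + w • B 1 := by
    rw [hB0, hB1]; exact Subtype.ext h₂
  rw [LinearMap.trace_eq_matrix_trace ℝ B, Matrix.trace_fin_two, LinearMap.toMatrix_apply,
    LinearMap.toMatrix_apply, e1, e2]
  simp

/-! ### Conserved quantities -/

theorem evalAt_apply {M : Type*} (t : ℝ) (x : M) (p : LinPoly M) : evalAt t x p = p.1 x + t • p.2 x := rfl

section Conserved

variable {M : Type*} [TopologicalSpace M] [ChartedSpace E2 M]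

/-- Non-degeneracy at a single point excludes the sign 0 from the signature, and the signature is
the same everywhere. -/
theorem IsOmegaPotential.exists_nondegenerate [Nonempty M] {f : M → Submodule ℝ R42}
    {η : OneForm M} (hη : IsOmegaPotential f η) :
    ∃ q : ∀ x : M, LinearMap.BilinForm ℝ (TangentSpace (𝓡 2) x),
      IsQuadraticDifferential f η q ∧ ∀ x Z, (∀ Y, q x Z Y = 0) → Z = 0 := by
  obtain ⟨q, hq, -, ⟨V, -, hVd, hV⟩, s, hs⟩ := hη.quadDiff
  refine ⟨q, hq, ?_⟩
  have hs0 : ∀ i, ((s i : SignType) : ℝ) ≠ 0 := by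
    obtain ⟨x, hx⟩ := hVd.nonempty
    obtain ⟨e, he⟩ := hs x
    intro i hi
    refine e.ne_zero i ((hV x hx).1 _ fun Y => ?_)
    rw [← e.sum_repr Y]
    simp only [map_sum, map_smul, he, smul_eq_mul]
    refine Finset.sum_eq_zero fun j _ => ?_
    split_ifs <;> simp [hi]
  intro x Z hZ
  obtain ⟨e, he⟩ := hs x
  refine e.ext_elem fun i => ?_
  have h := hZ (e i)
  rw [← e.sum_repr Z] at h
  simp only [map_sum, map_smul, LinearMap.sum_apply, LinearMap.smul_apply, he, smul_eq_mul,
    mul_ite, mul_zero, Finset.sum_ite_eq', Finset.mem_univ, if_true] at h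
  simpa [hs0 i] using h

theorem IsLinearConserved.mdiff_zero {η : OneForm M} {p : LinPoly M} (hp : IsLinearConserved η p)
    (x : M) : MDifferentiableAt (𝓡 2) 𝓘(ℝ, R42) p.1 x :=
  hp.smooth_zero.mdifferentiable (by simp) x

theorem IsLinearConserved.mdiff_one {η : OneForm M} {p : LinPoly M} (hp : IsLinearConserved η p)
    (x : M) : MDifferentiableAt (𝓡 2) 𝓘(ℝ, R42) p.2 x :=
  hp.smooth_one.mdifferentiable (by simp) x

/-- The coefficients of the equation `(d + tη) p(t) = 0`. -/
theorem IsLinearConserved.equations {η : OneForm M} {p : LinPoly M} (hp : IsLinearConserved η p)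
    (x : M) (X : TangentSpace (𝓡 2) x) :
    D p.1 x X = 0 ∧ D p.2 x X = -η x X (p.1 x) ∧ η x X (p.2 x) = 0 := by
  have key : ∀ t : ℝ, D p.1 x X + t • D p.2 x X + t • η x X (p.1 x + t • p.2 x) = 0 := by
    intro t
    have := hp.parallel t x X
    simp only [evalAt_apply] at this
    rwa [D_add (τ := fun y => t • p.2 y) (hp.mdiff_zero x) ((hp.mdiff_one x).const_smul t),
      D_const_smul _ (hp.mdiff_one x)] at this
  -- The expression is quadratic in t, so the values 0, 1 and -1 determine its three coefficients.
  have h0 := key 0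
  have h1 := key 1
  have h2 := key (-1)
  simp only [map_add, map_smul] at h0 h1 h2
  have e0 : D p.1 x X = 0 := by simpa using h0
  rw [e0] at h1 h2
  have e2 : η x X (p.2 x) = 0 := by
    have : (2 : ℝ) • η x X (p.2 x) = 0 := by
      calc (2 : ℝ) • η x X (p.2 x) = (0 + (1 : ℝ) • D p.2 x X +
            (1 : ℝ) • (η x X (p.1 x) + (1 : ℝ) • η x X (p.2 x))) +
            (0 + (-1 : ℝ) • D p.2 x X +
              (-1 : ℝ) • (η x X (p.1 x) + (-1 : ℝ) • η x X (p.2 x))) := by module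
        _ = 0 := by rw [h1, h2, add_zero]
    exact (smul_eq_zero.1 this).resolve_left two_ne_zero
  refine ⟨e0, ?_, e2⟩
  rw [e2] at h1
  refine eq_neg_of_add_eq_zero_left ?_
  rw [← h1]; module

end Conserved

/-! ### Middle potentials and top coefficients of conserved quantities -/

section Middle

variable {M : Type*} [TopologicalSpace M] [ChartedSpace E2 M] [IsManifold (𝓡 2) ∞ M]
  {f : M → Submodule ℝ R42} {U : Set M} {σ₁ σ₂ : M → R42} {X₁ X₂ : ∀ x : M, TangentSpace (𝓡 2) x}

namespace IsCurvatureFrame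

theorem mem_direction₁ (h : IsCurvatureFrame f U σ₁ σ₂ X₁ X₂) {y : M} (hy : y ∈ U) :
    D σ₁ y (X₁ y) ∈ f y := h.direction₁ y hy U σ₁ h.section₁ hy rfl

theorem mem_direction₂ (h : IsCurvatureFrame f U σ₁ σ₂ X₁ X₂) {y : M} (hy : y ∈ U) :
    D σ₂ y (X₂ y) ∈ f y := h.direction₂ y hy U σ₂ h.section₂ hy rfl

theorem adapted_indep (h : IsCurvatureFrame f U σ₁ σ₂ X₁ X₂) (hf : IsLegendre f) {y : M}
    (hy : y ∈ U) : IsAdapted (f y) (σ₁ y) (σ₂ y) (D σ₁ y (X₂ y)) (D σ₂ y (X₁ y)) ∧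
      LinearIndependent ℝ ![X₁ y, X₂ y] :=
  hf.adapted_of_directions h.section₁ h.section₂ hy hy
    (span_of_linearIndependent (hf.rank_two y) (h.section₁.mem y hy) (h.section₂.mem y hy)
      (h.indep y hy)) (h.ne_zero₁ y hy) (h.ne_zero₂ y hy) (h.mem_direction₁ hy) (h.mem_direction₂ hy)

theorem adapted (h : IsCurvatureFrame f U σ₁ σ₂ X₁ X₂) (hf : IsLegendre f) {y : M}
    (hy : y ∈ U) : IsAdapted (f y) (σ₁ y) (σ₂ y) (D σ₁ y (X₂ y)) (D σ₂ y (X₁ y)) :=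
  (h.adapted_indep hf hy).1

theorem exists_basis (h : IsCurvatureFrame f U σ₁ σ₂ X₁ X₂) (hf : IsLegendre f) {y : M}
    (hy : y ∈ U) : ∃ b : Basis (Fin 2) ℝ (TangentSpace (𝓡 2) y), b 0 = X₁ y ∧ b 1 = X₂ y :=
  exists_basis_tangentSpace (h.adapted_indep hf hy).2

theorem exists_comb (h : IsCurvatureFrame f U σ₁ σ₂ X₁ X₂) (hf : IsLegendre f) {y : M}
    (hy : y ∈ U) (Z : TangentSpace (𝓡 2) y) : ∃ u w : ℝ, Z = u • X₁ y + w • X₂ y := by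
  obtain ⟨b, h0, h1⟩ := h.exists_basis hf hy
  refine ⟨b.repr Z 0, b.repr Z 1, ?_⟩
  rw [← h0, ← h1, ← Fin.sum_univ_two (fun i => b.repr Z i • b i), b.sum_repr]

/-- Derivative of the contact condition along a vector field. -/
theorem _root_.LieSphere.IsLegendre.ip_second_deriv (hf : IsLegendre f) {σ ρ : M → R42}
    (hσ : IsSectionOn f U σ) (hρ : IsSectionOn f U ρ) {X : ∀ x : M, TangentSpace (𝓡 2) x}
    (hX : ContMDiffOn (𝓡 2) (𝓡 2).tangent ∞ (fun y => (⟨y, X y⟩ : TangentBundle (𝓡 2) M)) U)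
    {y : M} (hy : y ∈ U) (Y : TangentSpace (𝓡 2) y) :
    ip (ρ y) (D (fun z => D σ z (X z)) y Y) = -ip (D ρ y Y) (D σ y (X y)) := by
  have hd : MDifferentiableAt (𝓡 2) 𝓘(ℝ, R42) (fun z => D σ z (X z)) y :=
    ((contMDiffOn_D hσ.isOpen hσ.smooth hX).contMDiffAt
      (hσ.isOpen.mem_nhds hy)).mdifferentiableAt (by simp)
  have := ip_deriv_eq_zero (hρ.mdifferentiableAt hy) hd (c := 0) (by
    filter_upwards [hσ.isOpen.mem_nhds hy] with z hz
    rw [ip_comm]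
    exact hf.contact_ip hσ hz _ (hρ.mem z hz)) Y
  linarith

/-- The pairings of σ₁, σ₂ with the second derivatives come from differentiating the contact
condition; the mixed ones vanish because d_{X₁}σ₁ and d_{X₂}σ₂ lie in f. -/
theorem middle_form (h : IsCurvatureFrame f U σ₁ σ₂ X₁ X₂) (hf : IsLegendre f) {η : OneForm M}
    (hη : IsOmegaPotential f η) (hm : IsMiddle f η) {y : M} (hy : y ∈ U)
    (Z : TangentSpace (𝓡 2) y) :
    ∃ c d μ : ℝ, η y Z = c • wedge (σ₁ y) (D σ₁ y (X₂ y)) + d • wedge (σ₂ y) (D σ₂ y (X₁ y)) +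
      μ • wedge (σ₁ y) (σ₂ y) := by
  obtain ⟨A, hA, m, -, hmf, e⟩ := hm U σ₁ σ₂ X₁ X₂ h y hy Z
  have had := h.adapted hf hy
  refine had.middle_form (u₁ := D (fun z => D σ₁ z (X₂ z)) y (X₂ y))
    (u₂ := D (fun z => D σ₂ z (X₁ z)) y (X₁ y)) ?_ ?_ ?_ ?_ (hη.mem y Z) hA hmf e
  · exact hf.ip_second_deriv h.section₁ h.section₁ h.smooth₂ hy _
  · rw [hf.ip_second_deriv h.section₂ h.section₁ h.smooth₁ hy _,
      ip_eq_zero_of_mem (h.mem_direction₁ hy) had.perp₂, neg_zero]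
  · rw [hf.ip_second_deriv h.section₁ h.section₂ h.smooth₂ hy _,
      ip_eq_zero_of_mem (h.mem_direction₂ hy) had.perp₁, neg_zero]
  · exact hf.ip_second_deriv h.section₂ h.section₂ h.smooth₁ hy _

/-- η(Z) kills d_{X₁}σ₁ ∈ f, so only d_{X₁}σ₂ = n₂ contributes to the trace, through σ₂∧n₂;
symmetrically for X₂. Thus q reads off the coefficients c and d of η(Z). -/
theorem quadratic_differential (h : IsCurvatureFrame f U σ₁ σ₂ X₁ X₂) (hf : IsLegendre f)
    {η : OneForm M} (hη : ∀ (x : M) (X : TangentSpace (𝓡 2) x), η x X ∈ wedgeSub (f x) (perp (f x)))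
    {q : ∀ x : M, LinearMap.BilinForm ℝ (TangentSpace (𝓡 2) x)}
    (hq : IsQuadraticDifferential f η q) {y : M} (hy : y ∈ U) {Z : TangentSpace (𝓡 2) y} {c d μ : ℝ}
    (e : η y Z = c • wedge (σ₁ y) (D σ₁ y (X₂ y)) + d • wedge (σ₂ y) (D σ₂ y (X₁ y)) +
      μ • wedge (σ₁ y) (σ₂ y)) :
    q y Z (X₁ y) = -(d * ip (D σ₂ y (X₁ y)) (D σ₂ y (X₁ y))) ∧
      q y Z (X₂ y) = -(c * ip (D σ₁ y (X₂ y)) (D σ₁ y (X₂ y))) := by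
  have had := h.adapted hf hy
  have s1n1 := ip_eq_zero_of_mem had.mem₁ had.perp₁
  have s1n2 := ip_eq_zero_of_mem had.mem₁ had.perp₂
  have s2n1 := ip_eq_zero_of_mem had.mem₂ had.perp₁
  have s2n2 := ip_eq_zero_of_mem had.mem₂ had.perp₂
  have ho := had.orth
  have ho' : ip (D σ₂ y (X₁ y)) (D σ₁ y (X₂ y)) = 0 := by rw [ip_comm, ho]
  constructor
  · obtain ⟨L, hL, e'⟩ := hq y Z (X₁ y)
    rw [e']
    have h1 := hL U σ₁ h.section₁ hy
    have h2 := hL U σ₂ h.section₂ hy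
    rw [wedge_apply_eq_zero had.null (hη y Z) (h.mem_direction₁ hy)] at h1
    rw [e] at h2
    simp only [_root_.add_apply, _root_.smul_apply, wedge_apply, s1n2, s2n2, ho] at h2
    rw [trace_of_pair had.null.rank_two had.mem₁ had.mem₂ had.span L
      (x := 0) (y := 0) (z := 0) (w := -(d * ip (D σ₂ y (X₁ y)) (D σ₂ y (X₁ y))))
      (by rw [h1]; module) (by rw [h2]; module), zero_add]
  · obtain ⟨L, hL, e'⟩ := hq y Z (X₂ y)
    rw [e']
    have h1 := hL U σ₁ h.section₁ hy
    have h2 := hL U σ₂ h.section₂ hy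
    rw [wedge_apply_eq_zero had.null (hη y Z) (h.mem_direction₂ hy)] at h2
    rw [e] at h1
    simp only [_root_.add_apply, _root_.smul_apply, wedge_apply, s1n1, s2n1, ho'] at h1
    rw [trace_of_pair had.null.rank_two had.mem₁ had.mem₂ had.span L
      (x := -(c * ip (D σ₁ y (X₂ y)) (D σ₁ y (X₂ y)))) (y := 0) (z := 0) (w := 0)
      (by rw [h1]; module) (by rw [h2]; module), add_zero]

/-- Vectors annihilated by a middle potential lie in `f`. -/
theorem mem_of_annihilated [Nonempty M] (h : IsCurvatureFrame f U σ₁ σ₂ X₁ X₂) (hf : IsLegendre f)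
    {η : OneForm M} (hη : IsOmegaPotential f η) (hm : IsMiddle f η) {y : M} (hy : y ∈ U) {p : R42}
    (hp : ∀ Z : TangentSpace (𝓡 2) y, η y Z p = 0) : p ∈ f y := by
  obtain ⟨q, hq, hnd⟩ := hη.exists_nondegenerate
  have had := h.adapted hf hy
  have p1 := had.pos₁
  have p2 := had.pos₂
  -- By non-degeneracy Z ↦ (q(Z,X₁), q(Z,X₂)) is bijective. This provides Z₁ with d = 0, c ≠ 0 and
  -- Z₂ with c = 0, d ≠ 0, whatever the directions of η may be.
  let Q : TangentSpace (𝓡 2) y →ₗ[ℝ] ℝ × ℝ := ((q y).flip (X₁ y)).prod ((q y).flip (X₂ y))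
  have hQinj : Function.Injective Q := by
    rw [injective_iff_map_eq_zero]
    intro Z hZ
    refine hnd y Z fun Y => ?_
    obtain ⟨u, w, rfl⟩ := h.exists_comb hf hy Y
    have hZ1 : q y Z (X₁ y) = 0 := congrArg Prod.fst hZ
    have hZ2 : q y Z (X₂ y) = 0 := congrArg Prod.snd hZ
    rw [map_add, map_smul, map_smul, hZ1, hZ2]; simp
  have : FiniteDimensional ℝ (TangentSpace (𝓡 2) y) :=
    inferInstanceAs (FiniteDimensional ℝ E2)
  have hQsurj : Function.Surjective Q :=
    (LinearMap.injective_iff_surjective_of_finrank_eq_finrank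
      (by rw [finrank_tangentSpace]; simp)).1 hQinj
  obtain ⟨Z₁, hZ₁⟩ := hQsurj (0, 1)
  obtain ⟨Z₂, hZ₂⟩ := hQsurj (1, 0)
  obtain ⟨c₁, d₁, μ₁, e₁⟩ := h.middle_form hf hη hm hy Z₁
  obtain ⟨c₂, d₂, μ₂, e₂⟩ := h.middle_form hf hη hm hy Z₂
  obtain ⟨q11, q12⟩ := h.quadratic_differential hf hη.mem hq hy e₁
  obtain ⟨q21, q22⟩ := h.quadratic_differential hf hη.mem hq hy e₂
  rw [show q y Z₁ (X₁ y) = 0 from congrArg Prod.fst hZ₁] at q11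
  rw [show q y Z₁ (X₂ y) = 1 from congrArg Prod.snd hZ₁] at q12
  rw [show q y Z₂ (X₁ y) = 1 from congrArg Prod.fst hZ₂] at q21
  rw [show q y Z₂ (X₂ y) = 0 from congrArg Prod.snd hZ₂] at q22
  have d1 : d₁ = 0 := by
    rcases mul_eq_zero.1 (neg_eq_zero.1 q11.symm) with h | h
    · exact h
    · exact absurd h p2.ne'
  have c2 : c₂ = 0 := by
    rcases mul_eq_zero.1 (neg_eq_zero.1 q22.symm) with h | h
    · exact h
    · exact absurd h p1.ne'
  have c1 : c₁ ≠ 0 := by rintro rfl; simp at q12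
  have d2 : d₂ ≠ 0 := by rintro rfl; simp at q21
  have h1 := hp Z₁
  have h2 := hp Z₂
  rw [e₁, d1] at h1
  rw [e₂, c2] at h2
  simp only [_root_.add_apply, _root_.smul_apply, wedge_apply] at h1 h2
  -- The component of η(Z₁)p along n₁ modulo f; once it vanishes, the component along σ₁ gives (n₁,
  -- p) = 0.
  have a1 : c₁ * ip (σ₁ y) p = 0 := (had.coeff_of_mem (x := c₁ * ip (σ₁ y) p) (y := 0) (by
    have : (c₁ * ip (σ₁ y) p) • D σ₁ y (X₂ y) + (0 : ℝ) • D σ₂ y (X₁ y) =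
        (c₁ * ip (D σ₁ y (X₂ y)) p + μ₁ * ip (σ₂ y) p) • σ₁ y - (μ₁ * ip (σ₁ y) p) • σ₂ y := by
      rw [← sub_eq_zero, ← h1]; module
    rw [this]
    exact sub_mem (Submodule.smul_mem _ _ had.mem₁) (Submodule.smul_mem _ _ had.mem₂))).1
  have a2 : d₂ * ip (σ₂ y) p = 0 := (had.coeff_of_mem (x := 0) (y := d₂ * ip (σ₂ y) p) (by
    have : (0 : ℝ) • D σ₁ y (X₂ y) + (d₂ * ip (σ₂ y) p) • D σ₂ y (X₁ y) =
        (d₂ * ip (D σ₂ y (X₁ y)) p - μ₂ * ip (σ₁ y) p) • σ₂ y + (μ₂ * ip (σ₂ y) p) • σ₁ y := by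
      rw [← sub_eq_zero, ← h2]; module
    rw [this]
    exact add_mem (Submodule.smul_mem _ _ had.mem₂) (Submodule.smul_mem _ _ had.mem₁))).2
  have b1 := (mul_eq_zero.1 a1).resolve_left c1
  have b2 := (mul_eq_zero.1 a2).resolve_left d2
  rw [b1, b2] at h1 h2
  have g1 : c₁ * ip (D σ₁ y (X₂ y)) p = 0 :=
    (had.coeff_eq_zero (x := c₁ * ip (D σ₁ y (X₂ y)) p) (y := 0) (by
      rw [← neg_eq_zero, ← h1]; module)).1
  have g2 : d₂ * ip (D σ₂ y (X₁ y)) p = 0 :=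
    (had.coeff_eq_zero (x := 0) (y := d₂ * ip (D σ₂ y (X₁ y)) p) (by
      rw [← neg_eq_zero, ← h2]; module)).2
  exact had.mem_of_orth b1 b2 ((mul_eq_zero.1 g1).resolve_left c1)
    ((mul_eq_zero.1 g2).resolve_left d2)

end IsCurvatureFrame

theorem IsLinearConserved.mem [Nonempty M] {η : OneForm M} (hf : IsLegendre f) (hu : UmbilicFree f)
    (hη : IsOmegaPotential f η) (hm : IsMiddle f η) {p : LinPoly M} (hp : IsLinearConserved η p)
    (x : M) : p.2 x ∈ f x := by
  obtain ⟨U, σ₁, σ₂, X₁, X₂, hx, h⟩ := hf.exists_curvatureFrame hu x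
  exact h.mem_of_annihilated hf hη hm hx fun Z => (hp.equations x Z).2.2

theorem IsLinearConserved.isSection [Nonempty M] {η : OneForm M} (hf : IsLegendre f)
    (hu : UmbilicFree f) (hη : IsOmegaPotential f η) (hm : IsMiddle f η) {p : LinPoly M}
    (hp : IsLinearConserved η p) : IsSectionOn f univ p.2 :=
  ⟨isOpen_univ, hp.smooth_one.contMDiffOn, fun y _ => hp.mem hf hu hη hm y⟩

/-- The top coefficients of conserved quantities are determined by the bottom coefficients. -/
theorem IsCurvatureFrame.exists_conserved_form [Nonempty M] (h : IsCurvatureFrame f U σ₁ σ₂ X₁ X₂)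
    (hf : IsLegendre f) (hu : UmbilicFree f) {η : OneForm M} (hη : IsOmegaPotential f η)
    (hm : IsMiddle f η) {y : M} (hy : y ∈ U) :
    ∃ C E : ℝ, ∀ p : LinPoly M, IsLinearConserved η p →
      p.2 y = (C * ip (σ₁ y) (p.1 y)) • σ₁ y + (E * ip (σ₂ y) (p.1 y)) • σ₂ y := by
  have had := h.adapted hf hy
  obtain ⟨c₁, d₁, μ₁, e₁⟩ := h.middle_form hf hη hm hy (X₁ y)
  obtain ⟨c₂, d₂, μ₂, e₂⟩ := h.middle_form hf hη hm hy (X₂ y)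
  -- For p₁ = xσ₁ + zσ₂ one has dp₁(X₁) ≡ z n₂ and dp₁(X₂) ≡ x n₁ modulo f. Comparison with dp₁ =
  -- -ηp₀ gives x = -c₂(σ₁,p₀) and z = -d₁(σ₂,p₀).
  refine ⟨-c₂, -d₁, fun p hp => ?_⟩
  have hs := hp.isSection hf hu hη hm
  obtain ⟨x, z, hxz⟩ := had.exists_coeff (hs.mem y (mem_univ y))
  have k1 := hf.deriv_sub_mem h.section₁ h.section₂ hs hy hy (mem_univ y) hxz (X₁ y)
  have k2 := hf.deriv_sub_mem h.section₁ h.section₂ hs hy hy (mem_univ y) hxz (X₂ y)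
  rw [(hp.equations y _).2.1] at k1 k2
  rw [e₁] at k1
  rw [e₂] at k2
  simp only [_root_.add_apply, _root_.smul_apply, wedge_apply] at k1 k2
  have m1 := h.mem_direction₁ hy
  have m2 := h.mem_direction₂ hy
  have s1 := had.mem₁
  have s2 := had.mem₂
  have r1 := (had.coeff_of_mem (x := -(c₁ * ip (σ₁ y) (p.1 y)))
    (y := -(d₁ * ip (σ₂ y) (p.1 y)) - z) (by
      convert add_mem (add_mem (sub_mem (sub_mem k1 (Submodule.smul_mem _
        (c₁ * ip (D σ₁ y (X₂ y)) (p.1 y) + μ₁ * ip (σ₂ y) (p.1 y)) s1))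
        (Submodule.smul_mem _ (d₁ * ip (D σ₂ y (X₁ y)) (p.1 y)) s2))
        (Submodule.smul_mem _ x m1)) (Submodule.smul_mem _ (μ₁ * ip (σ₁ y) (p.1 y)) s2) using 1
      module)).2
  have r2 := (had.coeff_of_mem (x := -(c₂ * ip (σ₁ y) (p.1 y)) - x)
    (y := -(d₂ * ip (σ₂ y) (p.1 y))) (by
      convert add_mem (add_mem (sub_mem (sub_mem k2 (Submodule.smul_mem _
        (c₂ * ip (D σ₁ y (X₂ y)) (p.1 y) + μ₂ * ip (σ₂ y) (p.1 y)) s1))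
        (Submodule.smul_mem _ (d₂ * ip (D σ₂ y (X₁ y)) (p.1 y)) s2))
        (Submodule.smul_mem _ z m2)) (Submodule.smul_mem _ (μ₂ * ip (σ₁ y) (p.1 y)) s2) using 1
      module)).1
  rw [hxz, show x = -c₂ * ip (σ₁ y) (p.1 y) by linarith,
    show z = -d₁ * ip (σ₂ y) (p.1 y) by linarith]

end Middle

/-! ### Planes of conserved quantities -/

theorem g_apply {M : Type*} (P : Submodule ℝ (LinPoly M)) (t : ℝ) (x : M) (α β : P) :
    g P t x α β = ip ((α : LinPoly M).1 x + t • (α : LinPoly M).2 x)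
      ((β : LinPoly M).1 x + t • (β : LinPoly M).2 x) := rfl

theorem gInf_apply {M : Type*} (P : Submodule ℝ (LinPoly M)) (x : M) (α β : P) :
    gInf P x α β = ip ((α : LinPoly M).1 x) ((β : LinPoly M).2 x) +
      ip ((β : LinPoly M).1 x) ((α : LinPoly M).2 x) := rfl

theorem mem_planeAtZero {M : Type*} {P : Submodule ℝ (LinPoly M)} {x : M} {v : R42} :
    v ∈ planeAtZero P x ↔ ∃ α ∈ P, α.1 x = v := by
  simp [planeAtZero, Submodule.mem_map, evalAt_apply]

section Plane

variable {M : Type*} [TopologicalSpace M] [ChartedSpace E2 M]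

theorem IsConservedPlane.eq_zero_or {η : OneForm M} {P : Submodule ℝ (LinPoly M)}
    (h : IsConservedPlane η P) {p : LinPoly M} (hp : p ∈ P) : p = 0 ∨ IsLinearConserved η p :=
  or_iff_not_imp_left.2 (h.conserved p hp)

variable [IsManifold (𝓡 2) ∞ M] {f : M → Submodule ℝ R42} {η : OneForm M}
  {P : Submodule ℝ (LinPoly M)}

namespace IsOmegaWithPlane

theorem mem [Nonempty M] (hf : IsLegendre f) (hu : UmbilicFree f) (h : IsOmegaWithPlane f η P)
    {p : LinPoly M} (hp : p ∈ P) (x : M) : p.2 x ∈ f x := by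
  rcases h.plane.eq_zero_or hp with rfl | hc
  · exact zero_mem _
  · exact hc.mem hf hu h.omega h.middle x

theorem smooth (h : IsOmegaWithPlane f η P) {p : LinPoly M} (hp : p ∈ P) :
    ContMDiff (𝓡 2) 𝓘(ℝ, R42) ∞ p.2 := by
  rcases h.plane.eq_zero_or hp with rfl | hc
  · exact contMDiff_const (c := (0 : R42))
  · exact hc.smooth_one

theorem const_zero [ConnectedSpace M] (h : IsOmegaWithPlane f η P)
    {p : LinPoly M} (hp : p ∈ P) (x y : M) : p.1 x = p.1 y := by
  rcases h.plane.eq_zero_or hp with rfl | hc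
  · rfl
  · exact eq_of_mfderiv_eq_zero hc.mdiff_zero (fun x X => (hc.equations x X).1) x y

theorem exists_form [Nonempty M] (hf : IsLegendre f) (hu : UmbilicFree f)
    (h : IsOmegaWithPlane f η P) {U : Set M} {σ₁ σ₂ : M → R42}
    {X₁ X₂ : ∀ x : M, TangentSpace (𝓡 2) x} (hfr : IsCurvatureFrame f U σ₁ σ₂ X₁ X₂) {y : M}
    (hy : y ∈ U) : ∃ C E : ℝ, ∀ p ∈ P,
      p.2 y = (C * ip (σ₁ y) (p.1 y)) • σ₁ y + (E * ip (σ₂ y) (p.1 y)) • σ₂ y := by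
  obtain ⟨C, E, hCE⟩ := hfr.exists_conserved_form hf hu h.omega h.middle hy
  refine ⟨C, E, fun p hp => ?_⟩
  rcases h.plane.eq_zero_or hp with rfl | hc
  · simp
  · exact hCE p hc

/-- Both sides equal C(σ₁,α₀)(σ₁,β₀) + E(σ₂,α₀)(σ₂,β₀), because C and E are the same for α and β. -/
theorem ip_symm [Nonempty M] (hf : IsLegendre f) (hu : UmbilicFree f)
    (h : IsOmegaWithPlane f η P) {α β : LinPoly M} (hα : α ∈ P) (hβ : β ∈ P) (y : M) :
    ip (α.2 y) (β.1 y) = ip (β.2 y) (α.1 y) := by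
  obtain ⟨U, σ₁, σ₂, X₁, X₂, hy, hfr⟩ := hf.exists_curvatureFrame hu y
  obtain ⟨C, E, hCE⟩ := h.exists_form hf hu hfr hy
  rw [hCE α hα, hCE β hβ]
  simp only [map_add, map_smul, LinearMap.add_apply, LinearMap.smul_apply, smul_eq_mul]
  ring

/-- p₀ is constant and determines p₁ linearly; p₀ = 0 would thus contradict p₁ ≢ 0. -/
theorem eq_zero_of_zero [ConnectedSpace M] (hf : IsLegendre f) (hu : UmbilicFree f)
    (h : IsOmegaWithPlane f η P) {p : LinPoly M} (hp : p ∈ P) {x : M} (h0 : p.1 x = 0) : p = 0 := by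
  rcases h.plane.eq_zero_or hp with rfl | hc
  · rfl
  · refine absurd (funext fun y => ?_) hc.degree_one
    obtain ⟨U, σ₁, σ₂, X₁, X₂, hy, hfr⟩ := hf.exists_curvatureFrame hu y
    obtain ⟨C, E, hCE⟩ := h.exists_form hf hu hfr hy
    rw [hCE p hp, h.const_zero hp y x, h0]
    simp

/-- α(t) and β(t) are parallel for d + tη, which is a metric connection since η is skew. -/
theorem ip_eval_const [ConnectedSpace M] (h : IsOmegaWithPlane f η P) {α β : LinPoly M}
    (hα : α ∈ P) (hβ : β ∈ P) (t : ℝ) (x y : M) :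
    ip (α.1 x + t • α.2 x) (β.1 x + t • β.2 x) = ip (α.1 y + t • α.2 y) (β.1 y + t • β.2 y) := by
  rcases h.plane.eq_zero_or hα with rfl | hcα
  · simp
  rcases h.plane.eq_zero_or hβ with rfl | hcβ
  · simp
  have md : ∀ {p : LinPoly M}, IsLinearConserved η p → ∀ x,
      MDifferentiableAt (𝓡 2) 𝓘(ℝ, R42) (fun y => evalAt t y p) x := fun {p} hc x =>
    (hc.mdiff_zero x).add ((hc.mdiff_one x).const_smul t)
  refine eq_of_mfderiv_eq_zero (h := fun x => ip (evalAt t x α) (evalAt t x β))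
    (fun x => mdifferentiableAt_ip (md hcα x) (md hcβ x)) (fun x X => ?_) x y
  have key : ip (D (fun y => evalAt t y α) x X) (evalAt t x β) +
      ip (evalAt t x α) (D (fun y => evalAt t y β) x X) = 0 := by
    rw [eq_neg_of_add_eq_zero_left (hcα.parallel t x X),
      eq_neg_of_add_eq_zero_left (hcβ.parallel t x X)]
    have := ip_wedge_skew (h.omega.mem x X) (evalAt t x α) (evalAt t x β)
    simp only [map_neg, map_smul, LinearMap.neg_apply, LinearMap.smul_apply, smul_eq_mul]
    linear_combination -t * this
  exact (mfderiv_ip (md hcα x) (md hcβ x) X).trans key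

theorem metrics [ConnectedSpace M] (hf : IsLegendre f) (hu : UmbilicFree f)
    (h : IsOmegaWithPlane f η P) :
    (∀ (t : ℝ) (x y : M), g P t x = g P t y) ∧ (∀ x y : M, gInf P x = gInf P y) ∧
      ∀ (t : ℝ) (x : M), g P t x = g P 0 x + t • gInf P x := by
  have h1 : ∀ (t : ℝ) (x y : M), g P t x = g P t y := fun t x y =>
    LinearMap.ext fun α => LinearMap.ext fun β => h.ip_eval_const α.2 β.2 t x y
  have h2 : ∀ (t : ℝ) (x : M), g P t x = g P 0 x + t • gInf P x := fun t x =>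
    LinearMap.ext fun α => LinearMap.ext fun β => by
      -- The t² term (α₁, β₁) vanishes because top coefficients lie in the isotropic f.
      have h0 := hf.isotropic x _ (h.mem hf hu α.2 x) _ (h.mem hf hu β.2 x)
      simp only [LinearMap.add_apply, LinearMap.smul_apply, g_apply, gInf_apply, map_add, map_smul,
        zero_smul, add_zero, smul_eq_mul, h0]
      rw [ip_comm ((α : LinPoly M).2 x) ((β : LinPoly M).1 x)]
      ring
  refine ⟨h1, fun x y => ?_, h2⟩
  -- g_∞ = g₁ - g₀ inherits constancy from the metrics g_t.
  have := h2 1 x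
  rw [h1 1 x y, h2 1 y, h1 0 x y, one_smul, one_smul] at this
  refine LinearMap.ext fun α => LinearMap.ext fun β => ?_
  have e := congrArg (fun b => b α β) this
  simp only [LinearMap.add_apply] at e
  linarith

end IsOmegaWithPlane

end Plane

/-! ### The projection to a space form in a curvature frame -/

section Projection

variable {M : Type*} [TopologicalSpace M] [ChartedSpace E2 M]
  {f : M → Submodule ℝ R42} {𝔮 𝔭 : R42} {𝔣 𝔱 : M → R42}

namespace IsProjection

theorem section_point (h : IsProjection f 𝔮 𝔭 𝔣 𝔱) : IsSectionOn f univ 𝔣 :=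
  ⟨isOpen_univ, h.smooth_point.contMDiffOn, fun y _ => h.point_mem y⟩

theorem section_plane (h : IsProjection f 𝔮 𝔭 𝔣 𝔱) : IsSectionOn f univ 𝔱 :=
  ⟨isOpen_univ, h.smooth_plane.contMDiffOn, fun y _ => h.plane_mem y⟩

theorem span (h : IsProjection f 𝔮 𝔭 𝔣 𝔱) (hf : IsLegendre f) (y : M) :
    f y = Submodule.span ℝ {𝔣 y, 𝔱 y} := by
  refine span_of_linearIndependent (hf.rank_two y) (h.point_mem y) (h.plane_mem y) ?_
  rw [LinearIndependent.pair_iff]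
  intro u w e
  have e1 := congrArg (fun v => ip v 𝔮) e
  have e2 := congrArg (fun v => ip v 𝔭) e
  simp only [map_add, map_smul, LinearMap.add_apply, LinearMap.smul_apply, h.point_q, h.plane_q,
    h.point_p, h.plane_p, map_zero, LinearMap.zero_apply, smul_eq_mul] at e1 e2
  constructor <;> linarith

/-- Up to sign, 𝔣, 𝔱 is the basis of f dual to the functionals (·,𝔮), (·,𝔭). -/
theorem expand (h : IsProjection f 𝔮 𝔭 𝔣 𝔱) (hf : IsLegendre f) {y : M} {v : R42} (hv : v ∈ f y) :
    v = (-ip v 𝔮) • 𝔣 y + (-ip v 𝔭) • 𝔱 y := by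
  rw [h.span hf y, Submodule.mem_span_pair] at hv
  obtain ⟨u, w, rfl⟩ := hv
  simp only [map_add, map_smul, LinearMap.add_apply, LinearMap.smul_apply, h.point_q, h.plane_q,
    h.point_p, h.plane_p, smul_eq_mul]
  module

theorem eq_zero (h : IsProjection f 𝔮 𝔭 𝔣 𝔱) (hf : IsLegendre f) {y : M} {v : R42} (hv : v ∈ f y)
    (h1 : ip v 𝔮 = 0) (h2 : ip v 𝔭 = 0) : v = 0 := by
  rw [h.expand hf hv, h1, h2]; simp

theorem ip_D_const {σ : M → R42} {x : M} (hσ : MDifferentiableAt (𝓡 2) 𝓘(ℝ, R42) σ x) {w : R42}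
    {c : ℝ} (hc : ∀ z, ip (σ z) w = c) (X : TangentSpace (𝓡 2) x) : ip (D σ x X) w = 0 := by
  have := ip_deriv_eq_zero hσ (mdifferentiableAt_const (c := w))
    (Filter.Eventually.of_forall hc) X
  rwa [D_const, map_zero, add_zero] at this

theorem mdiff_point (h : IsProjection f 𝔮 𝔭 𝔣 𝔱) (x : M) : MDifferentiableAt (𝓡 2) 𝓘(ℝ, R42) 𝔣 x :=
  h.section_point.mdifferentiableAt (mem_univ x)

theorem mdiff_plane (h : IsProjection f 𝔮 𝔭 𝔣 𝔱) (x : M) : MDifferentiableAt (𝓡 2) 𝓘(ℝ, R42) 𝔱 x :=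
  h.section_plane.mdifferentiableAt (mem_univ x)

/-- A combination of derivatives of `𝔣` and `𝔱` that lies in `f` vanishes. -/
theorem D_eq_zero_of_mem (h : IsProjection f 𝔮 𝔭 𝔣 𝔱) (hf : IsLegendre f) {y : M} {u w : ℝ}
    {X Y : TangentSpace (𝓡 2) y} (hm : u • D 𝔣 y X + w • D 𝔱 y Y ∈ f y) :
    u • D 𝔣 y X + w • D 𝔱 y Y = 0 := by
  -- The derivatives of 𝔣 and 𝔱 are orthogonal to the constants 𝔮 and 𝔭, and only 0 ∈ f is
  -- orthogonal to both. This upgrades congruences modulo f to Rodrigues' equations.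
  refine h.eq_zero hf hm ?_ ?_ <;>
  simp only [map_add, map_smul, LinearMap.add_apply, LinearMap.smul_apply, smul_eq_mul,
    ip_D_const (h.mdiff_point y) h.point_q, ip_D_const (h.mdiff_point y) h.point_p,
    ip_D_const (h.mdiff_plane y) h.plane_q, ip_D_const (h.mdiff_plane y) h.plane_p] <;> ring

variable [IsManifold (𝓡 2) ∞ M] {U : Set M} {σ₁ σ₂ : M → R42}
  {X₁ X₂ : ∀ x : M, TangentSpace (𝓡 2) x}

/-- Derivatives along the curvature directions of sections of `f`. -/
theorem _root_.LieSphere.IsCurvatureFrame.deriv_mem (hfr : IsCurvatureFrame f U σ₁ σ₂ X₁ X₂)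
    (hf : IsLegendre f) {V : Set M} {ρ : M → R42} (hρ : IsSectionOn f V ρ) {y : M} (hy : y ∈ U)
    (hV : y ∈ V) {u w : ℝ} (e : ρ y = u • σ₁ y + w • σ₂ y) :
    D ρ y (X₁ y) - w • D σ₂ y (X₁ y) ∈ f y ∧ D ρ y (X₂ y) - u • D σ₁ y (X₂ y) ∈ f y := by
  have k1 := hf.deriv_sub_mem hfr.section₁ hfr.section₂ hρ hy hy hV e (X₁ y)
  have k2 := hf.deriv_sub_mem hfr.section₁ hfr.section₂ hρ hy hy hV e (X₂ y)
  constructor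
  · convert add_mem k1 (Submodule.smul_mem _ u (hfr.mem_direction₁ hy)) using 1
    module
  · convert add_mem k2 (Submodule.smul_mem _ w (hfr.mem_direction₂ hy)) using 1
    module

/-- `𝔣` immerses where both of its coefficients in a curvature frame are non-zero. -/
theorem immersed_of_coeff (h : IsProjection f 𝔮 𝔭 𝔣 𝔱) (hf : IsLegendre f)
    (hfr : IsCurvatureFrame f U σ₁ σ₂ X₁ X₂) {y : M} (hy : y ∈ U) {x₁ x₂ : ℝ}
    (e : 𝔣 y = x₁ • σ₁ y + x₂ • σ₂ y) (h1 : x₁ ≠ 0) (h2 : x₂ ≠ 0) : y ∈ immersedPoints 𝔣 := by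
  change Function.Injective (D 𝔣 y)
  rw [injective_iff_map_eq_zero]
  intro Z hZ
  obtain ⟨u, w, rfl⟩ := hfr.exists_comb hf hy Z
  obtain ⟨k1, k2⟩ := hfr.deriv_mem hf h.section_point hy (mem_univ y) e
  rw [map_add, map_smul, map_smul] at hZ
  obtain ⟨r1, r2⟩ := (hfr.adapted hf hy).coeff_of_mem (x := w * x₁) (y := u * x₂) (by
    convert neg_mem (add_mem (Submodule.smul_mem _ u k1) (Submodule.smul_mem _ w k2)) using 1
    rw [← sub_eq_zero, ← hZ]
    module)
  rw [(mul_eq_zero.1 r2).resolve_right h2, (mul_eq_zero.1 r1).resolve_right h1]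
  simp

theorem coeff_ne_zero (h : IsProjection f 𝔮 𝔭 𝔣 𝔱) (hf : IsLegendre f)
    (hfr : IsCurvatureFrame f U σ₁ σ₂ X₁ X₂) {y : M} (hy : y ∈ U) {x₁ x₂ : ℝ}
    (e : 𝔣 y = x₁ • σ₁ y + x₂ • σ₂ y) (hi : y ∈ immersedPoints 𝔣) : x₁ ≠ 0 ∧ x₂ ≠ 0 := by
  have hi' : Function.Injective (D 𝔣 y) := hi
  rw [injective_iff_map_eq_zero] at hi'
  obtain ⟨k1, k2⟩ := hfr.deriv_mem hf h.section_point hy (mem_univ y) e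
  constructor
  · rintro rfl
    refine hfr.ne_zero₂ y hy (hi' _ ?_)
    have := h.D_eq_zero_of_mem hf (u := 1) (w := 0) (X := X₂ y) (Y := 0)
      (by convert k2 using 1; module)
    simpa using this
  · rintro rfl
    refine hfr.ne_zero₁ y hy (hi' _ ?_)
    have := h.D_eq_zero_of_mem hf (u := 1) (w := 0) (X := X₁ y) (Y := 0)
      (by convert k1 using 1; module)
    simpa using this

/-- The shape operator is diagonal in a curvature frame. -/
theorem exists_shapeOperator (h : IsProjection f 𝔮 𝔭 𝔣 𝔱) (hf : IsLegendre f)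
    (hfr : IsCurvatureFrame f U σ₁ σ₂ X₁ X₂) {y : M} (hy : y ∈ U) {x₁ x₂ y₁ y₂ : ℝ}
    (e : 𝔣 y = x₁ • σ₁ y + x₂ • σ₂ y) (e' : 𝔱 y = y₁ • σ₁ y + y₂ • σ₂ y) (h1 : x₁ ≠ 0) (h2 : x₂ ≠ 0) :
    ∃ A : End ℝ (TangentSpace (𝓡 2) y), IsShapeOperator 𝔣 𝔱 y A ∧
      LinearMap.det A = y₁ * y₂ / (x₁ * x₂) ∧ LinearMap.trace ℝ _ A = -(y₁ / x₁ + y₂ / x₂) := by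
  obtain ⟨b, hb0, hb1⟩ := hfr.exists_basis hf hy
  obtain ⟨k1, k2⟩ := hfr.deriv_mem hf h.section_point hy (mem_univ y) e
  obtain ⟨l1, l2⟩ := hfr.deriv_mem hf h.section_plane hy (mem_univ y) e'
  -- Modulo f, d𝔣(X₁) and d𝔱(X₁) are x₂ and y₂ times n₂ = d_{X₁}σ₂, so the principal curvature along
  -- X₁ is -y₂/x₂. Along X₂ it is -y₁/x₁.
  refine ⟨Matrix.toLin b b (Matrix.diagonal ![-(y₂ / x₂), -(y₁ / x₁)]), ?_, ?_, ?_⟩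
  · have q1 : D 𝔱 y (X₁ y) + -(y₂ / x₂) • D 𝔣 y (X₁ y) = 0 := by
      have := h.D_eq_zero_of_mem hf (u := -(y₂ / x₂)) (w := 1) (X := X₁ y) (Y := X₁ y) (by
        convert add_mem l1 (Submodule.smul_mem _ (-(y₂ / x₂)) k1) using 1
        rw [smul_sub, smul_smul, neg_mul, div_mul_cancel₀ _ h2]
        module)
      rw [← this]; module
    have q2 : D 𝔱 y (X₂ y) + -(y₁ / x₁) • D 𝔣 y (X₂ y) = 0 := by
      have := h.D_eq_zero_of_mem hf (u := -(y₁ / x₁)) (w := 1) (X := X₂ y) (Y := X₂ y) (by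
        convert add_mem l2 (Submodule.smul_mem _ (-(y₁ / x₁)) k2) using 1
        rw [smul_sub, smul_smul, neg_mul, div_mul_cancel₀ _ h1]
        module)
      rw [← this]; module
    have a0 : Matrix.toLin b b (Matrix.diagonal ![-(y₂ / x₂), -(y₁ / x₁)]) (X₁ y) =
        -(y₂ / x₂) • X₁ y := by
      rw [← hb0, Matrix.toLin_self, Fin.sum_univ_two]; simp
    have a1 : Matrix.toLin b b (Matrix.diagonal ![-(y₂ / x₂), -(y₁ / x₁)]) (X₂ y) =
        -(y₁ / x₁) • X₂ y := by
      rw [← hb1, Matrix.toLin_self, Fin.sum_univ_two]; simp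
    intro Z
    obtain ⟨u, w, rfl⟩ := hfr.exists_comb hf hy Z
    simp only [map_add, map_smul, a0, a1]
    calc _ = u • (D 𝔱 y (X₁ y) + -(y₂ / x₂) • D 𝔣 y (X₁ y)) +
          w • (D 𝔱 y (X₂ y) + -(y₁ / x₁) • D 𝔣 y (X₂ y)) := by module
      _ = 0 := by rw [q1, q2]; simp
  · rw [LinearMap.det_toLin, Matrix.det_diagonal, Fin.prod_univ_two]
    simp
    field_simp
  · rw [Matrix.trace_toLin_eq, Matrix.trace_diagonal, Fin.sum_univ_two]
    simp [add_comm]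

/-- The coefficient matrices of a projection and of its pairing with the space form are inverse to
each other. -/
theorem coeff_duality (h : IsProjection f 𝔮 𝔭 𝔣 𝔱) (hf : IsLegendre f)
    (hfr : IsCurvatureFrame f U σ₁ σ₂ X₁ X₂) {y : M} (hy : y ∈ U) {x₁ x₂ y₁ y₂ : ℝ}
    (e : 𝔣 y = x₁ • σ₁ y + x₂ • σ₂ y) (e' : 𝔱 y = y₁ • σ₁ y + y₂ • σ₂ y) :
    ip (σ₁ y) 𝔮 * x₂ + ip (σ₁ y) 𝔭 * y₂ = 0 ∧ ip (σ₂ y) 𝔮 * x₁ + ip (σ₂ y) 𝔭 * y₁ = 0 := by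
  have had := hfr.adapted hf hy
  have h1 := h.expand hf had.mem₁
  have h2 := h.expand hf had.mem₂
  rw [e, e'] at h1 h2
  have c1 := (had.coeff_eq_zero (x := 1 + ip (σ₁ y) 𝔮 * x₁ + ip (σ₁ y) 𝔭 * y₁)
    (y := ip (σ₁ y) 𝔮 * x₂ + ip (σ₁ y) 𝔭 * y₂) (by
      rw [← sub_eq_zero] at h1
      rw [← h1]; module)).2
  have c2 := (had.coeff_eq_zero (x := ip (σ₂ y) 𝔮 * x₁ + ip (σ₂ y) 𝔭 * y₁)
    (y := 1 + ip (σ₂ y) 𝔮 * x₂ + ip (σ₂ y) 𝔭 * y₂) (by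
      rw [← sub_eq_zero] at h2
      rw [← h2]; module)).1
  exact ⟨c1, c2⟩

/-- `𝔣` immerses where no curvature sphere is orthogonal to the point sphere complex. -/
theorem immersed_of_ip (h : IsProjection f 𝔮 𝔭 𝔣 𝔱) (hf : IsLegendre f)
    (hfr : IsCurvatureFrame f U σ₁ σ₂ X₁ X₂) {y : M} (hy : y ∈ U) (h1 : ip (σ₁ y) 𝔭 ≠ 0)
    (h2 : ip (σ₂ y) 𝔭 ≠ 0) : y ∈ immersedPoints 𝔣 := by
  obtain ⟨x₁, x₂, e⟩ := (hfr.adapted hf hy).exists_coeff (h.point_mem y)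
  have hq := h.point_q y
  have hp := h.point_p y
  rw [e] at hq hp
  simp only [map_add, map_smul, LinearMap.add_apply, LinearMap.smul_apply, smul_eq_mul] at hq hp
  refine h.immersed_of_coeff hf hfr hy e ?_ ?_
  · rintro rfl
    have : x₂ = 0 := by simpa [h2] using hp
    rw [this] at hq
    norm_num at hq
  · rintro rfl
    have : x₁ = 0 := by simpa [h1] using hp
    rw [this] at hq
    norm_num at hq

end IsProjection

end Projection

/-! ### The inverse of `φ_∞` -/

section Tensor

variable {V : Type*} [AddCommGroup V] [Module ℝ V] {h : LinearMap.BilinForm ℝ V} {α β : V}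
  {A B C : ℝ}

theorem phiInf_tmul (h : LinearMap.BilinForm ℝ V) (a b v w : V) :
    phiInf h (a ⊗ₜ b) v w = h a v * h b w := rfl

theorem exists_tensor_coeff (hgen : ∀ v : V, ∃ s t : ℝ, v = s • α + t • β) (w : V ⊗[ℝ] V) :
    ∃ x y z t : ℝ, w = x • (α ⊗ₜ α) + y • (α ⊗ₜ β) + z • (β ⊗ₜ α) + t • (β ⊗ₜ β) := by
  induction w with
  | zero => exact ⟨0, 0, 0, 0, by simp⟩
  | tmul a b =>
    obtain ⟨s, t, rfl⟩ := hgen a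
    obtain ⟨s', t', rfl⟩ := hgen b
    refine ⟨s * s', s * t', t * s', t * t', ?_⟩
    simp only [TensorProduct.add_tmul, TensorProduct.tmul_add, ← TensorProduct.smul_tmul',
      TensorProduct.tmul_smul]
    module
  | add a b ha hb =>
    obtain ⟨x, y, z, t, rfl⟩ := ha
    obtain ⟨x', y', z', t', rfl⟩ := hb
    exact ⟨x + x', y + y', z + z', t + t', by module⟩

theorem phiInf_injective (hgen : ∀ v : V, ∃ s t : ℝ, v = s • α + t • β) (hA : h α α = A)
    (hB : h α β = B) (hB' : h β α = B) (hC : h β β = C) (hdet : A * C - B * B ≠ 0) :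
    Function.Injective (phiInf h) := by
  rw [injective_iff_map_eq_zero]
  intro w hw
  obtain ⟨x, y, z, t, rfl⟩ := exists_tensor_coeff hgen w
  have key : ∀ a b a' b' : ℝ, x * ((a * A + b * B) * (a' * A + b' * B)) +
      y * ((a * A + b * B) * (a' * B + b' * C)) + z * ((a * B + b * C) * (a' * A + b' * B)) +
      t * ((a * B + b * C) * (a' * B + b' * C)) = 0 := by
    intro a b a' b'
    have := congrArg (fun T => T (a • α + b • β) (a' • α + b' • β)) hw
    simp only [map_add, map_smul, LinearMap.add_apply, LinearMap.smul_apply, phiInf_tmul, hA, hB,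
      hB', hC, smul_eq_mul, LinearMap.zero_apply] at this
    linear_combination this
  -- The test vectors Cα - Bβ and -Bα + Aβ are dual to α, β up to the factor AC - B²; each pair of
  -- them isolates one coefficient.
  have h1 := key C (-B) C (-B)
  have h2 := key C (-B) (-B) A
  have h3 := key (-B) A C (-B)
  have h4 := key (-B) A (-B) A
  have hd2 : (A * C - B * B) * (A * C - B * B) ≠ 0 := mul_ne_zero hdet hdet
  have hx : x = 0 := (mul_eq_zero.1 (show x * ((A * C - B * B) * (A * C - B * B)) = 0 by
    linear_combination h1)).resolve_right hd2
  have hy : y = 0 := (mul_eq_zero.1 (show y * ((A * C - B * B) * (A * C - B * B)) = 0 by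
    linear_combination h2)).resolve_right hd2
  have hz : z = 0 := (mul_eq_zero.1 (show z * ((A * C - B * B) * (A * C - B * B)) = 0 by
    linear_combination h3)).resolve_right hd2
  have ht : t = 0 := (mul_eq_zero.1 (show t * ((A * C - B * B) * (A * C - B * B)) = 0 by
    linear_combination h4)).resolve_right hd2
  simp [hx, hy, hz, ht]

/-- The symmetric tensor inverse to a metric with Gram matrix `(A, B; B, C)`. -/
noncomputable def inverseTensor (α β : V) (A B C : ℝ) : V ⊗[ℝ] V :=
  (A * C - B * B)⁻¹ • (C • symProd α α + (2 * -B) • symProd α β + A • symProd β β)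

theorem inverseTensor_mem (α β : V) (A B C : ℝ) : inverseTensor α β A B C ∈ symSq V := by
  have hm : ∀ a b : V, symProd a b ∈ symSq V := fun a b => Submodule.subset_span ⟨a, b, rfl⟩
  exact Submodule.smul_mem _ _ (add_mem (add_mem (Submodule.smul_mem _ _ (hm _ _))
    (Submodule.smul_mem _ _ (hm _ _))) (Submodule.smul_mem _ _ (hm _ _)))

theorem phiInf_inverseTensor (hgen : ∀ v : V, ∃ s t : ℝ, v = s • α + t • β) (hA : h α α = A)
    (hB : h α β = B) (hB' : h β α = B) (hC : h β β = C) (hdet : A * C - B * B ≠ 0) :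
    phiInf h (inverseTensor α β A B C) = h := by
  refine LinearMap.ext fun v => LinearMap.ext fun w => ?_
  obtain ⟨a, b, rfl⟩ := hgen v
  obtain ⟨a', b', rfl⟩ := hgen w
  simp only [inverseTensor, symProd, map_add, map_smul, LinearMap.add_apply, LinearMap.smul_apply,
    phiInf_tmul, hA, hB, hB', hC, smul_eq_mul]
  have hinv := mul_inv_cancel₀ hdet
  generalize (A * C - B * B)⁻¹ = d at hinv ⊢
  linear_combination (a * a' * A + a * b' * B + b * a' * B + b * b' * C) * hinv

end Tensor

/-- Pairing the tensor with products of u and v, which are dual to 𝔮, 𝔭 up to sign, recovers a, b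
and c. -/
theorem weingartenTensor_ne_zero {𝔮 𝔭 u v : R42} (huq : ip u 𝔮 = -1) (hup : ip u 𝔭 = 0)
    (hvq : ip v 𝔮 = 0) (hvp : ip v 𝔭 = -1) {a b c : ℝ} (h : a ≠ 0 ∨ b ≠ 0 ∨ c ≠ 0) :
    weingartenTensor 𝔮 𝔭 a b c ≠ 0 := by
  intro h0
  have key : ∀ s t : R42, a * (ip s 𝔮 * ip t 𝔮) + b * (ip s 𝔮 * ip t 𝔭 + ip s 𝔭 * ip t 𝔮) +
      c * (ip s 𝔭 * ip t 𝔭) = 0 := by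
    intro s t
    have := congrArg (TensorProduct.lift ((LinearMap.mul ℝ ℝ).compl₁₂ (ip s) (ip t))) h0
    simp only [weingartenTensor, symProd, map_add, map_smul, TensorProduct.lift.tmul,
      LinearMap.compl₁₂_apply, LinearMap.mul_apply', smul_eq_mul, map_zero] at this
    linear_combination this
  have h1 := key u u
  have h2 := key u v
  have h3 := key v v
  simp only [huq, hup, hvq, hvp] at h1 h2 h3
  rcases h with h | h | h <;> apply h <;> linarith

/-- φ_∞⁻¹(g_∞) is the inverse of the Gram matrix (A, B; B, C), that is, (C, -B; -B, A) divided by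
the determinant. The class [W] does not see the factor k. -/
theorem isWeingartenClass_of_gram {M : Type*} [TopologicalSpace M] [ChartedSpace E2 M]
    {P : Submodule ℝ (LinPoly M)} {x : M} {α β : P} {A B C : ℝ}
    (hgen : ∀ v : P, ∃ s t : ℝ, v = s • α + t • β) (hA : gInf P x α α = A)
    (hB : gInf P x α β = B) (hC : gInf P x β β = C) (hdet : A * C - B * B ≠ 0) {k : ℝ}
    (hW : weingartenTensor ((α : LinPoly M).1 x) ((β : LinPoly M).1 x) (k * C) (k * -B) (k * A) ≠ 0) :
    IsWeingartenClass P x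
      (weingartenTensor ((α : LinPoly M).1 x) ((β : LinPoly M).1 x) (k * C) (k * -B) (k * A)) := by
  have hB' : gInf P x β α = B := by rw [← hB, gInf_apply, gInf_apply, add_comm]
  have hev : ∀ γ : P, ev P 0 x γ = (γ : LinPoly M).1 x := fun γ => by
    change (γ : LinPoly M).1 x + (0 : ℝ) • (γ : LinPoly M).2 x = _
    simp
  have hphi : phi P 0 x (inverseTensor α β A B C) = (A * C - B * B)⁻¹ •
      weingartenTensor ((α : LinPoly M).1 x) ((β : LinPoly M).1 x) C (-B) A := by
    simp only [phi, inverseTensor, weingartenTensor, symProd, map_add, map_smul,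
      TensorProduct.map_tmul, hev]
  have hrel : weingartenTensor ((α : LinPoly M).1 x) ((β : LinPoly M).1 x) (k * C) (k * -B) (k * A) =
      (k * (A * C - B * B)) • phi P 0 x (inverseTensor α β A B C) := by
    rw [hphi, smul_smul, mul_assoc, mul_inv_cancel₀ hdet, mul_one, weingartenTensor,
      weingartenTensor]
    module
  refine ⟨inverseTensor α β A B C, inverseTensor_mem _ _ _ _ _,
    phiInf_inverseTensor hgen hA hB hB' hC hdet, fun w' _ hw' =>
      phiInf_injective hgen hA hB hB' hC hdet
        (hw'.trans (phiInf_inverseTensor hgen hA hB hB' hC hdet).symm), hW, ?_, ?_⟩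
  · intro h0
    rw [hrel, h0, smul_zero] at hW
    exact hW rfl
  · rw [Projectivization.mk_eq_mk_iff']
    exact ⟨_, hrel.symm⟩

/-! ### From conserved quantities to linear Weingarten surfaces -/

theorem IsSpaceForm.linearIndependent {𝔮 𝔭 : R42} (h : IsSpaceForm 𝔮 𝔭) {u w : ℝ}
    (e : u • 𝔮 + w • 𝔭 = 0) : u = 0 ∧ w = 0 := by
  have hp : ip 𝔭 𝔭 ≠ 0 := by rcases h.unit with h | h <;> rw [h] <;> norm_num
  have e1 := congrArg (fun v => ip v 𝔭) e
  simp only [map_add, map_smul, LinearMap.add_apply, LinearMap.smul_apply, smul_eq_mul,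
    h.orthogonal, map_zero, LinearMap.zero_apply, mul_zero, zero_add] at e1
  have hw : w = 0 := (mul_eq_zero.1 e1).resolve_right hp
  subst hw
  simpa [h.ne_zero] using e

theorem exists_normalizer {d : ℝ} (hd : d ≠ 0) : ∃ c : ℝ, c ≠ 0 ∧ (c * c * d = 1 ∨ c * c * d = -1) := by
  have h0 : 0 < |d| := abs_pos.2 hd
  have hs : Real.sqrt |d| * Real.sqrt |d| = |d| := Real.mul_self_sqrt h0.le
  refine ⟨(Real.sqrt |d|)⁻¹, inv_ne_zero (Real.sqrt_pos.2 h0).ne', ?_⟩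
  rw [← mul_inv, hs]
  rcases abs_choice d with h | h
  · left; rw [h]; exact inv_mul_cancel₀ hd
  · right; rw [h, inv_neg, neg_mul, inv_mul_cancel₀ hd]

namespace IsOmegaWithPlane

variable {M : Type*} [TopologicalSpace M] [ChartedSpace E2 M] [IsManifold (𝓡 2) ∞ M]
  [ConnectedSpace M] {f : M → Submodule ℝ R42} {η : OneForm M} {P : Submodule ℝ (LinPoly M)}

/-- By polarisation g₀ ≠ 0 has a non-null vector; normalised, it is the point sphere complex, and a
non-zero g₀-orthogonal vector of P is the space form vector. -/
theorem exists_spaceForm (hf : IsLegendre f) (hu : UmbilicFree f) (h : IsOmegaWithPlane f η P)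
    {x : M} (hg : g P 0 x ≠ 0) : ∃ α ∈ P, ∃ β ∈ P, IsSpaceForm (α.1 x) (β.1 x) := by
  have hg0 : ∀ α β : P, g P 0 x α β = ip ((α : LinPoly M).1 x) ((β : LinPoly M).1 x) := by
    intro α β; simp [g_apply]
  obtain ⟨β, hβ⟩ : ∃ β : P, g P 0 x β β ≠ 0 := by
    by_contra! hall
    refine hg (LinearMap.ext fun v => LinearMap.ext fun w => ?_)
    have h1 := hall (v + w)
    have h2 := hall v
    have h3 := hall w
    simp only [map_add, LinearMap.add_apply, h2, h3] at h1
    have h4 : g P 0 x v w = g P 0 x w v := by rw [hg0, hg0, ip_comm]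
    rw [LinearMap.zero_apply, LinearMap.zero_apply]
    linarith
  obtain ⟨c, hc, hcu⟩ := exists_normalizer hβ
  have : FiniteDimensional ℝ P := FiniteDimensional.of_finrank_eq_succ h.plane.dim_two
  have hker := LinearMap.ker_ne_bot_of_finrank_lt (f := (g P 0 x).flip β)
    (by rw [h.plane.dim_two]; simp)
  obtain ⟨α, hα, hα0⟩ := (Submodule.ne_bot_iff _).1 hker
  have hα' : g P 0 x α β = 0 := hα
  refine ⟨α, α.2, c • β, P.smul_mem c β.2, ?_, ?_, ?_⟩
  · have : ip ((c • (β : LinPoly M)).1 x) ((c • (β : LinPoly M)).1 x) = c * c * g P 0 x β β := by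
      rw [hg0]
      simp only [Prod.smul_fst, Pi.smul_apply, map_smul, LinearMap.smul_apply, smul_eq_mul]
      ring
    rwa [this]
  · rw [hg0] at hα'
    simp [hα']
  · intro h0
    exact hα0 (Subtype.ext (h.eq_zero_of_zero hf hu α.2 h0))

theorem exists_projection (hf : IsLegendre f) (hu : UmbilicFree f) (h : IsOmegaWithPlane f η P)
    {x : M} (hnd : (gInf P x).Nondegenerate) {α β : LinPoly M} (hα : α ∈ P) (hβ : β ∈ P)
    (hsf : IsSpaceForm (α.1 x) (β.1 x)) :
    ∃ (𝔣 𝔱 : M → R42) (a b c : ℝ), IsNonTubularProjection f (α.1 x) (β.1 x) 𝔣 𝔱 a b c ∧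
      IsWeingartenClass P x (weingartenTensor (α.1 x) (β.1 x) a b c) := by
  set 𝔮 := α.1 x with hq
  set 𝔭 := β.1 x with hp
  let α' : P := ⟨α, hα⟩
  let β' : P := ⟨β, hβ⟩
  have hli' : ∀ u w : ℝ, u • α' + w • β' = 0 → u = 0 ∧ w = 0 := by
    intro u w e
    have e1 : u • α + w • β = 0 := congrArg Subtype.val e
    exact hsf.linearIndependent (congrFun (congrArg Prod.fst e1) x)
  have hgen : ∀ v : P, ∃ s t : ℝ, v = s • α' + t • β' := by
    intro v
    let b := basisOfLinearIndependentOfCardEqFinrank (LinearIndependent.pair_iff.2 hli')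
      (by rw [h.plane.dim_two]; simp)
    refine ⟨b.repr v 0, b.repr v 1, ?_⟩
    have hb0 : b 0 = α' := by simp [b]
    have hb1 : b 1 = β' := by simp [b]
    rw [← hb0, ← hb1, ← Fin.sum_univ_two (fun i => b.repr v i • b i), b.sum_repr]
  set A := gInf P x α' α' with hA
  set B := gInf P x α' β' with hB
  set C := gInf P x β' β' with hC
  have hB' : gInf P x β' α' = B := by rw [hB, gInf_apply, gInf_apply, add_comm]
  have hdet : A * C - B * B ≠ 0 := by
    intro h0
    have hzero : ∀ s t : ℝ, s * A + t * B = 0 → s * B + t * C = 0 → s = 0 ∧ t = 0 := by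
      intro s t h1 h2
      refine hli' s t (hnd.1 _ fun w => ?_)
      obtain ⟨a, b, rfl⟩ := hgen w
      simp only [map_add, map_smul, LinearMap.add_apply, LinearMap.smul_apply, ← hA, ← hB, ← hC,
        hB', smul_eq_mul]
      linear_combination a * h1 + b * h2
    -- If the determinant vanished, the columns of the adjugate would lie in the trivial kernel,
    -- forcing A = B = C = 0.
    obtain ⟨z1, z2⟩ := hzero C (-B) (by linarith) (by ring)
    obtain ⟨z3, z4⟩ := hzero (-B) A (by ring) (by linarith)
    have := (hzero 1 0 (by rw [z4]; linarith) (by rw [z1]; linarith)).1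
    norm_num at this
  obtain ⟨-, hconst, -⟩ := h.metrics hf hu
  have cα : ∀ y, α.1 y = 𝔮 := fun y => h.const_zero hα y x
  have cβ : ∀ y, β.1 y = 𝔭 := fun y => h.const_zero hβ y x
  have vA : ∀ y, ip (α.2 y) 𝔮 = A / 2 := fun y => by
    have : gInf P y α' α' = A := by rw [hconst y x]
    rw [gInf_apply, ip_comm (α.1 y), cα y] at this
    linarith
  have vC : ∀ y, ip (β.2 y) 𝔭 = C / 2 := fun y => by
    have : gInf P y β' β' = C := by rw [hconst y x]
    rw [gInf_apply, ip_comm (β.1 y), cβ y] at this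
    linarith
  have hsym : ∀ y, ip (α.2 y) 𝔭 = ip (β.2 y) 𝔮 := fun y => by
    have := h.ip_symm hf hu hα hβ y
    rwa [cα y, cβ y] at this
  have vB : ∀ y, ip (α.2 y) 𝔭 = B / 2 := fun y => by
    have : gInf P y α' β' = B := by rw [hconst y x]
    rw [gInf_apply, ip_comm (α.1 y), ip_comm (β.1 y), cα y, cβ y] at this
    have := hsym y
    linarith
  have vB' : ∀ y, ip (β.2 y) 𝔮 = B / 2 := fun y => by rw [← hsym, vB]
  -- The pairings of α₁, β₁ with 𝔮, 𝔭 form half the Gram matrix of g_∞. The coefficients of 𝔣 and 𝔱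
  -- are the entries of minus its inverse, to match the normalisation -1.
  let 𝔣 : M → R42 := fun y => (-(2 * C / (A * C - B * B))) • α.2 y + (2 * B / (A * C - B * B)) • β.2 y
  let 𝔱 : M → R42 := fun y => (2 * B / (A * C - B * B)) • α.2 y + (-(2 * A / (A * C - B * B))) • β.2 y
  have sm : ∀ u w : ℝ, ContMDiff (𝓡 2) 𝓘(ℝ, R42) ∞ (fun y => u • α.2 y + w • β.2 y) := fun u w =>
    ((contMDiff_const (I := 𝓡 2) (I' := 𝓘(ℝ, ℝ)) (c := u)).smul (h.smooth hα)).add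
      ((contMDiff_const (I := 𝓡 2) (I' := 𝓘(ℝ, ℝ)) (c := w)).smul (h.smooth hβ))
  have mm : ∀ (u w : ℝ) y, u • α.2 y + w • β.2 y ∈ f y := fun u w y =>
    add_mem (Submodule.smul_mem _ _ (h.mem hf hu hα y)) (Submodule.smul_mem _ _ (h.mem hf hu hβ y))
  have hproj : IsProjection f 𝔮 𝔭 𝔣 𝔱 :=
    { smooth_point := sm _ _
      smooth_plane := sm _ _
      point_mem := mm _ _
      plane_mem := mm _ _
      point_q := fun y => by
        simp only [𝔣, map_add, map_smul, LinearMap.add_apply, LinearMap.smul_apply, smul_eq_mul,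
          vA, vB']
        linear_combination -mul_inv_cancel₀ hdet
      point_p := fun y => by
        simp only [𝔣, map_add, map_smul, LinearMap.add_apply, LinearMap.smul_apply, smul_eq_mul,
          vB, vC]
        field_simp
        ring
      plane_q := fun y => by
        simp only [𝔱, map_add, map_smul, LinearMap.add_apply, LinearMap.smul_apply, smul_eq_mul,
          vA, vB']
        field_simp
        ring
      plane_p := fun y => by
        simp only [𝔱, map_add, map_smul, LinearMap.add_apply, LinearMap.smul_apply, smul_eq_mul,
          vB, vC]
        linear_combination -mul_inv_cancel₀ hdet }
  have hne : 1 * C ≠ 0 ∨ 1 * -B ≠ 0 ∨ 1 * A ≠ 0 := by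
    by_contra! h0
    apply hdet
    have h1 : C = 0 := by linarith [h0.1]
    have h2 : B = 0 := by linarith [h0.2.1]
    rw [h1, h2]; ring
  refine ⟨𝔣, 𝔱, 1 * C, 1 * -B, 1 * A, ⟨hsf, hproj, ⟨hne, fun y hy => ?_⟩, ?_⟩, ?_⟩
  · obtain ⟨U, σ₁, σ₂, X₁, X₂, hyU, hfr⟩ := hf.exists_curvatureFrame hu y
    have had := hfr.adapted hf hyU
    obtain ⟨x₁, x₂, e⟩ := had.exists_coeff (hproj.point_mem y)
    obtain ⟨y₁, y₂, e'⟩ := had.exists_coeff (hproj.plane_mem y)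
    obtain ⟨hx₁, hx₂⟩ := hproj.coeff_ne_zero hf hfr hyU e hy
    obtain ⟨S, hS, hSd, hSt⟩ := hproj.exists_shapeOperator hf hfr hyU e e' hx₁ hx₂
    refine ⟨S, hS, ?_⟩
    obtain ⟨d1, d2⟩ := hproj.coeff_duality hf hfr hyU e e'
    obtain ⟨c₁, c₂, hform⟩ := h.exists_form hf hu hfr hyU
    have fα := hform α hα
    have fβ := hform β hβ
    have wA := vA y
    have wB := vB y
    have wC := vC y
    rw [fα] at wA wB
    rw [fβ] at wC
    simp only [map_add, map_smul, LinearMap.add_apply, LinearMap.smul_apply, smul_eq_mul, cα,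
      cβ] at wA wB wC
    have hA2 : A = 2 * (c₁ * ip (σ₁ y) 𝔮 * ip (σ₁ y) 𝔮 + c₂ * ip (σ₂ y) 𝔮 * ip (σ₂ y) 𝔮) := by linarith
    have hB2 : B = 2 * (c₁ * ip (σ₁ y) 𝔮 * ip (σ₁ y) 𝔭 + c₂ * ip (σ₂ y) 𝔮 * ip (σ₂ y) 𝔭) := by linarith
    have hC2 : C = 2 * (c₁ * ip (σ₁ y) 𝔭 * ip (σ₁ y) 𝔭 + c₂ * ip (σ₂ y) 𝔭 * ip (σ₂ y) 𝔭) := by linarith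
    -- Diagonality of g_∞ splits this into two products, one for each curvature sphere; each has a
    -- factor that vanishes by duality. Dividing by x₁x₂ gives the Weingarten equation with (a, b,
    -- c) = (C, -B, A).
    have hpoly : C * (y₁ * y₂) + B * (y₁ * x₂ + y₂ * x₁) + A * (x₁ * x₂) = 0 := by
      rw [hA2, hB2, hC2]
      linear_combination 2 * c₁ * (ip (σ₁ y) 𝔭 * y₁ + ip (σ₁ y) 𝔮 * x₁) * d1 +
        2 * c₂ * (ip (σ₂ y) 𝔭 * y₂ + ip (σ₂ y) 𝔮 * x₂) * d2
    rw [hSd, hSt]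
    field_simp
    linear_combination hpoly
  · intro h0
    apply hdet
    linear_combination -h0
  · exact isWeingartenClass_of_gram (α := α') (β := β') hgen hA.symm hB.symm hC.symm hdet
      (weingartenTensor_ne_zero (hproj.point_q x) (hproj.point_p x) (hproj.plane_q x)
        (hproj.plane_p x) hne)

/-- For a suitable choice of space form in `P(0)`, the projection immerses on a dense set. -/
theorem exists_dense_projection [SecondCountableTopology M] (hf : IsLegendre f) (hu : UmbilicFree f)
    (h : IsOmegaWithPlane f η P) {x : M} (hg : g P 0 x ≠ 0) (hnd : (gInf P x).Nondegenerate) :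
    ∃ (𝔮 𝔭 : R42) (𝔣 𝔱 : M → R42) (a b c : ℝ),
      IsNonTubularProjection f 𝔮 𝔭 𝔣 𝔱 a b c ∧ Dense (immersedPoints 𝔣) := by
  obtain ⟨α, hα, β, hβ, hsf⟩ := h.exists_spaceForm hf hu hg
  obtain ⟨𝔣₀, 𝔱₀, a₀, b₀, c₀, hpr, -⟩ := h.exists_projection hf hu hnd hα hβ hsf
  set 𝔮 := α.1 x
  set 𝔭 := β.1 x
  have hline : ∀ u v : ℝ, ¬ (u = 0 ∧ v = 0) → {l : ℝ | u + l * v = 0}.Countable := by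
    intro u v huv
    refine Set.Subsingleton.countable fun l hl l' hl' => ?_
    have e1 : u + l * v = 0 := hl
    have e2 : u + l' * v = 0 := hl'
    have hv : v ≠ 0 := fun hv => huv ⟨by rw [hv] at e1; linarith, hv⟩
    exact mul_right_cancel₀ hv (by linarith)
  -- With 𝔭 + l𝔮 as point sphere complex, 𝔣 can fail to immerse at y only if a curvature sphere at y
  -- is orthogonal to it; each of the two spheres excludes at most one l.
  have hbad : ∀ y : M, ∃ S : Set ℝ, S.Countable ∧ ∀ l ∉ S, ∀ (c : ℝ) (𝔮' : R42) (𝔣 𝔱 : M → R42),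
      c ≠ 0 → IsProjection f 𝔮' (c • (𝔭 + l • 𝔮)) 𝔣 𝔱 → y ∈ immersedPoints 𝔣 := by
    intro y
    obtain ⟨U, σ₁, σ₂, X₁, X₂, hyU, hfr⟩ := hf.exists_curvatureFrame hu y
    have had := hfr.adapted hf hyU
    have hne : ∀ v ∈ f y, v ≠ 0 → ¬ (ip v 𝔭 = 0 ∧ ip v 𝔮 = 0) := fun v hv hv0 hh =>
      hv0 (hpr.projection.eq_zero hf hv hh.2 hh.1)
    refine ⟨{l | ip (σ₁ y) 𝔭 + l * ip (σ₁ y) 𝔮 = 0} ∪ {l | ip (σ₂ y) 𝔭 + l * ip (σ₂ y) 𝔮 = 0},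
      (hline _ _ (hne _ had.mem₁ (had.indep.ne_zero 0))).union
        (hline _ _ (hne _ had.mem₂ (had.indep.ne_zero 1))), fun l hl c 𝔮' 𝔣 𝔱 hc hpr' => ?_⟩
    rw [mem_union, not_or] at hl
    refine hpr'.immersed_of_ip hf hfr hyU ?_ ?_
    · rw [map_smul, smul_eq_mul]
      exact mul_ne_zero hc (by simpa using hl.1)
    · rw [map_smul, smul_eq_mul]
      exact mul_ne_zero hc (by simpa using hl.2)
  choose S hS hSi using hbad
  obtain ⟨Q, hQc, hQd⟩ := TopologicalSpace.exists_countable_dense M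
  have hquad : {l : ℝ | ip 𝔭 𝔭 + l * l * ip 𝔮 𝔮 = 0}.Countable := by
    refine Set.Countable.mono (s₂ := {Real.sqrt (-ip 𝔭 𝔭 / ip 𝔮 𝔮), -Real.sqrt (-ip 𝔭 𝔭 / ip 𝔮 𝔮)})
      (fun l hl => ?_) (Set.toFinite _).countable
    have e : ip 𝔭 𝔭 + l * l * ip 𝔮 𝔮 = 0 := hl
    have hq0 : ip 𝔮 𝔮 ≠ 0 := by
      intro h0
      rw [h0] at e
      rcases hsf.unit with h | h <;> rw [h] at e <;> norm_num at e
    have e2 : -ip 𝔭 𝔭 / ip 𝔮 𝔮 = l * l := by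
      rw [div_eq_iff hq0]; linarith
    rw [e2, Real.sqrt_mul_self_eq_abs]
    rcases abs_choice l with hl | hl <;> rw [hl] <;> simp
  -- Avoiding countably many l secures immersion on a countable dense set of points; the first set
  -- keeps 𝔭 + l𝔮 non-null.
  have hcount : ({l : ℝ | ip 𝔭 𝔭 + l * l * ip 𝔮 𝔮 = 0} ∪ ⋃ y ∈ Q, S y).Countable :=
    hquad.union (hQc.biUnion fun y _ => hS y)
  obtain ⟨l, hl⟩ : ∃ l : ℝ, l ∉ {l : ℝ | ip 𝔭 𝔭 + l * l * ip 𝔮 𝔮 = 0} ∪ ⋃ y ∈ Q, S y := by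
    by_contra! hall
    exact Cardinal.not_countable_real (hcount.mono fun l _ => hall l)
  rw [mem_union, not_or] at hl
  have hl1 : ip 𝔭 𝔭 + l * l * ip 𝔮 𝔮 ≠ 0 := hl.1
  have hl2 : ∀ y ∈ Q, l ∉ S y := fun y hy hlS => hl.2 (mem_biUnion hy hlS)
  obtain ⟨c, hc, hcu⟩ := exists_normalizer hl1
  have hqp : ip 𝔭 𝔮 = 0 := by rw [ip_comm, hsf.orthogonal]
  -- The new space form vector l(𝔮,𝔮)𝔭 - (𝔭,𝔭)𝔮 spans the orthogonal complement of 𝔭 + l𝔮 in ⟨𝔮, 𝔭⟩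
  -- and is non-zero because (𝔭,𝔭) = ±1.
  have hsf' : IsSpaceForm (((l * ip 𝔮 𝔮) • β + (-ip 𝔭 𝔭) • α).1 x) ((c • (β + l • α)).1 x) := by
    change IsSpaceForm ((l * ip 𝔮 𝔮) • 𝔭 + (-ip 𝔭 𝔭) • 𝔮) (c • (𝔭 + l • 𝔮))
    refine ⟨?_, ?_, ?_⟩
    · convert hcu using 2 <;>
      · simp only [map_add, map_smul, LinearMap.add_apply, LinearMap.smul_apply, smul_eq_mul,
          hsf.orthogonal, hqp]
        ring
    · simp only [map_add, map_smul, LinearMap.add_apply, LinearMap.smul_apply, smul_eq_mul,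
        hsf.orthogonal, hqp]
      ring
    · intro h0
      have := (hsf.linearIndependent (u := -ip 𝔭 𝔭) (w := l * ip 𝔮 𝔮) (by rw [← h0]; module)).1
      rcases hsf.unit with h | h <;> rw [h] at this <;> norm_num at this
  obtain ⟨𝔣, 𝔱, a, b, d, hpr', -⟩ := h.exists_projection hf hu hnd
    (P.add_mem (P.smul_mem _ hβ) (P.smul_mem _ hα))
    (P.smul_mem c (P.add_mem hβ (P.smul_mem l hα))) hsf'
  exact ⟨_, _, 𝔣, 𝔱, a, b, d, hpr', hQd.mono fun y hy =>
    hSi y l (hl2 y hy) c _ 𝔣 𝔱 hc hpr'.projection⟩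

end IsOmegaWithPlane

/-! ### Auxiliary linear algebra in dimension two -/

/-- The action of A on ∧² of a plane: det A is multiplication on ∧²T, and tr A is its derivation
version. This is how K and H enter the ∧²-valued form. -/
theorem wedge_trace_det {T : Type*} [AddCommGroup T] [Module ℝ T] (b : Basis (Fin 2) ℝ T)
    (A : End ℝ T) (L : T →ₗ[ℝ] R42) (X Y : T) :
    wedge (L (A X)) (L Y) + wedge (L X) (L (A Y)) = LinearMap.trace ℝ T A • wedge (L X) (L Y) ∧
      wedge (L (A X)) (L (A Y)) = LinearMap.det A • wedge (L X) (L Y) := by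
  have hv : ∀ v, v = b.repr v 0 • b 0 + b.repr v 1 • b 1 := fun v => by
    rw [← Fin.sum_univ_two (fun i => b.repr v i • b i), b.sum_repr]
  have h0 := hv (A (b 0))
  have h1 := hv (A (b 1))
  rw [← LinearMap.det_toMatrix b, Matrix.det_fin_two, LinearMap.trace_eq_matrix_trace ℝ b,
    Matrix.trace_fin_two]
  simp only [LinearMap.toMatrix_apply]
  generalize b.repr (A (b 0)) 0 = p at *
  generalize b.repr (A (b 0)) 1 = q at *
  generalize b.repr (A (b 1)) 0 = r at *
  generalize b.repr (A (b 1)) 1 = s at *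
  rw [hv X, hv Y]
  generalize b.repr X 0 = x at *
  generalize b.repr X 1 = y at *
  generalize b.repr Y 0 = z at *
  generalize b.repr Y 1 = w at *
  simp only [map_add, map_smul, h0, h1, wedge_add_left, wedge_add_right, wedge_smul_left,
    wedge_smul_right, wedge_self, wedge_swap (L (b 1)) (L (b 0))]
  constructor <;> module

theorem exists_signature_basis {T : Type*} [AddCommGroup T] [Module ℝ T] (b : Basis (Fin 2) ℝ T)
    (q : LinearMap.BilinForm ℝ T) {r₀ r₁ : ℝ} (h00 : q (b 0) (b 0) = r₀) (h01 : q (b 0) (b 1) = 0)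
    (h10 : q (b 1) (b 0) = 0) (h11 : q (b 1) (b 1) = r₁) (hr₀ : r₀ ≠ 0) (hr₁ : r₁ ≠ 0) :
    ∃ e : Basis (Fin 2) ℝ T, ∀ i j, q (e i) (e j) =
      if i = j then ((![SignType.sign r₀, SignType.sign r₁] i : SignType) : ℝ) else 0 := by
  have hs : ∀ r : ℝ, r ≠ 0 → (Real.sqrt |r|)⁻¹ * ((Real.sqrt |r|)⁻¹ * r) = (SignType.sign r : ℝ) := by
    intro r hr
    rw [← mul_assoc, ← mul_inv, Real.mul_self_sqrt (abs_nonneg r), inv_mul_eq_iff_eq_mul₀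
      (abs_pos.2 hr).ne', abs_mul_sign]
  have hu : ∀ r : ℝ, r ≠ 0 → IsUnit (Real.sqrt |r|)⁻¹ := fun r hr =>
    (inv_ne_zero (Real.sqrt_pos.2 (abs_pos.2 hr)).ne').isUnit
  refine ⟨b.isUnitSMul (w := ![(Real.sqrt |r₀|)⁻¹, (Real.sqrt |r₁|)⁻¹]) (fun i => ?_), fun i j => ?_⟩
  · fin_cases i
    · exact hu r₀ hr₀
    · exact hu r₁ hr₁
  · rw [Basis.isUnitSMul_apply, Basis.isUnitSMul_apply]
    fin_cases i <;> fin_cases j <;> simp [h00, h01, h10, h11, hs r₀ hr₀, hs r₁ hr₁]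

theorem nondegenerate_of_diagonal {T : Type*} [AddCommGroup T] [Module ℝ T] (b : Basis (Fin 2) ℝ T)
    (q : LinearMap.BilinForm ℝ T) (h01 : q (b 0) (b 1) = 0)
    (h10 : q (b 1) (b 0) = 0) (h00 : q (b 0) (b 0) ≠ 0) (h11 : q (b 1) (b 1) ≠ 0) :
    q.Nondegenerate := by
  have hv : ∀ v, v = b.repr v 0 • b 0 + b.repr v 1 • b 1 := fun v => by
    rw [← Fin.sum_univ_two (fun i => b.repr v i • b i), b.sum_repr]
  constructor
  · intro v hq
    have e0 := hq (b 0)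
    have e1 := hq (b 1)
    rw [hv v] at e0 e1 ⊢
    simp only [map_add, map_smul, LinearMap.add_apply, LinearMap.smul_apply, smul_eq_mul, h01, h10,
      mul_zero, add_zero, zero_add, mul_eq_zero, h00, h11, or_false] at e0 e1
    rw [e0, e1]; simp
  · intro v hq
    have e0 := hq (b 0)
    have e1 := hq (b 1)
    rw [hv v] at e0 e1 ⊢
    simp only [map_add, map_smul, smul_eq_mul, h01, h10,
      mul_zero, add_zero, zero_add, mul_eq_zero, h00, h11, or_false] at e0 e1
    rw [e0, e1]; simp

/-- The signs of a non-degenerate binary quadratic form on an orthogonal basis. -/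
theorem signs_of_orthogonal {a b c : ℝ} (hD : b ^ 2 - a * c ≠ 0) {x₁ y₁ x₂ y₂ r₁ r₂ : ℝ}
    (horth : c * (x₁ * x₂) - b * (x₁ * y₂ + x₂ * y₁) + a * (y₁ * y₂) = 0)
    (hδ : x₁ * y₂ - x₂ * y₁ ≠ 0)
    (hr₁ : r₁ = c * (x₁ * x₁) - 2 * b * (x₁ * y₁) + a * (y₁ * y₁))
    (hr₂ : r₂ = c * (x₂ * x₂) - 2 * b * (x₂ * y₂) + a * (y₂ * y₂)) :
    r₁ ≠ 0 ∧ r₂ ≠ 0 ∧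
      ((0 < b ^ 2 - a * c → (SignType.sign r₂ = 1 ∧ SignType.sign r₁ = -1) ∨
        (SignType.sign r₁ = 1 ∧ SignType.sign r₂ = -1)) ∧
      (b ^ 2 - a * c < 0 → SignType.sign r₂ = SignType.sign a ∧
        SignType.sign r₁ = SignType.sign a)) := by
  -- Gram determinant of the form (c, -b; -b, a) in an orthogonal basis: its own determinant times
  -- the squared change of basis.
  have hprod : r₁ * r₂ = -(b ^ 2 - a * c) * (x₁ * y₂ - x₂ * y₁) ^ 2 := by
    rw [hr₁, hr₂]
    linear_combination (c * (x₁ * x₂) - b * (x₁ * y₂ + x₂ * y₁) + a * (y₁ * y₂)) * horth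
  have hδ2 : 0 < (x₁ * y₂ - x₂ * y₁) ^ 2 := by positivity
  have hne : r₁ * r₂ ≠ 0 := by rw [hprod]; exact mul_ne_zero (neg_ne_zero.2 hD) hδ2.ne'
  have h1 : r₁ ≠ 0 := left_ne_zero_of_mul hne
  have h2 : r₂ ≠ 0 := right_ne_zero_of_mul hne
  refine ⟨h1, h2, fun hpos => ?_, fun hneg => ?_⟩
  · have hlt : r₁ * r₂ < 0 := by rw [hprod]; nlinarith
    rcases lt_or_gt_of_ne h1 with h | h
    · left
      exact ⟨sign_pos (by nlinarith), sign_neg h⟩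
    · right
      exact ⟨sign_pos h, sign_neg (by nlinarith)⟩
  · have key : ∀ x y r : ℝ, r ≠ 0 → r = c * (x * x) - 2 * b * (x * y) + a * (y * y) →
        SignType.sign r = SignType.sign a := by
      intro x y r hr0 hr
      have ha : a ≠ 0 := by rintro rfl; nlinarith [sq_nonneg b]
      -- Completing the square: ar = (ay - bx)² - (b² - ac)x².
      have h3 : 0 ≤ a * r := by
        rw [hr]
        nlinarith [sq_nonneg (a * y - b * x), mul_nonneg (neg_nonneg.2 hneg.le) (sq_nonneg x)]
      have h4 : 0 < a * r := lt_of_le_of_ne h3 (mul_ne_zero ha hr0).symm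
      rcases lt_or_gt_of_ne ha with h | h
      · rw [sign_neg h, sign_neg (by nlinarith)]
      · rw [sign_pos h, sign_pos (by nlinarith)]
    exact ⟨key _ _ _ h2 hr₂, key _ _ _ h1 hr₁⟩

/-! ### The middle potential of a linear Weingarten surface -/

section Potential

variable {M : Type*} [TopologicalSpace M] [ChartedSpace E2 M]

/-- The one-form `u₁ ∧ dw₁ + u₂ ∧ dw₂`. -/
noncomputable def wedgeForm (u₁ w₁ u₂ w₂ : M → R42) : OneForm M := fun x =>
  (wedgeL (u₁ x)).comp (D w₁ x) + (wedgeL (u₂ x)).comp (D w₂ x)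

theorem wedgeForm_apply (u₁ w₁ u₂ w₂ : M → R42) (x : M) (X : TangentSpace (𝓡 2) x) :
    wedgeForm u₁ w₁ u₂ w₂ x X = wedge (u₁ x) (D w₁ x X) + wedge (u₂ x) (D w₂ x X) := rfl

/-- The `∧²`-valued two-form `c d𝔣 ∧ d𝔣 - b (d𝔣 ∧ d𝔱 + d𝔱 ∧ d𝔣) + a d𝔱 ∧ d𝔱`. -/
noncomputable def weingartenForm (𝔣 𝔱 : M → R42) (a b c : ℝ) (x : M) (X Y : TangentSpace (𝓡 2) x) :
    End42 :=
  c • wedge (D 𝔣 x X) (D 𝔣 x Y) - b • (wedge (D 𝔣 x X) (D 𝔱 x Y) + wedge (D 𝔱 x X) (D 𝔣 x Y)) +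
    a • wedge (D 𝔱 x X) (D 𝔱 x Y)

theorem weingartenForm_of_immersed {𝔣 𝔱 : M → R42} {a b c : ℝ} (h : IsLinearWeingarten 𝔣 𝔱 a b c)
    {x : M} (hx : x ∈ immersedPoints 𝔣) (X Y : TangentSpace (𝓡 2) x) :
    weingartenForm 𝔣 𝔱 a b c x X Y = 0 := by
  obtain ⟨A, hA, he⟩ := h.2 x hx
  have hA' : ∀ Z, D 𝔱 x Z = (-1 : ℝ) • D 𝔣 x (A Z) := fun Z => by
    rw [eq_neg_of_add_eq_zero_left (hA Z)]; module
  have : FiniteDimensional ℝ (TangentSpace (𝓡 2) x) :=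
    inferInstanceAs (FiniteDimensional ℝ E2)
  obtain ⟨h1, h2⟩ := wedge_trace_det (finBasisOfFinrankEq ℝ _ (finrank_tangentSpace x)) A
    (D 𝔣 x).toLinearMap X Y
  simp only [ContinuousLinearMap.coe_coe] at h1 h2
  simp only [weingartenForm, hA', wedge_smul_left, wedge_smul_right]
  calc _ = c • wedge (D 𝔣 x X) (D 𝔣 x Y) +
        b • (wedge (D 𝔣 x (A X)) (D 𝔣 x Y) + wedge (D 𝔣 x X) (D 𝔣 x (A Y))) +
        a • wedge (D 𝔣 x (A X)) (D 𝔣 x (A Y)) := by module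
    _ = (a * LinearMap.det A + 2 * b * ((1 / 2) * LinearMap.trace ℝ _ A) + c) •
        wedge (D 𝔣 x X) (D 𝔣 x Y) := by rw [h1, h2]; module
    _ = 0 := by rw [he, zero_smul]

variable [IsManifold (𝓡 2) ∞ M]

theorem contDiffOn_comp_symm_univ {σ : M → R42} (hσ : ContMDiff (𝓡 2) 𝓘(ℝ, R42) ∞ σ)
    {e : OpenPartialHomeomorph M E2} (he : e ∈ atlas E2 M) :
    ContDiffOn ℝ ∞ (fun z => σ (e.symm z)) e.target := by
  have := contDiffOn_comp_symm he (hσ.contMDiffOn (s := univ))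
  rwa [preimage_univ, inter_univ] at this

/-- The form is continuous in charts and vanishes on the dense set of immersed points, hence also
where 𝔣 fails to immerse. -/
theorem weingartenForm_eq_zero {𝔣 𝔱 : M → R42} {a b c : ℝ} (h : IsLinearWeingarten 𝔣 𝔱 a b c)
    (h𝔣 : ContMDiff (𝓡 2) 𝓘(ℝ, R42) ∞ 𝔣) (h𝔱 : ContMDiff (𝓡 2) 𝓘(ℝ, R42) ∞ 𝔱)
    (hd : Dense (immersedPoints 𝔣)) (x : M) (X Y : TangentSpace (𝓡 2) x) :
    weingartenForm 𝔣 𝔱 a b c x X Y = 0 := by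
  obtain ⟨e, he, y, hy, rfl⟩ := exists_chart_point x
  obtain ⟨v, rfl⟩ := coordVec_surjective he hy X
  obtain ⟨w, rfl⟩ := coordVec_surjective he hy Y
  have hcont : ∀ {σ : M → R42}, ContMDiff (𝓡 2) 𝓘(ℝ, R42) ∞ σ → ∀ v : E2,
      ContinuousOn (fun z => D σ (e.symm z) (coordVec e z v)) e.target := fun {σ} hσ v =>
    (((contDiffOn_comp_symm_univ hσ he).continuousOn_fderiv_of_isOpen e.open_target
      (by simp)).clm_apply continuousOn_const).congr fun z hz =>
        D_coordVec he hz (hσ.mdifferentiable (by simp) _) v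
  have hw : ∀ {u u' : E2 → R42}, ContinuousOn u e.target → ContinuousOn u' e.target →
      ContinuousOn (fun z => wedge (u z) (u' z)) e.target := fun {u u'} hu hu' =>
    (wedgeL.continuous.comp_continuousOn hu).clm_apply hu'
  have hG : ContinuousOn (fun z => weingartenForm 𝔣 𝔱 a b c (e.symm z) (coordVec e z v)
      (coordVec e z w)) e.target :=
    (((hw (hcont h𝔣 v) (hcont h𝔣 w)).const_smul c).sub
      (((hw (hcont h𝔣 v) (hcont h𝔱 w)).add (hw (hcont h𝔱 v) (hcont h𝔣 w))).const_smul b)).add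
      ((hw (hcont h𝔱 v) (hcont h𝔱 w)).const_smul a)
  by_contra hne
  have hO := e.isOpen_inter_preimage
    (hG.isOpen_inter_preimage e.open_target (isOpen_compl_singleton (x := (0 : End42))))
  obtain ⟨x', hx', hxi⟩ := hd.inter_open_nonempty _ hO
    ⟨e.symm y, e.map_target hy, by rw [mem_preimage, e.right_inv hy]; exact ⟨hy, hne⟩⟩
  refine hx'.2.2 ?_
  have hxi' : e.symm (e x') ∈ immersedPoints 𝔣 := by rwa [e.left_inv hx'.1]
  exact weingartenForm_of_immersed h hxi' _ _

/-! ### Exterior derivatives of one-forms B(u, dw) -/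

section Bilinear

variable {E G H F : Type*} [NormedAddCommGroup E] [NormedSpace ℝ E] [NormedAddCommGroup G]
  [NormedSpace ℝ G] [NormedAddCommGroup H] [NormedSpace ℝ H] [NormedAddCommGroup F]
  [NormedSpace ℝ F] (B : G →L[ℝ] H →L[ℝ] F)

theorem contDiffOn_bilinear_fderiv {u : E → G} {w : E → H} {s : Set E} (hs : IsOpen s)
    (hu : ContDiffOn ℝ ∞ u s) (hw : ContDiffOn ℝ ∞ w s) :
    ContDiffOn ℝ ∞ (fun z => (B (u z)).comp (fderiv ℝ w z)) s :=
  (B.contDiff.comp_contDiffOn hu).clm_comp (hw.fderiv_of_isOpen hs (by simp))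

/-- d(B(u, dw)) = B(du ∧ dw), as the symmetric second derivative of w drops out on
antisymmetrisation. -/
theorem hasFDerivAt_bilinear_fderiv {u : E → G} {w : E → H} {y : E} (hu : ContDiffAt ℝ ∞ u y)
    (hw : ContDiffAt ℝ ∞ w y) :
    ∃ Ω : E →L[ℝ] E →L[ℝ] F, HasFDerivAt (fun z => (B (u z)).comp (fderiv ℝ w z)) Ω y ∧
      ∀ v v', Ω v v' - Ω v' v = B (fderiv ℝ u y v) (fderiv ℝ w y v') -
        B (fderiv ℝ u y v') (fderiv ℝ w y v) := by
  have h1 : HasFDerivAt (fun z => B (u z)) (B.comp (fderiv ℝ u y)) y :=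
    B.hasFDerivAt.comp y (hu.differentiableAt (by simp)).hasFDerivAt
  have h2 : HasFDerivAt (fderiv ℝ w) (fderiv ℝ (fderiv ℝ w) y) y :=
    ((hw.fderiv_right (m := 1) (by norm_cast)).differentiableAt (by simp)).hasFDerivAt
  refine ⟨_, h1.clm_comp h2, fun v v' => ?_⟩
  have hs := hw.isSymmSndFDerivAt (by simpa using WithTop.coe_le_coe.2 (le_top : (2 : ℕ∞) ≤ ⊤)) v v'
  simp only [_root_.add_apply, ContinuousLinearMap.comp_apply, ContinuousLinearMap.compL_apply,
    ContinuousLinearMap.flip_apply, hs]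
  abel

/-- The exterior derivative of `B(u₁, dw₁) + B(u₂, dw₂)`. -/
theorem fderiv_bilinear_fderiv {u₁ u₂ : E → G} {w₁ w₂ : E → H} {y : E}
    (hu₁ : ContDiffAt ℝ ∞ u₁ y) (hw₁ : ContDiffAt ℝ ∞ w₁ y) (hu₂ : ContDiffAt ℝ ∞ u₂ y)
    (hw₂ : ContDiffAt ℝ ∞ w₂ y) {θ : E → E →L[ℝ] F}
    (hθ : ∀ᶠ z in 𝓝 y, θ z = (B (u₁ z)).comp (fderiv ℝ w₁ z) + (B (u₂ z)).comp (fderiv ℝ w₂ z))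
    (v v' : E) : fderiv ℝ θ y v v' - fderiv ℝ θ y v' v =
      B (fderiv ℝ u₁ y v) (fderiv ℝ w₁ y v') - B (fderiv ℝ u₁ y v') (fderiv ℝ w₁ y v) +
      (B (fderiv ℝ u₂ y v) (fderiv ℝ w₂ y v') - B (fderiv ℝ u₂ y v') (fderiv ℝ w₂ y v)) := by
  obtain ⟨Ω₁, hΩ₁, k₁⟩ := hasFDerivAt_bilinear_fderiv B hu₁ hw₁
  obtain ⟨Ω₂, hΩ₂, k₂⟩ := hasFDerivAt_bilinear_fderiv B hu₂ hw₂
  have hd : HasFDerivAt θ (Ω₁ + Ω₂) y := (hΩ₁.add hΩ₂).congr_of_eventuallyEq hθ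
  rw [hd.fderiv, ← k₁, ← k₂]
  simp only [_root_.add_apply]
  abel

end Bilinear

theorem inChart_wedgeForm {u₁ w₁ u₂ w₂ : M → R42} (hw₁ : ContMDiff (𝓡 2) 𝓘(ℝ, R42) ∞ w₁)
    (hw₂ : ContMDiff (𝓡 2) 𝓘(ℝ, R42) ∞ w₂) {e : OpenPartialHomeomorph M E2} (he : e ∈ atlas E2 M)
    {y : E2} (hy : y ∈ e.target) : (wedgeForm u₁ w₁ u₂ w₂).inChart e y =
      (wedgeL (u₁ (e.symm y))).comp (fderiv ℝ (fun z => w₁ (e.symm z)) y) +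
      (wedgeL (u₂ (e.symm y))).comp (fderiv ℝ (fun z => w₂ (e.symm z)) y) := by
  rw [fderiv_comp_symm he hy (hw₁.mdifferentiable (by simp) _),
    fderiv_comp_symm he hy (hw₂.mdifferentiable (by simp) _)]
  rfl

theorem isSmooth_wedgeForm {u₁ w₁ u₂ w₂ : M → R42} (hu₁ : ContMDiff (𝓡 2) 𝓘(ℝ, R42) ∞ u₁)
    (hw₁ : ContMDiff (𝓡 2) 𝓘(ℝ, R42) ∞ w₁) (hu₂ : ContMDiff (𝓡 2) 𝓘(ℝ, R42) ∞ u₂)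
    (hw₂ : ContMDiff (𝓡 2) 𝓘(ℝ, R42) ∞ w₂) : (wedgeForm u₁ w₁ u₂ w₂).IsSmooth := by
  intro e he
  have hs : ∀ {u w : M → R42}, ContMDiff (𝓡 2) 𝓘(ℝ, R42) ∞ u → ContMDiff (𝓡 2) 𝓘(ℝ, R42) ∞ w →
      ContDiffOn ℝ ∞ (fun y => (wedgeL (u (e.symm y))).comp (fderiv ℝ (fun z => w (e.symm z)) y))
        e.target := fun {u w} hu hw =>
    contDiffOn_bilinear_fderiv (F := End42) wedgeL e.open_target
      (contDiffOn_comp_symm_univ hu he) (contDiffOn_comp_symm_univ hw he)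
  exact ((hs hu₁ hw₁).add (hs hu₂ hw₂)).congr fun y hy => inChart_wedgeForm hw₁ hw₂ he hy

theorem isClosed_wedgeForm {u₁ w₁ u₂ w₂ : M → R42} (hu₁ : ContMDiff (𝓡 2) 𝓘(ℝ, R42) ∞ u₁)
    (hw₁ : ContMDiff (𝓡 2) 𝓘(ℝ, R42) ∞ w₁) (hu₂ : ContMDiff (𝓡 2) 𝓘(ℝ, R42) ∞ u₂)
    (hw₂ : ContMDiff (𝓡 2) 𝓘(ℝ, R42) ∞ w₂)
    (h : ∀ (x : M) (X Y : TangentSpace (𝓡 2) x),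
      wedge (D u₁ x X) (D w₁ x Y) - wedge (D u₁ x Y) (D w₁ x X) +
        (wedge (D u₂ x X) (D w₂ x Y) - wedge (D u₂ x Y) (D w₂ x X)) = 0) :
    (wedgeForm u₁ w₁ u₂ w₂).IsClosed := by
  intro e he y hy v w
  have hc : ∀ {u : M → R42}, ContMDiff (𝓡 2) 𝓘(ℝ, R42) ∞ u →
      ContDiffAt ℝ ∞ (fun z => u (e.symm z)) y := fun hu =>
    (contDiffOn_comp_symm_univ hu he).contDiffAt (e.open_target.mem_nhds hy)
  have hD : ∀ {u : M → R42}, ContMDiff (𝓡 2) 𝓘(ℝ, R42) ∞ u → ∀ v : E2,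
      fderiv ℝ (fun z => u (e.symm z)) y v = D u (e.symm y) (coordVec e y v) := fun hu v =>
    (D_coordVec he hy (hu.mdifferentiable (by simp) _) v).symm
  refine (fderiv_bilinear_fderiv (F := End42) wedgeL (hc hu₁) (hc hw₁) (hc hu₂) (hc hw₂)
    (θ := (wedgeForm u₁ w₁ u₂ w₂).inChart e)
    (Filter.eventually_of_mem (e.open_target.mem_nhds hy)
      fun z hz => inChart_wedgeForm hw₁ hw₂ he hz) v w).trans ?_
  rw [hD hu₁, hD hu₁, hD hw₁, hD hw₁, hD hu₂, hD hu₂, hD hw₂, hD hw₂]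
  exact h _ _ _

end Potential

/-- In the indefinite case the order of the signs varies with the curvature frame; swapping the
basis vectors gives one fixed signature. -/
theorem exists_basis_of_signs {T : Type*} [AddCommGroup T] [Module ℝ T] (b : Basis (Fin 2) ℝ T)
    (q : LinearMap.BilinForm ℝ T) {r₀ r₁ : ℝ} (h00 : q (b 0) (b 0) = r₀) (h01 : q (b 0) (b 1) = 0)
    (h10 : q (b 1) (b 0) = 0) (h11 : q (b 1) (b 1) = r₁) (hr₀ : r₀ ≠ 0) (hr₁ : r₁ ≠ 0)
    {s t : SignType} (h : (SignType.sign r₀ = s ∧ SignType.sign r₁ = t) ∨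
      (SignType.sign r₁ = s ∧ SignType.sign r₀ = t)) :
    ∃ e : Basis (Fin 2) ℝ T, ∀ i j, q (e i) (e j) =
      if i = j then ((![s, t] i : SignType) : ℝ) else 0 := by
  rcases h with ⟨rfl, rfl⟩ | ⟨rfl, rfl⟩
  · exact exists_signature_basis b q h00 h01 h10 h11 hr₀ hr₁
  · exact exists_signature_basis (b.reindex (Equiv.swap 0 1)) q (by simpa using h11)
      (by simpa using h10) (by simpa using h01) (by simpa using h00) hr₁ hr₀

/-! ### Algebraic properties of the potential and its form in a curvature frame -/

section Potential

variable {M : Type*} [TopologicalSpace M] [ChartedSpace E2 M] {f : M → Submodule ℝ R42}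

theorem wedgeForm_mem (hf : IsLegendre f) {u₁ w₁ u₂ w₂ : M → R42} (hu₁ : ∀ x, u₁ x ∈ f x)
    (hw₁ : IsSectionOn f univ w₁) (hu₂ : ∀ x, u₂ x ∈ f x) (hw₂ : IsSectionOn f univ w₂) (x : M)
    (X : TangentSpace (𝓡 2) x) : wedgeForm u₁ w₁ u₂ w₂ x X ∈ wedgeSub (f x) (perp (f x)) :=
  add_mem (wedge_mem (hu₁ x) (hf.contact _ _ hw₁ x (mem_univ x) X))
    (wedge_mem (hu₂ x) (hf.contact _ _ hw₂ x (mem_univ x) X))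

theorem wedgeForm_apply_perp {u₁ u₂ : M → R42} (w₁ w₂ : M → R42)
    (hu₁ : ∀ x, u₁ x ∈ f x) (hu₂ : ∀ x, u₂ x ∈ f x) {x : M}
    (X : TangentSpace (𝓡 2) x) {v : R42} (hv : v ∈ perp (f x)) : wedgeForm u₁ w₁ u₂ w₂ x X v =
      (-ip (D w₁ x X) v) • u₁ x + (-ip (D w₂ x X) v) • u₂ x := by
  rw [wedgeForm_apply, _root_.add_apply, wedge_apply, wedge_apply,
    ip_eq_zero_of_mem (hu₁ x) hv, ip_eq_zero_of_mem (hu₂ x) hv]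
  module

/-- The middle potential of a linear Weingarten surface. -/
noncomputable def weingartenPotential (𝔣 𝔱 : M → R42) (a b c : ℝ) : OneForm M :=
  wedgeForm 𝔣 (fun z => (-c) • 𝔣 z + b • 𝔱 z) 𝔱 (fun z => b • 𝔣 z + (-a) • 𝔱 z)

variable {𝔮 𝔭 : R42} {𝔣 𝔱 : M → R42} {a b c : ℝ}

theorem IsProjection.section_comb (h : IsProjection f 𝔮 𝔭 𝔣 𝔱) (u w : ℝ) :
    IsSectionOn f univ (fun z => u • 𝔣 z + w • 𝔱 z) := by
  simpa using h.section_point.comb h.section_plane u w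

theorem IsProjection.smooth_comb (h : IsProjection f 𝔮 𝔭 𝔣 𝔱) (u w : ℝ) :
    ContMDiff (𝓡 2) 𝓘(ℝ, R42) ∞ (fun z => u • 𝔣 z + w • 𝔱 z) :=
  contMDiffOn_univ.1 (h.section_comb u w).smooth

theorem IsProjection.potential_apply (h : IsProjection f 𝔮 𝔭 𝔣 𝔱) (a b c : ℝ) (x : M)
    (X : TangentSpace (𝓡 2) x) : weingartenPotential 𝔣 𝔱 a b c x X =
      wedge (𝔣 x) ((-c) • D 𝔣 x X + b • D 𝔱 x X) + wedge (𝔱 x) (b • D 𝔣 x X + (-a) • D 𝔱 x X) := by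
  rw [weingartenPotential, wedgeForm_apply, D_comb _ _ (h.mdiff_point x) (h.mdiff_plane x),
    D_comb _ _ (h.mdiff_point x) (h.mdiff_plane x)]

theorem IsProjection.potential_mem (h : IsProjection f 𝔮 𝔭 𝔣 𝔱) (hf : IsLegendre f) (a b c : ℝ)
    (x : M) (X : TangentSpace (𝓡 2) x) :
    weingartenPotential 𝔣 𝔱 a b c x X ∈ wedgeSub (f x) (perp (f x)) :=
  wedgeForm_mem hf h.point_mem (h.section_comb _ _) h.plane_mem (h.section_comb _ _) x X

variable [IsManifold (𝓡 2) ∞ M]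

/-- η(X)η(Y)v is a combination of u₁, u₂ whose coefficients contain X, Y only through pairings
(dw_i(X), dw_j(Y)). These are symmetric in X, Y, so η(X) and η(Y) commute. -/
theorem bracketVanishes_wedgeForm (hf : IsLegendre f) {u₁ w₁ u₂ w₂ : M → R42}
    (hu₁ : ∀ x, u₁ x ∈ f x) (hw₁ : IsSectionOn f univ w₁) (hu₂ : ∀ x, u₂ x ∈ f x)
    (hw₂ : IsSectionOn f univ w₂) : (wedgeForm u₁ w₁ u₂ w₂).BracketVanishes := by
  intro x X Y
  have key : ∀ (X Y : TangentSpace (𝓡 2) x) (v : R42),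
      wedgeForm u₁ w₁ u₂ w₂ x X (wedgeForm u₁ w₁ u₂ w₂ x Y v) =
        (-(ip (u₁ x) v * ip (D w₁ x X) (D w₁ x Y)) - ip (u₂ x) v * ip (D w₁ x X) (D w₂ x Y)) • u₁ x +
        (-(ip (u₁ x) v * ip (D w₂ x X) (D w₁ x Y)) - ip (u₂ x) v * ip (D w₂ x X) (D w₂ x Y)) • u₂ x := by
    intro X Y v
    have k1 := wedgeForm_apply_perp (f := f) w₁ w₂ hu₁ hu₂ X (hf.contact _ _ hw₁ x (mem_univ x) Y)
    have k2 := wedgeForm_apply_perp (f := f) w₁ w₂ hu₁ hu₂ X (hf.contact _ _ hw₂ x (mem_univ x) Y)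
    have k3 := wedge_apply_eq_zero (hf.null x) (wedgeForm_mem hf hu₁ hw₁ hu₂ hw₂ x X) (hu₁ x)
    have k4 := wedge_apply_eq_zero (hf.null x) (wedgeForm_mem hf hu₁ hw₁ hu₂ hw₂ x X) (hu₂ x)
    rw [wedgeForm_apply u₁ w₁ u₂ w₂ x Y, _root_.add_apply, wedge_apply, wedge_apply]
    simp only [map_add, map_sub, map_smul, k1, k2, k3, k4]
    module
  have hcomm : ∀ v, wedgeForm u₁ w₁ u₂ w₂ x X (wedgeForm u₁ w₁ u₂ w₂ x Y v) =
      wedgeForm u₁ w₁ u₂ w₂ x Y (wedgeForm u₁ w₁ u₂ w₂ x X v) := fun v => by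
    have hU := mem_univ x
    rw [key, key, hf.symm_deriv hw₁ hw₁ hU hU X Y, hf.symm_deriv hw₁ hw₂ hU hU X Y,
      hf.symm_deriv hw₂ hw₁ hU hU X Y, hf.symm_deriv hw₂ hw₂ hU hU X Y]
  have h0 : wedgeForm u₁ w₁ u₂ w₂ x X * wedgeForm u₁ w₁ u₂ w₂ x Y =
      wedgeForm u₁ w₁ u₂ w₂ x Y * wedgeForm u₁ w₁ u₂ w₂ x X :=
    ContinuousLinearMap.ext hcomm
  rw [Ring.lie_def, Ring.lie_def, h0]
  simp

/-- The quadratic differential of `𝔣 ∧ dw₁ + 𝔱 ∧ dw₂`. -/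
theorem IsProjection.exists_quadraticDifferential
    (h : IsProjection f 𝔮 𝔭 𝔣 𝔱) (hf : IsLegendre f) (w₁ w₂ : M → R42)
    (hw₁ : IsSectionOn f univ w₁) (hw₂ : IsSectionOn f univ w₂) :
    ∃ q : ∀ x : M, LinearMap.BilinForm ℝ (TangentSpace (𝓡 2) x),
      IsQuadraticDifferential f (wedgeForm 𝔣 w₁ 𝔱 w₂) q := by
  refine ⟨fun x => -(ip.compl₁₂ (D w₁ x).toLinearMap (D 𝔣 x).toLinearMap) -
    ip.compl₁₂ (D w₂ x).toLinearMap (D 𝔱 x).toLinearMap, fun x X Y => ?_⟩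
  have hU := mem_univ x
  have kA := wedgeForm_apply_perp (f := f) w₁ w₂ h.point_mem h.plane_mem X
    (hf.contact _ _ h.section_point x hU Y)
  have kB := wedgeForm_apply_perp (f := f) w₁ w₂ h.point_mem h.plane_mem X
    (hf.contact _ _ h.section_plane x hU Y)
  have hm : ∀ s t : ℝ, s • 𝔣 x + t • 𝔱 x ∈ f x := fun s t =>
    add_mem (Submodule.smul_mem _ _ (h.point_mem x)) (Submodule.smul_mem _ _ (h.plane_mem x))
  let A : f x := ⟨wedgeForm 𝔣 w₁ 𝔱 w₂ x X (D 𝔣 x Y), by rw [kA]; exact hm _ _⟩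
  let B : f x := ⟨wedgeForm 𝔣 w₁ 𝔱 w₂ x X (D 𝔱 x Y), by rw [kB]; exact hm _ _⟩
  -- η(X) kills f and σ = -(σ,𝔮)𝔣 - (σ,𝔭)𝔱 pointwise, so σ ↦ η(X)d_Yσ is determined by its values on
  -- 𝔣 and 𝔱.
  let L : f x →ₗ[ℝ] f x := ((-(ip.flip 𝔮)).comp (f x).subtype).smulRight A +
    ((-(ip.flip 𝔭)).comp (f x).subtype).smulRight B
  have hL : ∀ v : f x, (L v : R42) = (-ip (v : R42) 𝔮) • wedgeForm 𝔣 w₁ 𝔱 w₂ x X (D 𝔣 x Y) +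
      (-ip (v : R42) 𝔭) • wedgeForm 𝔣 w₁ 𝔱 w₂ x X (D 𝔱 x Y) := fun v => rfl
  refine ⟨L, fun U σ hσ hx => ?_, ?_⟩
  · have e := h.expand hf (hσ.mem x hx)
    have k := wedge_apply_eq_zero (hf.null x)
      (wedgeForm_mem hf h.point_mem hw₁ h.plane_mem hw₂ x X)
      (hf.deriv_sub_mem h.section_point h.section_plane hσ hU hU hx e Y)
    rw [map_sub, sub_eq_zero, map_add, map_smul, map_smul] at k
    rw [hL, k]
  · rw [trace_of_pair (hf.rank_two x) (h.point_mem x) (h.plane_mem x) (h.span hf x) L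
      (x := -ip (D w₁ x X) (D 𝔣 x Y)) (y := -ip (D w₂ x X) (D 𝔣 x Y))
      (z := -ip (D w₁ x X) (D 𝔱 x Y)) (w := -ip (D w₂ x X) (D 𝔱 x Y))
      (by rw [hL, h.point_q, h.point_p, kA]; module)
      (by rw [hL, h.plane_q, h.plane_p, kB]; module)]
    simp [sub_eq_add_neg]

/-- dη is -2 times the Weingarten form: closedness is the linear Weingarten equation. -/
theorem IsProjection.potential_closed (h : IsProjection f 𝔮 𝔭 𝔣 𝔱)
    (hW : ∀ (x : M) (X Y : TangentSpace (𝓡 2) x), weingartenForm 𝔣 𝔱 a b c x X Y = 0) :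
    (weingartenPotential 𝔣 𝔱 a b c).IsClosed := by
  refine isClosed_wedgeForm h.smooth_point (h.smooth_comb _ _) h.smooth_plane (h.smooth_comb _ _)
    fun x X Y => ?_
  rw [D_comb _ _ (h.mdiff_point x) (h.mdiff_plane x), D_comb _ _ (h.mdiff_point x) (h.mdiff_plane x),
    D_comb _ _ (h.mdiff_point x) (h.mdiff_plane x), D_comb _ _ (h.mdiff_point x) (h.mdiff_plane x)]
  have e : ∀ T : End42, T = (-2 : ℝ) • weingartenForm 𝔣 𝔱 a b c x X Y → T = 0 := fun T hT => by
    rw [hT, hW, smul_zero]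
  apply e
  simp only [weingartenForm, wedge_add_right, wedge_smul_right, wedge_swap (D 𝔣 x Y) (D 𝔣 x X),
    wedge_swap (D 𝔣 x Y) (D 𝔱 x X), wedge_swap (D 𝔱 x Y) (D 𝔣 x X),
    wedge_swap (D 𝔱 x Y) (D 𝔱 x X)]
  module

variable {U : Set M} {σ₁ σ₂ : M → R42} {X₁ X₂ : ∀ x : M, TangentSpace (𝓡 2) x}

/-- The coefficients of the projection in a curvature frame. -/
theorem IsProjection.exists_frame_coeff (h : IsProjection f 𝔮 𝔭 𝔣 𝔱) (hf : IsLegendre f)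
    (hfr : IsCurvatureFrame f U σ₁ σ₂ X₁ X₂) {y : M} (hy : y ∈ U) :
    ∃ x₁ y₁ x₂ y₂ : ℝ, 𝔣 y = x₁ • σ₁ y + x₂ • σ₂ y ∧ 𝔱 y = y₁ • σ₁ y + y₂ • σ₂ y ∧
      x₁ * y₂ - x₂ * y₁ ≠ 0 := by
  have had := hfr.adapted hf hy
  obtain ⟨x₁, x₂, e⟩ := had.exists_coeff (h.point_mem y)
  obtain ⟨y₁, y₂, e'⟩ := had.exists_coeff (h.plane_mem y)
  refine ⟨x₁, y₁, x₂, y₂, e, e', fun h0 => ?_⟩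
  have hz : ∀ u w : ℝ, u • 𝔣 y + w • 𝔱 y = 0 → u = 0 := fun u w hc => by
    have := congrArg (fun v => ip v 𝔮) hc
    simpa [h.point_q, h.plane_q] using this
  have hz' : ∀ u w : ℝ, u • 𝔣 y + w • 𝔱 y = 0 → w = 0 := fun u w hc => by
    have := congrArg (fun v => ip v 𝔭) hc
    simpa [h.point_p, h.plane_p] using this
  have k1 : x₁ = 0 := neg_eq_zero.1 (hz' y₁ (-x₁) (by
    rw [e, e']
    calc _ = (-(x₁ * y₂ - x₂ * y₁)) • σ₂ y := by module
      _ = 0 := by rw [h0]; simp))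
  have k2 : x₂ = 0 := neg_eq_zero.1 (hz' y₂ (-x₂) (by
    rw [e, e']
    calc _ = (x₁ * y₂ - x₂ * y₁) • σ₁ y := by module
      _ = 0 := by rw [h0]; simp))
  have := h.point_q y
  rw [e, k1, k2] at this
  simp at this

/-- The two curvature spheres are conjugate with respect to the linear Weingarten condition. -/
theorem IsProjection.frame_orthogonal (h : IsProjection f 𝔮 𝔭 𝔣 𝔱) (hf : IsLegendre f)
    (hfr : IsCurvatureFrame f U σ₁ σ₂ X₁ X₂) {y : M} (hy : y ∈ U) {x₁ y₁ x₂ y₂ : ℝ}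
    (e : 𝔣 y = x₁ • σ₁ y + x₂ • σ₂ y) (e' : 𝔱 y = y₁ • σ₁ y + y₂ • σ₂ y)
    (hW : weingartenForm 𝔣 𝔱 a b c y (X₁ y) (X₂ y) = 0) :
    c * (x₁ * x₂) - b * (x₁ * y₂ + x₂ * y₁) + a * (y₁ * y₂) = 0 := by
  have had := hfr.adapted hf hy
  obtain ⟨f1, f2⟩ := hfr.deriv_mem hf h.section_point hy (mem_univ y) e
  obtain ⟨t1, t2⟩ := hfr.deriv_mem hf h.section_plane hy (mem_univ y) e'
  have p1 := had.pos₁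
  have p2 := had.pos₂
  have ho := had.orth
  have ho' : ip (D σ₂ y (X₁ y)) (D σ₁ y (X₂ y)) = 0 := by rw [ip_comm, ho]
  have hk : ∀ {v w n : R42} {r : ℝ}, v - r • w ∈ f y → n ∈ perp (f y) → ip v n = r * ip w n := by
    intro v w n r hv hn
    have := ip_eq_zero_of_mem hv hn
    rw [map_sub, LinearMap.sub_apply, sub_eq_zero, map_smul, LinearMap.smul_apply, smul_eq_mul] at this
    exact this
  -- On (X₁, X₂) the form is, modulo terms containing f, the conjugacy expression times n₂∧n₁;
  -- pairing with n₂ and n₁ extracts it.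
  have e0 := congrArg (fun T : End42 => ip (T (D σ₂ y (X₁ y))) (D σ₁ y (X₂ y))) hW
  simp only [weingartenForm, _root_.add_apply, _root_.sub_apply, _root_.smul_apply, wedge_apply,
    map_add, map_sub, map_smul, LinearMap.add_apply, LinearMap.sub_apply, LinearMap.smul_apply,
    smul_eq_mul, hk f1 had.perp₁, hk f1 had.perp₂, hk f2 had.perp₁, hk f2 had.perp₂,
    hk t1 had.perp₁, hk t1 had.perp₂, hk t2 had.perp₁, hk t2 had.perp₂, ho, ho', mul_zero,
    sub_zero, _root_.zero_apply, map_zero, LinearMap.zero_apply] at e0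
  refine (mul_eq_zero.1 ?_).resolve_right (mul_pos p1 p2).ne'
  linear_combination e0

/-- The potential in a curvature frame. -/
theorem IsProjection.potential_frame (h : IsProjection f 𝔮 𝔭 𝔣 𝔱) (hf : IsLegendre f)
    (hfr : IsCurvatureFrame f U σ₁ σ₂ X₁ X₂) {y : M} (hy : y ∈ U) {x₁ y₁ x₂ y₂ : ℝ}
    (e : 𝔣 y = x₁ • σ₁ y + x₂ • σ₂ y) (e' : 𝔱 y = y₁ • σ₁ y + y₂ • σ₂ y)
    (ho : c * (x₁ * x₂) - b * (x₁ * y₂ + x₂ * y₁) + a * (y₁ * y₂) = 0) :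
    (∃ μ : ℝ, weingartenPotential 𝔣 𝔱 a b c y (X₁ y) =
      (0 : ℝ) • wedge (σ₁ y) (D σ₁ y (X₂ y)) +
      (-(c * (x₂ * x₂) - 2 * b * (x₂ * y₂) + a * (y₂ * y₂))) • wedge (σ₂ y) (D σ₂ y (X₁ y)) +
      μ • wedge (σ₁ y) (σ₂ y)) ∧
    ∃ μ : ℝ, weingartenPotential 𝔣 𝔱 a b c y (X₂ y) =
      (-(c * (x₁ * x₁) - 2 * b * (x₁ * y₁) + a * (y₁ * y₁))) • wedge (σ₁ y) (D σ₁ y (X₂ y)) +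
      (0 : ℝ) • wedge (σ₂ y) (D σ₂ y (X₁ y)) + μ • wedge (σ₁ y) (σ₂ y) := by
  have had := hfr.adapted hf hy
  obtain ⟨f1, f2⟩ := hfr.deriv_mem hf h.section_point hy (mem_univ y) e
  obtain ⟨t1, t2⟩ := hfr.deriv_mem hf h.section_plane hy (mem_univ y) e'
  have hx : ∀ {v n : R42}, v - n ∈ f y → ∃ s t : ℝ, v = n + (s • σ₁ y + t • σ₂ y) := fun hv => by
    obtain ⟨s, t, hst⟩ := had.exists_coeff hv
    exact ⟨s, t, by rw [← hst]; abel⟩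
  obtain ⟨p1, q1, h1⟩ := hx f1
  obtain ⟨p2, q2, h2⟩ := hx t1
  obtain ⟨p3, q3, h3⟩ := hx f2
  obtain ⟨p4, q4, h4⟩ := hx t2
  rw [h.potential_apply, h.potential_apply, h1, h2, h3, h4, e, e']
  simp only [wedge_add_left, wedge_add_right, wedge_smul_left, wedge_smul_right, wedge_self,
    wedge_swap (σ₂ y) (σ₁ y)]
  generalize wedge (σ₁ y) (D σ₂ y (X₁ y)) = A
  generalize wedge (σ₂ y) (D σ₂ y (X₁ y)) = A'
  generalize wedge (σ₁ y) (D σ₁ y (X₂ y)) = B'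
  generalize wedge (σ₂ y) (D σ₁ y (X₂ y)) = B
  generalize wedge (σ₁ y) (σ₂ y) = C
  constructor
  · refine ⟨x₁ * (-c * q1 + b * q2) - x₂ * (-c * p1 + b * p2) + y₁ * (b * q1 - a * q2) -
      y₂ * (b * p1 - a * p2), ?_⟩
    rw [← sub_eq_zero]
    -- The only term outside the desired shape, σ₁∧n₂, carries the conjugacy expression as
    -- coefficient.
    calc _ = (-(c * (x₁ * x₂) - b * (x₁ * y₂ + x₂ * y₁) + a * (y₁ * y₂))) • A := by module
      _ = 0 := by rw [ho, neg_zero, zero_smul]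
  · refine ⟨x₁ * (-c * q3 + b * q4) - x₂ * (-c * p3 + b * p4) + y₁ * (b * q3 - a * q4) -
      y₂ * (b * p3 - a * p4), ?_⟩
    rw [← sub_eq_zero]
    calc _ = (-(c * (x₁ * x₂) - b * (x₁ * y₂ + x₂ * y₁) + a * (y₁ * y₂))) • B := by module
      _ = 0 := by rw [ho, neg_zero, zero_smul]

end Potential

/-! ### The potential as a middle potential of an Ω-surface -/

section Potential

variable {M : Type*} [TopologicalSpace M] [ChartedSpace E2 M] [IsManifold (𝓡 2) ∞ M]
  {f : M → Submodule ℝ R42} {𝔮 𝔭 : R42} {𝔣 𝔱 : M → R42} {a b c : ℝ}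

theorem IsProjection.potential_middle (h : IsProjection f 𝔮 𝔭 𝔣 𝔱) (hf : IsLegendre f)
    (hW : ∀ (x : M) (X Y : TangentSpace (𝓡 2) x), weingartenForm 𝔣 𝔱 a b c x X Y = 0) :
    IsMiddle f (weingartenPotential 𝔣 𝔱 a b c) := by
  intro U σ₁ σ₂ X₁ X₂ hfr y hy Z
  have had := hfr.adapted hf hy
  obtain ⟨x₁, y₁, x₂, y₂, e, e', -⟩ := h.exists_frame_coeff hf hfr hy
  obtain ⟨⟨μ₁, k₁⟩, μ₂, k₂⟩ := h.potential_frame hf hfr hy e e'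
    (h.frame_orthogonal hf hfr hy e e' (hW _ _ _))
  obtain ⟨u, w, rfl⟩ := hfr.exists_comb hf hy Z
  have m1 : σ₁ y ∈ cyclide σ₁ X₂ y := Submodule.subset_span (by simp)
  have m1' : D σ₁ y (X₂ y) ∈ cyclide σ₁ X₂ y := Submodule.subset_span (by simp)
  have m2 : σ₂ y ∈ cyclide σ₂ X₁ y := Submodule.subset_span (by simp)
  have m2' : D σ₂ y (X₁ y) ∈ cyclide σ₂ X₁ y := Submodule.subset_span (by simp)
  refine ⟨(w * -(c * (x₁ * x₁) - 2 * b * (x₁ * y₁) + a * (y₁ * y₁))) •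
        wedge (σ₁ y) (D σ₁ y (X₂ y)) +
      (u * -(c * (x₂ * x₂) - 2 * b * (x₂ * y₂) + a * (y₂ * y₂))) • wedge (σ₂ y) (D σ₂ y (X₁ y)),
    add_mem (Submodule.mem_sup_left (Submodule.smul_mem _ _ (wedge_mem m1 m1')))
      (Submodule.mem_sup_right (Submodule.smul_mem _ _ (wedge_mem m2 m2'))),
    (u * μ₁ + w * μ₂) • wedge (σ₁ y) (σ₂ y), Submodule.smul_mem _ _ (wedge_mem m1 m2),
    Submodule.smul_mem _ _ (wedge_mem had.mem₁ had.mem₂), ?_⟩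
  rw [map_add, map_smul, map_smul, k₁, k₂]
  module

/-- The quadratic differential of the potential is diagonal in a curvature frame. -/
theorem IsProjection.potential_diagonal (h : IsProjection f 𝔮 𝔭 𝔣 𝔱) (hf : IsLegendre f)
    (hu : UmbilicFree f) (hD : b ^ 2 - a * c ≠ 0)
    (hW : ∀ (x : M) (X Y : TangentSpace (𝓡 2) x), weingartenForm 𝔣 𝔱 a b c x X Y = 0)
    {q : ∀ x : M, LinearMap.BilinForm ℝ (TangentSpace (𝓡 2) x)}
    (hq : IsQuadraticDifferential f (weingartenPotential 𝔣 𝔱 a b c) q) (x : M) :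
    ∃ (e : Basis (Fin 2) ℝ (TangentSpace (𝓡 2) x)) (r₀ r₁ : ℝ), q x (e 0) (e 0) = r₀ ∧
      q x (e 0) (e 1) = 0 ∧ q x (e 1) (e 0) = 0 ∧ q x (e 1) (e 1) = r₁ ∧ r₀ ≠ 0 ∧ r₁ ≠ 0 ∧
      (0 < b ^ 2 - a * c → (SignType.sign r₀ = 1 ∧ SignType.sign r₁ = -1) ∨
        (SignType.sign r₁ = 1 ∧ SignType.sign r₀ = -1)) ∧
      (b ^ 2 - a * c < 0 → SignType.sign r₀ = SignType.sign a ∧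
        SignType.sign r₁ = SignType.sign a) := by
  obtain ⟨U, σ₁, σ₂, X₁, X₂, hy, hfr⟩ := hf.exists_curvatureFrame hu x
  have had := hfr.adapted hf hy
  obtain ⟨x₁, y₁, x₂, y₂, e, e', hδ⟩ := h.exists_frame_coeff hf hfr hy
  have ho := h.frame_orthogonal hf hfr hy e e' (hW _ _ _)
  obtain ⟨⟨μ₁, k₁⟩, μ₂, k₂⟩ := h.potential_frame hf hfr hy e e' ho
  have hm := h.potential_mem hf a b c
  obtain ⟨q11, q12⟩ := hfr.quadratic_differential hf hm hq hy k₁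
  obtain ⟨q21, q22⟩ := hfr.quadratic_differential hf hm hq hy k₂
  obtain ⟨n1, n2, hs, hs'⟩ := signs_of_orthogonal hD ho hδ rfl rfl
  obtain ⟨B, b0, b1⟩ := hfr.exists_basis hf hy
  have p1 := had.pos₁
  have p2 := had.pos₂
  have hsg : ∀ {r n : ℝ}, 0 < n → SignType.sign (-(-r * n)) = SignType.sign r := fun {r n} hn => by
    rw [neg_mul, neg_neg, sign_mul, sign_pos hn, mul_one]
  rw [← b0] at q11 q12 q21 p2
  rw [← b1] at q12 q21 q22 p1
  refine ⟨B, _, _, q11, by rw [q12]; ring, by rw [q21]; ring, q22, ?_, ?_, ?_, ?_⟩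
  · rw [neg_mul, neg_neg]; exact mul_ne_zero n2 p2.ne'
  · rw [neg_mul, neg_neg]; exact mul_ne_zero n1 p1.ne'
  · rw [hsg p1, hsg p2]; exact hs
  · rw [hsg p1, hsg p2]; exact hs'

theorem IsNonTubularProjection.isOmegaPotential [Nonempty M]
    (h : IsNonTubularProjection f 𝔮 𝔭 𝔣 𝔱 a b c) (hf : IsLegendre f) (hu : UmbilicFree f)
    (hd : Dense (immersedPoints 𝔣)) : IsOmegaPotential f (weingartenPotential 𝔣 𝔱 a b c) := by
  have hp := h.projection
  have hW := weingartenForm_eq_zero h.weingarten hp.smooth_point hp.smooth_plane hd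
  refine ⟨isSmooth_wedgeForm hp.smooth_point (hp.smooth_comb _ _) hp.smooth_plane
    (hp.smooth_comb _ _), hp.potential_mem hf a b c, hp.potential_closed hW,
    bracketVanishes_wedgeForm hf hp.point_mem (hp.section_comb _ _) hp.plane_mem
      (hp.section_comb _ _), ?_⟩
  obtain ⟨q, hq⟩ := hp.exists_quadraticDifferential hf _ _ (hp.section_comb (-c) b)
    (hp.section_comb b (-a))
  have hdiag := hp.potential_diagonal hf hu h.nonTubular hW hq
  refine ⟨q, hq, ?_, ⟨univ, isOpen_univ, dense_univ, fun x _ => ?_⟩, ?_⟩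
  · obtain ⟨x⟩ := ‹Nonempty M›
    obtain ⟨e, r₀, r₁, h00, -, -, -, hr, -⟩ := hdiag x
    refine ⟨x, fun h0 => hr ?_⟩
    rw [← h00, h0]; rfl
  · obtain ⟨e, r₀, r₁, h00, h01, h10, h11, hr₀, hr₁, -⟩ := hdiag x
    exact nondegenerate_of_diagonal e (q x) h01 h10 (by rwa [h00]) (by rwa [h11])
  -- For b² - ac < 0 the quadratic differential is definite with the sign of a; for b² - ac > 0 it
  -- is indefinite.
  · rcases lt_or_gt_of_ne h.nonTubular with hneg | hpos
    · refine ⟨![SignType.sign a, SignType.sign a], fun x => ?_⟩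
      obtain ⟨e, r₀, r₁, h00, h01, h10, h11, hr₀, hr₁, -, hs⟩ := hdiag x
      exact exists_basis_of_signs e (q x) h00 h01 h10 h11 hr₀ hr₁ (Or.inl (hs hneg))
    · refine ⟨![1, -1], fun x => ?_⟩
      obtain ⟨e, r₀, r₁, h00, h01, h10, h11, hr₀, hr₁, hs, -⟩ := hdiag x
      exact exists_basis_of_signs e (q x) h00 h01 h10 h11 hr₀ hr₁ (hs hpos)

end Potential

/-! ### Its conserved quantities -/

section Conserved

variable {M : Type*} {𝔮 𝔭 : R42} {𝔣 𝔱 : M → R42} {a b c : ℝ}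

/-- The conserved quantities `𝔮 + t(-c 𝔣 + b 𝔱)` and `𝔭 + t(b 𝔣 - a 𝔱)`, combined with
coefficients `u` and `w`. -/
noncomputable def weingartenPoly (𝔮 𝔭 : R42) (𝔣 𝔱 : M → R42) (a b c u w : ℝ) : LinPoly M :=
  (fun _ => u • 𝔮 + w • 𝔭, fun z => (b * w - c * u) • 𝔣 z + (b * u - a * w) • 𝔱 z)

/-- The plane spanned by these conserved quantities. -/
noncomputable def weingartenPlane (𝔮 𝔭 : R42) (𝔣 𝔱 : M → R42) (a b c : ℝ) :
    Submodule ℝ (LinPoly M) :=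
  Submodule.span ℝ {weingartenPoly 𝔮 𝔭 𝔣 𝔱 a b c 1 0, weingartenPoly 𝔮 𝔭 𝔣 𝔱 a b c 0 1}

theorem weingartenPoly_eq (u w : ℝ) : weingartenPoly 𝔮 𝔭 𝔣 𝔱 a b c u w =
    u • weingartenPoly 𝔮 𝔭 𝔣 𝔱 a b c 1 0 + w • weingartenPoly 𝔮 𝔭 𝔣 𝔱 a b c 0 1 := by
  refine Prod.ext (funext fun z => ?_) (funext fun z => ?_)
  · simp only [weingartenPoly, Prod.fst_add, Prod.smul_fst, Pi.add_apply, Pi.smul_apply]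
    module
  · simp only [weingartenPoly, Prod.snd_add, Prod.smul_snd, Pi.add_apply, Pi.smul_apply]
    module

theorem mem_weingartenPlane {p : LinPoly M} : p ∈ weingartenPlane 𝔮 𝔭 𝔣 𝔱 a b c ↔
    ∃ u w : ℝ, weingartenPoly 𝔮 𝔭 𝔣 𝔱 a b c u w = p := by
  simp only [weingartenPlane, Submodule.mem_span_pair, ← weingartenPoly_eq]

variable [TopologicalSpace M] [ChartedSpace E2 M] {f : M → Submodule ℝ R42}

theorem IsNonTubularProjection.gInf_poly (h : IsNonTubularProjection f 𝔮 𝔭 𝔣 𝔱 a b c) (x : M)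
    {u w u' w' : ℝ} {α β : weingartenPlane 𝔮 𝔭 𝔣 𝔱 a b c}
    (hα : (α : LinPoly M) = weingartenPoly 𝔮 𝔭 𝔣 𝔱 a b c u w)
    (hβ : (β : LinPoly M) = weingartenPoly 𝔮 𝔭 𝔣 𝔱 a b c u' w') :
    gInf (weingartenPlane 𝔮 𝔭 𝔣 𝔱 a b c) x α β =
      2 * (c * (u * u') - b * (u * w' + w * u') + a * (w * w')) := by
  have hp := h.projection
  have q1 : ip 𝔮 (𝔣 x) = -1 := by rw [ip_comm, hp.point_q]
  have q2 : ip 𝔭 (𝔣 x) = 0 := by rw [ip_comm, hp.point_p]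
  have q3 : ip 𝔮 (𝔱 x) = 0 := by rw [ip_comm, hp.plane_q]
  have q4 : ip 𝔭 (𝔱 x) = -1 := by rw [ip_comm, hp.plane_p]
  rw [gInf_apply, hα, hβ]
  simp only [weingartenPoly, map_add, map_smul, LinearMap.add_apply, LinearMap.smul_apply,
    smul_eq_mul, q1, q2, q3, q4]
  ring

/-- Since d𝔣 and d𝔱 are orthogonal to 𝔮 and 𝔭, applying η to u𝔮 + w𝔭 leaves exactly minus the
derivative of the top coefficient. The top coefficient itself lies in f, which η kills. -/
theorem IsNonTubularProjection.isLinearConserved [Nonempty M]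
    (h : IsNonTubularProjection f 𝔮 𝔭 𝔣 𝔱 a b c) (hf : IsLegendre f) {u w : ℝ}
    (h0 : weingartenPoly 𝔮 𝔭 𝔣 𝔱 a b c u w ≠ 0) :
    IsLinearConserved (weingartenPotential 𝔣 𝔱 a b c) (weingartenPoly 𝔮 𝔭 𝔣 𝔱 a b c u w) := by
  have hp := h.projection
  refine ⟨contMDiff_const, hp.smooth_comb _ _, fun hz => h0 ?_, fun t x X => ?_⟩
  · obtain ⟨x⟩ := ‹Nonempty M›
    have hx : (b * w - c * u) • 𝔣 x + (b * u - a * w) • 𝔱 x = 0 := congrFun hz x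
    have e1 : c * u - b * w = 0 := by
      simpa [hp.point_q, hp.plane_q] using congrArg (fun v => ip v 𝔮) hx
    have e2 : a * w - b * u = 0 := by
      simpa [hp.point_p, hp.plane_p] using congrArg (fun v => ip v 𝔭) hx
    -- The map from (u, w) to the top coefficient has determinant ±(b² - ac), so non-tubularity
    -- makes it injective.
    have hu : u = 0 := (mul_eq_zero.1 (show (b ^ 2 - a * c) * u = 0 by
      linear_combination -b * e2 - a * e1)).resolve_left h.nonTubular
    have hw : w = 0 := (mul_eq_zero.1 (show (b ^ 2 - a * c) * w = 0 by
      linear_combination -b * e1 - c * e2)).resolve_left h.nonTubular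
    rw [weingartenPoly_eq, hu, hw, zero_smul, zero_smul, add_zero]
  · have hm : (b * w - c * u) • 𝔣 x + (b * u - a * w) • 𝔱 x ∈ f x :=
      (hp.section_comb _ _).mem x (mem_univ x)
    have hk := wedge_apply_eq_zero (hf.null x) (hp.potential_mem hf a b c x X) hm
    have e : (fun y => evalAt t y (weingartenPoly 𝔮 𝔭 𝔣 𝔱 a b c u w)) = fun y =>
        (1 : ℝ) • (u • 𝔮 + w • 𝔭) + t • ((b * w - c * u) • 𝔣 y + (b * u - a * w) • 𝔱 y) := by
      funext y
      rw [evalAt_apply, one_smul]; rfl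
    have hc : MDifferentiableAt (𝓡 2) 𝓘(ℝ, R42) (fun _ : M => u • 𝔮 + w • 𝔭) x :=
      mdifferentiableAt_const
    rw [e, D_comb _ _ hc ((hp.section_comb _ _).mdifferentiableAt (mem_univ x)), D_const,
      D_comb _ _ (hp.mdiff_point x) (hp.mdiff_plane x), evalAt_apply]
    change _ + t • weingartenPotential 𝔣 𝔱 a b c x X ((u • 𝔮 + w • 𝔭) +
      t • ((b * w - c * u) • 𝔣 x + (b * u - a * w) • 𝔱 x)) = 0
    have f1 : ip (D 𝔣 x X) 𝔮 = 0 := IsProjection.ip_D_const (hp.mdiff_point x) hp.point_q X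
    have f2 : ip (D 𝔣 x X) 𝔭 = 0 := IsProjection.ip_D_const (hp.mdiff_point x) hp.point_p X
    have t1 : ip (D 𝔱 x X) 𝔮 = 0 := IsProjection.ip_D_const (hp.mdiff_plane x) hp.plane_q X
    have t2 : ip (D 𝔱 x X) 𝔭 = 0 := IsProjection.ip_D_const (hp.mdiff_plane x) hp.plane_p X
    rw [map_add, map_smul, hk, hp.potential_apply]
    simp only [_root_.add_apply, wedge_apply, map_add, map_smul, LinearMap.add_apply,
      LinearMap.smul_apply, f1, f2, t1, t2, hp.point_q, hp.point_p, hp.plane_q, hp.plane_p]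
    module

variable [IsManifold (𝓡 2) ∞ M]

theorem IsNonTubularProjection.isOmegaWithPlane [Nonempty M]
    (h : IsNonTubularProjection f 𝔮 𝔭 𝔣 𝔱 a b c) (hf : IsLegendre f) (hu : UmbilicFree f)
    (hd : Dense (immersedPoints 𝔣)) :
    IsOmegaWithPlane f (weingartenPotential 𝔣 𝔱 a b c) (weingartenPlane 𝔮 𝔭 𝔣 𝔱 a b c) := by
  have hp := h.projection
  refine ⟨h.isOmegaPotential hf hu hd, hp.potential_middle hf
    (weingartenForm_eq_zero h.weingarten hp.smooth_point hp.smooth_plane hd), ?_, ?_⟩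
  · have hli : LinearIndependent ℝ
        ![weingartenPoly 𝔮 𝔭 𝔣 𝔱 a b c 1 0, weingartenPoly 𝔮 𝔭 𝔣 𝔱 a b c 0 1] := by
      rw [LinearIndependent.pair_iff]
      intro s t e
      rw [← weingartenPoly_eq] at e
      obtain ⟨x⟩ := ‹Nonempty M›
      exact h.spaceForm.linearIndependent (congrFun (congrArg Prod.fst e) x)
    have hs := linearIndependent_iff_card_eq_finrank_span.1 hli
    have : Set.range ![weingartenPoly 𝔮 𝔭 𝔣 𝔱 a b c 1 0, weingartenPoly 𝔮 𝔭 𝔣 𝔱 a b c 0 1] =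
      {weingartenPoly 𝔮 𝔭 𝔣 𝔱 a b c 1 0, weingartenPoly 𝔮 𝔭 𝔣 𝔱 a b c 0 1} := by
      simp [Set.pair_comm]
    rw [Set.finrank, this] at hs
    exact hs.symm
  · intro p hpm h0
    obtain ⟨u, w, rfl⟩ := mem_weingartenPlane.1 hpm
    exact h.isLinearConserved hf h0

theorem IsNonTubularProjection.exists_plane [Nonempty M]
    (h : IsNonTubularProjection f 𝔮 𝔭 𝔣 𝔱 a b c) (hf : IsLegendre f) (hu : UmbilicFree f)
    (hd : Dense (immersedPoints 𝔣)) :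
    ∃ (η : OneForm M) (P : Submodule ℝ (LinPoly M)), IsOmegaWithPlane f η P ∧
      ∀ x : M, g P 0 x ≠ 0 ∧ (gInf P x).Nondegenerate ∧
        planeAtZero P x = Submodule.span ℝ {𝔮, 𝔭} ∧
        IsWeingartenClass P x (weingartenTensor 𝔮 𝔭 a b c) := by
  refine ⟨_, _, h.isOmegaWithPlane hf hu hd, fun x => ?_⟩
  have hp := h.projection
  have hmem : ∀ u w : ℝ, weingartenPoly 𝔮 𝔭 𝔣 𝔱 a b c u w ∈ weingartenPlane 𝔮 𝔭 𝔣 𝔱 a b c :=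
    fun u w => mem_weingartenPlane.2 ⟨u, w, rfl⟩
  let α : weingartenPlane 𝔮 𝔭 𝔣 𝔱 a b c := ⟨_, hmem 1 0⟩
  let β : weingartenPlane 𝔮 𝔭 𝔣 𝔱 a b c := ⟨_, hmem 0 1⟩
  have hgen : ∀ v : weingartenPlane 𝔮 𝔭 𝔣 𝔱 a b c, ∃ s t : ℝ, v = s • α + t • β := fun v => by
    obtain ⟨u, w, e⟩ := mem_weingartenPlane.1 v.2
    exact ⟨u, w, Subtype.ext (by rw [← e, weingartenPoly_eq]; rfl)⟩
  have hA : gInf _ x α α = 2 * c := by rw [h.gInf_poly x rfl rfl]; ring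
  have hB : gInf _ x α β = -2 * b := by rw [h.gInf_poly x rfl rfl]; ring
  have hB' : gInf _ x β α = -2 * b := by rw [h.gInf_poly x rfl rfl]; ring
  have hC : gInf _ x β β = 2 * a := by rw [h.gInf_poly x rfl rfl]; ring
  have hα0 : (α : LinPoly M).1 x = 𝔮 := by simp [α, weingartenPoly]
  have hβ0 : (β : LinPoly M).1 x = 𝔭 := by simp [β, weingartenPoly]
  refine ⟨fun h0 => ?_, ?_, ?_, ?_⟩
  · have := congrArg (fun B => B β β) h0
    simp only [g_apply, hβ0, zero_smul, add_zero, LinearMap.zero_apply] at this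
    rcases h.spaceForm.unit with e | e <;> rw [e] at this <;> norm_num at this
  · have hsymm : ∀ v w, gInf (weingartenPlane 𝔮 𝔭 𝔣 𝔱 a b c) x v w = gInf _ x w v := fun v w => by
      rw [gInf_apply, gInf_apply, add_comm]
    have hl : ∀ v, (∀ w, gInf (weingartenPlane 𝔮 𝔭 𝔣 𝔱 a b c) x v w = 0) → v = 0 := by
      intro v hv
      obtain ⟨s, t, rfl⟩ := hgen v
      have e1 := hv α
      have e2 := hv β
      simp only [map_add, map_smul, LinearMap.add_apply, LinearMap.smul_apply, smul_eq_mul, hA, hB,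
        hB', hC] at e1 e2
      have hs : s = 0 := (mul_eq_zero.1 (show (b ^ 2 - a * c) * s = 0 by
        linear_combination (-a / 2) * e1 + (-b / 2) * e2)).resolve_left h.nonTubular
      have ht : t = 0 := (mul_eq_zero.1 (show (b ^ 2 - a * c) * t = 0 by
        linear_combination (-b / 2) * e1 + (-c / 2) * e2)).resolve_left h.nonTubular
      rw [hs, ht]; simp
    exact ⟨hl, fun v hv => hl v fun w => by rw [hsymm, hv]⟩
  · ext v
    rw [mem_planeAtZero, Submodule.mem_span_pair]
    constructor
    · rintro ⟨p, hpm, rfl⟩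
      obtain ⟨u, w, rfl⟩ := mem_weingartenPlane.1 hpm
      exact ⟨u, w, rfl⟩
    · rintro ⟨u, w, rfl⟩
      exact ⟨_, hmem u w, rfl⟩
  · have hne := weingartenTensor_ne_zero (hp.point_q x) (hp.point_p x) (hp.plane_q x) (hp.plane_p x)
      h.weingarten.1
    have ea : 1 / 2 * (2 * a) = a := by ring
    have eb : 1 / 2 * -(-2 * b) = b := by ring
    have ec : 1 / 2 * (2 * c) = c := by ring
    -- The Gram matrix of g_∞ is 2(c, -b; -b, a), with adjugate 2(a, b; b, c); the factor 1/2
    -- restores W itself.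
    have hk := isWeingartenClass_of_gram hgen hA hB hC (k := 1 / 2)
      (by intro h0; exact h.nonTubular (by linear_combination (-1 / 4) * h0))
      (by rwa [ea, eb, ec, hα0, hβ0])
    rwa [ea, eb, ec, hα0, hβ0] at hk

end Conserved

end LieSphere

/-! ### The main theorem -/

theorem mainTheorem8 {M : Type*} [TopologicalSpace M] [T2Space M] [SecondCountableTopology M]
    [ConnectedSpace M] [ChartedSpace E2 M] [IsManifold (𝓡 2) ∞ M]
    (f : M → Submodule ℝ R42) (hf : IsLegendre f) (hu : UmbilicFree f) :
    -- the characterisation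
    ((∃ (𝔮 𝔭 : R42) (𝔣 𝔱 : M → R42) (a b c : ℝ),
        IsNonTubularProjection f 𝔮 𝔭 𝔣 𝔱 a b c ∧ Dense (immersedPoints 𝔣)) ↔
      ∃ (η : OneForm M) (P : Submodule ℝ (LinPoly M)), IsOmegaWithPlane f η P ∧
        ∀ x : M, g P 0 x ≠ 0 ∧ (gInf P x).Nondegenerate) ∧
    -- the metrics on `P` do not depend on the point, and `g_t = g_0 + t g_∞`
    (∀ (η : OneForm M) (P : Submodule ℝ (LinPoly M)), IsOmegaWithPlane f η P →
      (∀ (t : ℝ) (x y : M), g P t x = g P t y) ∧ (∀ x y : M, gInf P x = gInf P y) ∧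
      ∀ (t : ℝ) (x : M), g P t x = g P 0 x + t • gInf P x) ∧
    -- from linear Weingarten surfaces to conserved quantities
    (∀ (𝔮 𝔭 : R42) (𝔣 𝔱 : M → R42) (a b c : ℝ),
      IsNonTubularProjection f 𝔮 𝔭 𝔣 𝔱 a b c → Dense (immersedPoints 𝔣) →
      ∃ (η : OneForm M) (P : Submodule ℝ (LinPoly M)), IsOmegaWithPlane f η P ∧
        ∀ x : M, g P 0 x ≠ 0 ∧ (gInf P x).Nondegenerate ∧
          planeAtZero P x = Submodule.span ℝ {𝔮, 𝔭} ∧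
          IsWeingartenClass P x (weingartenTensor 𝔮 𝔭 a b c)) ∧
    -- from conserved quantities to linear Weingarten surfaces
    (∀ (η : OneForm M) (P : Submodule ℝ (LinPoly M)), IsOmegaWithPlane f η P →
      ∀ x : M, g P 0 x ≠ 0 → (gInf P x).Nondegenerate →
        (∃ 𝔮 ∈ planeAtZero P x, ∃ 𝔭 ∈ planeAtZero P x, IsSpaceForm 𝔮 𝔭) ∧
        ∀ 𝔮 ∈ planeAtZero P x, ∀ 𝔭 ∈ planeAtZero P x, IsSpaceForm 𝔮 𝔭 →
          ∃ (𝔣 𝔱 : M → R42) (a b c : ℝ), IsNonTubularProjection f 𝔮 𝔭 𝔣 𝔱 a b c ∧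
            IsWeingartenClass P x (weingartenTensor 𝔮 𝔭 a b c)) := by
  refine ⟨⟨?_, ?_⟩, fun η P h => h.metrics hf hu, fun 𝔮 𝔭 𝔣 𝔱 a b c h hd => h.exists_plane hf hu hd,
    fun η P h x hg hnd => ⟨?_, ?_⟩⟩
  · rintro ⟨𝔮, 𝔭, 𝔣, 𝔱, a, b, c, h, hd⟩
    obtain ⟨η, P, hP, hx⟩ := h.exists_plane hf hu hd
    exact ⟨η, P, hP, fun x => ⟨(hx x).1, (hx x).2.1⟩⟩
  · rintro ⟨η, P, hP, hx⟩
    obtain ⟨x⟩ : Nonempty M := inferInstance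
    -- An arbitrary space form in P(0) need not give a densely immersed projection, so a generic one
    -- is chosen here.
    exact hP.exists_dense_projection hf hu (hx x).1 (hx x).2
  · obtain ⟨α, hα, β, hβ, hs⟩ := h.exists_spaceForm hf hu hg
    exact ⟨_, mem_planeAtZero.2 ⟨α, hα, rfl⟩, _, mem_planeAtZero.2 ⟨β, hβ, rfl⟩, hs⟩
  · intro 𝔮 h𝔮 𝔭 h𝔭 hs
    obtain ⟨α, hα, rfl⟩ := mem_planeAtZero.1 h𝔮
    obtain ⟨β, hβ, rfl⟩ := mem_planeAtZero.1 h𝔭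
    exact h.exists_projection hf hu hnd hα hβ hs
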